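/- **Setting.** For integers $n\ge 1$, $m\ge 2$ let $\mathcal H_n$ be the space of $n\times n$ Hermitian matrices with the measure $d\mu(X)=\prod_i dx_{ii}\prod_{i<j}d(\mathrm{Re}\,x_{ij})\,d(\mathrm{Im}\,x_{ij})$, let $N=\int_{\mathcal H_n}e^{-\frac12\mathrm{tr}X^2}d\mu(X)$, and put $$Z_n(t,m)=\int_{\mathcal H_n}\exp\Big(-\tfrac12\mathrm{tr}X^2\Big)\exp\Big(\mathrm{tr}\sum_{j=3}^{2m}\frac{t_j}{j}X^j\Big)\frac{d\mu(X)}{N},$$ for $(t_3,\dots,t_{2m-1})\in\mathbb C^{2m-3}$ and $t_{2m}\in\Omega_\epsilon=\{\pi/2+\epsilon<\arg t<3\pi/2-\epsilon\}$, $0<\epsilon<\pi/2$. The integral converges and $Z_n(t,m)$ is holomorphic there. Its asymptotic expansion $\mathcal A(Z_n(t,m))$ is obtained by expanding $Z_n(t,m)$ as a convergent power series in $t_3,\dots,t_{2m-1}$ and then expanding each coefficient, a holomorphic function $h$ of $t_{2m}\in\Omega_\epsilon$, as an asymptotic series $\sum_v a_v t_{2m}^v$ at $0$, meaning that $\big(h(z)-\sum_{v=0}^{k}a_vz^v\big)/z^{k+1}\to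 a_{k+1}$ as $z\to0$ in $\Omega_\epsilon$, for all $k\ge0$. A *ribbon graph* $\Gamma$ is a finite graph (loops and multiple edges allowed) with a cyclic order on the set of half-edges at each vertex; $v_j(\Gamma)$ is its number of vertices of degree $j$, $\chi(\Gamma)$ is the number of vertices minus the number of edges, $b(\Gamma)$ is the number of boundary components of the oriented surface obtained by fattening $\Gamma$, and $\mathrm{Aut}(\Gamma)$ is the group of permutations of the half-edges that preserve the cyclic orders at the vertices and the pairing of half-edges into edges. Sums over ribbon graphs are over isomorphism classes, and the empty graph is not connected. **Theorem 2.5.** For each $m\ge2$ there is a unique element of $(\mathbb Q[n])[[t_3,\dots,t_{2m}]]$ whose value at every integer $n\ge1$ is the asymptotic expansion of $Z_n(t,m)$, for every $\epsilon\in(0,\pi/2)$; denote it by $\mathcal A(Z_n(t,m))$. It has constant term $1$, and with $\log$ the formal power series logarithm the following hold. 1. In $(\mathbb Q[n])[[t_3,\dots,t_{2m}]]$, $$\log\mathcal A(Z_n(t,m))=\sum_{\substack{\Gamma\text{ connected ribbon graph}\\ \text{with vertices of degree }3,\dots,2m}}\frac{1}{|\mathrm{Aut}(\Gamma)|}\,n^{b(\Gamma)}\prod_{j=3}^{2m}t_j^{v_j(\Gamma)},$$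 where each monomial in $t$ occurs for only finitely many $\Gamma$. 2. Regrouped by genus and number of boundary components, $$\log\mathcal A(Z_n(t,m))=\sum_{\substack{g\ge0,\ s>0\\2-2g-s<0}}\Bigg(\sum_{\substack{\Gamma\text{ connected ribbon graph}\\ \text{with vertices of degree }3,\dots,2m,\\ \chi(\Gamma)=2-2g-s,\ b(\Gamma)=s}}\frac{n^s}{|\mathrm{Aut}(\Gamma)|}\prod_{j=3}^{2m}t_j^{v_j(\Gamma)}\Bigg),$$ where every inner sum is finite. 3. Let $\deg t_j=j$, let $\mathfrak I_j$ be the ideal of the series in $(\mathbb Q[n])[[t_3,t_4,\dots]]$ all of whose terms have degree greater than $j$, and let $\pi_j$ be the projection modulo $\mathfrak I_j$. For each $j$ the image $\pi_j(\log\mathcal A(Z_n(t,m)))$ is the same for all $m\ge2$ with $2m\ge j$. There is a unique $L=\lim_{m\to\infty}\log\mathcal A(Z_n(t,m))\in(\mathbb Q[n])[[t_3,t_4,\dots]]$ with $\pi_{2m}(L)=\pi_{2m}(\log\mathcal A(Z_n(t,m)))$ for all $m\ge2$, and $$L=\sum_{\substack{g\ge0,\ s>0\\2-2g-s<0}}\Bigg(\sum_{\substack{\Gamma\text{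 connected ribbon graph}\\ \text{with vertices of degree }\ge3,\\ \chi(\Gamma)=2-2g-s,\ b(\Gamma)=s}}\frac{n^s}{|\mathrm{Aut}(\Gamma)|}\prod_{j\ge3}t_j^{v_j(\Gamma)}\Bigg),$$ where every inner sum is finite. -/

import Mathlib

open Polynomial

noncomputable section

/-! ### Ribbon graphs -/

/-- A ribbon graph without isolated vertices, presented by its half-edges: a finite set `H` of
half-edges, the fixed-point-free involution `opp` exchanging the two halves of every edge, and the
permutation `next` sending each half-edge to the one that follows it in the cyclic order at its
vertex. The vertices are the cycles of `next` (fixed points included) and the edges are the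
cycles of `opp`. Connectedness is not required. -/
structure RibbonGraph where
  H : Type
  finite_H : Finite H
  next : Equiv.Perm H
  opp : Equiv.Perm H
  opp_opp : ∀ h, opp (opp h) = h
  opp_ne : ∀ h, opp h ≠ h

namespace RibbonGraph

/-- The vertices: the cycles of `next`. -/
def Vertex (Γ : RibbonGraph) : Type := Quotient (Equiv.Perm.SameCycle.setoid Γ.next)

/-- The edges: the pairs of half-edges exchanged by `opp`. -/
def Edge (Γ : RibbonGraph) : Type := Quotient (Equiv.Perm.SameCycle.setoid Γ.opp)

/-- The boundary circuits of the fattened graph: walk along a half-edge to the other end of its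
edge, turn to the next half-edge there, and so on. They are the cycles of `next ∘ opp`. -/
def BoundaryCircuit (Γ : RibbonGraph) : Type :=
  Quotient (Equiv.Perm.SameCycle.setoid (Γ.next * Γ.opp))

/-- The vertex to which a half-edge is attached. -/
def vertexOf (Γ : RibbonGraph) (h : Γ.H) : Γ.Vertex :=
  Quotient.mk (Equiv.Perm.SameCycle.setoid Γ.next) h

/-- The degree of a vertex is the number of half-edges attached to it. -/
def degree (Γ : RibbonGraph) (v : Γ.Vertex) : ℕ := Nat.card {h : Γ.H // Γ.vertexOf h = v}

/-- `v_j(Γ)`, the number of vertices of degree `j`. -/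
def vertexCount (Γ : RibbonGraph) (j : ℕ) : ℕ := Nat.card {v : Γ.Vertex // Γ.degree v = j}

/-- `b(Γ)`, the number of boundary components. -/
def boundaryCount (Γ : RibbonGraph) : ℕ := Nat.card Γ.BoundaryCircuit

/-- The Euler characteristic of the underlying graph. -/
def eulerChar (Γ : RibbonGraph) : ℤ := (Nat.card Γ.Vertex : ℤ) - (Nat.card Γ.Edge : ℤ)

/-- Two vertices are adjacent when they are the endpoints of an edge. -/
def Adj (Γ : RibbonGraph) (v w : Γ.Vertex) : Prop :=
  ∃ h : Γ.H, Γ.vertexOf h = v ∧ Γ.vertexOf (Γ.opp h) = w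

/-- Connectedness of the underlying graph; the empty graph is not connected. -/
def Connected (Γ : RibbonGraph) : Prop :=
  Nonempty Γ.Vertex ∧ ∀ v w : Γ.Vertex, Relation.ReflTransGen Γ.Adj v w

/-- The automorphism group. The centralizer of `next` is the group
`∏_j 𝔖_{v_j} ⋉ (ℤ/jℤ)^{v_j}` of the permutations of the half-edges that permute the vertices of
each degree and rotate the half-edges at each vertex; it acts by conjugation on the pairings of
the half-edges, and the automorphism group is the isotropy subgroup of the pairing `opp`. -/
def Aut (Γ : RibbonGraph) : Subgroup (Equiv.Perm Γ.H) :=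
  Subgroup.centralizer {Γ.next, Γ.opp}

/-- Isomorphism of ribbon graphs. -/
def Iso (Γ Δ : RibbonGraph) : Prop :=
  ∃ e : Γ.H ≃ Δ.H, (∀ h, e (Γ.next h) = Δ.next (e h)) ∧ ∀ h, e (Γ.opp h) = Δ.opp (e h)

instance isoSetoid : Setoid RibbonGraph where
  r := Iso
  iseqv :=
    { refl := fun _ => ⟨Equiv.refl _, fun _ => rfl, fun _ => rfl⟩
      symm := fun {Γ Δ} ⟨e, h₁, h₂⟩ => ⟨e.symm,
        fun h => by rw [Equiv.symm_apply_eq, h₁, Equiv.apply_symm_apply],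
        fun h => by rw [Equiv.symm_apply_eq, h₂, Equiv.apply_symm_apply]⟩
      trans := fun {Γ Δ Θ} ⟨e, h₁, h₂⟩ ⟨f, k₁, k₂⟩ => ⟨e.trans f,
        fun h => by simp only [Equiv.trans_apply, h₁, k₁],
        fun h => by simp only [Equiv.trans_apply, h₂, k₂]⟩ }

theorem finite_vertex (Γ : RibbonGraph) : Finite Γ.Vertex :=
  have := Γ.finite_H
  inferInstanceAs (Finite (Quotient (Equiv.Perm.SameCycle.setoid Γ.next)))

theorem finite_support_vertexCount (Γ : RibbonGraph) :
    (Function.support Γ.vertexCount).Finite := by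
  have := Γ.finite_vertex
  refine (Set.finite_range Γ.degree).subset fun j hj => ?_
  by_contra h
  refine hj ?_
  have : IsEmpty {v : Γ.Vertex // Γ.degree v = j} := ⟨fun v => h ⟨v.1, v.2⟩⟩
  exact Nat.card_of_isEmpty

/-- The exponent vector `(v_j(Γ))_{j ∈ S}`. -/
def exponent (Γ : RibbonGraph) (S : Set ℕ) : S →₀ ℕ :=
  (Finsupp.ofSupportFinite Γ.vertexCount Γ.finite_support_vertexCount).subtypeDomain (· ∈ S)

/-- The term `|Aut Γ|⁻¹ n^{b(Γ)} ∏_{j ∈ S} t_j^{v_j(Γ)}` of `ℚ[n][[t_j : j ∈ S]]`; the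
polynomial variable plays the role of `n`. -/
def term (Γ : RibbonGraph) (S : Set ℕ) : MvPowerSeries S ℚ[X] :=
  MvPowerSeries.monomial (Γ.exponent S) (C (1 / (Nat.card Γ.Aut : ℚ)) * X ^ Γ.boundaryCount)

end RibbonGraph

/-- Isomorphism classes of ribbon graphs. All invariants of a class are those of a
representative `Γ.out`. -/
abbrev RibbonClass : Type 1 := Quotient RibbonGraph.isoSetoid

/-- The connected ribbon graphs all of whose vertices have degree in `S`. -/
def connectedGraphs (S : Set ℕ) : Set RibbonClass :=
  {Γ | Γ.out.Connected ∧ ∀ v : Γ.out.Vertex, Γ.out.degree v ∈ S}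

/-- The connected ribbon graphs with vertex degrees in `S`, Euler characteristic `2 - 2g - s` and
`s` boundary components, so that capping the boundary circuits by disks gives a closed surface of
genus `g`. -/
def connectedGraphsOfType (S : Set ℕ) (g s : ℕ) : Set RibbonClass :=
  {Γ ∈ connectedGraphs S |
    Γ.out.eulerChar = 2 - 2 * (g : ℤ) - (s : ℤ) ∧ Γ.out.boundaryCount = s}

/-- The pairs `(g, s)` with `g ≥ 0`, `s > 0` and `2 - 2g - s < 0`. -/
def stableTypes : Set (ℕ × ℕ) := {p | 0 < p.2 ∧ 2 - 2 * (p.1 : ℤ) - (p.2 : ℤ) < 0}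

/-- The sum of the terms of the connected ribbon graphs of type `(g, s)`. -/
def typeSum (S : Set ℕ) (g s : ℕ) : MvPowerSeries S ℚ[X] :=
  ∑ᶠ Γ ∈ connectedGraphsOfType S g s, (Quotient.out Γ).term S

/-! ### Formal power series -/

/-- `F` is the sum of the family `f` in a formal power series ring: every monomial occurs in only
finitely many members of the family, and coefficients are added. -/
def IsFormalSum {ι σ R : Type*} [CommRing R] (f : ι → MvPowerSeries σ R)
    (F : MvPowerSeries σ R) : Prop :=
  ∀ d : σ →₀ ℕ, {i | MvPowerSeries.coeff d (f i) ≠ 0}.Finite ∧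
    MvPowerSeries.coeff d F = ∑ᶠ i, MvPowerSeries.coeff d (f i)

/-- The formal logarithm `∑_{k ≥ 1} (-1)^{k+1} (F - 1)^k / k` of a series `F` with constant
term `1`. -/
def formalLog {σ R : Type*} [CommRing R] [Algebra ℚ R] (F : MvPowerSeries σ R) :
    MvPowerSeries σ R :=
  (PowerSeries.log R).subst (F - 1)

/-- The inclusion of `ℚ[n][[t_3, …, t_{2m}]]` in `ℚ[n][[t_3, t_4, …]]`. -/
def includeVars (m : ℕ) (F : MvPowerSeries (Set.Icc 3 (2 * m)) ℚ[X]) :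
    MvPowerSeries (Set.Ici 3) ℚ[X] :=
  MvPowerSeries.rename
    (Set.embeddingOfSubset (Set.Icc 3 (2 * m)) (Set.Ici 3) Set.Icc_subset_Ici_self) F

/-- The degree of a monomial, with `deg t_j = j`. -/
def tDegree (d : Set.Ici (3 : ℕ) →₀ ℕ) : ℕ := Finsupp.weight (fun j : Set.Ici (3 : ℕ) => j.1) d

/-- The ideal `𝔍_j` of the series in `ℚ[n][[t_3, t_4, …]]` all of whose terms have degree greater
than `j`. -/
def degreeIdeal (j : ℕ) : Ideal (MvPowerSeries (Set.Ici (3 : ℕ)) ℚ[X]) where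
  carrier := {F | ∀ d, tDegree d ≤ j → MvPowerSeries.coeff d F = 0}
  zero_mem' := fun _ _ => map_zero _
  add_mem' := fun {F G} hF hG d hd => by rw [map_add, hF d hd, hG d hd, add_zero]
  smul_mem' := fun c F hF d hd => by
    classical
    rw [smul_eq_mul, MvPowerSeries.coeff_mul]
    refine Finset.sum_eq_zero fun p hp => ?_
    have hle : tDegree p.2 ≤ j := by
      refine le_trans ?_ hd
      rw [← Finset.HasAntidiagonal.mem_antidiagonal.mp hp]
      unfold tDegree
      rw [map_add]
      exact Nat.le_add_left _ _
    rw [hF p.2 hle, mul_zero]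

/-- The projection `π_j` onto `ℚ[n][[t_3, t_4, …]] / 𝔍_j`. -/
def proj (j : ℕ) : MvPowerSeries (Set.Ici (3 : ℕ)) ℚ[X] →+*
    MvPowerSeries (Set.Ici (3 : ℕ)) ℚ[X] ⧸ degreeIdeal j :=
  Ideal.Quotient.mk (degreeIdeal j)

/-- `L` is the limit of the series `F m`, `m ≥ 2`: the element of
`lim_j ℚ[n][[t_3, t_4, …]] / 𝔍_j` given by the projections `π_{2m}(F m)`. -/
def IsSeriesLimit (F : ℕ → MvPowerSeries (Set.Ici (3 : ℕ)) ℚ[X])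
    (L : MvPowerSeries (Set.Ici (3 : ℕ)) ℚ[X]) : Prop :=
  ∀ m, 2 ≤ m → proj (2 * m) L = proj (2 * m) (F m)

/-! ### Asymptotic expansions -/

/-- The sector `π/2 + ε < arg z < 3π/2 - ε`. -/
def sector (ε : ℝ) : Set ℂ :=
  {z | ∃ r θ : ℝ, 0 < r ∧ Real.pi / 2 + ε < θ ∧ θ < 3 * Real.pi / 2 - ε ∧
    z = r * Complex.exp (θ * Complex.I)}

/-- `∑ a_v z^v` is the asymptotic expansion at `0` of the function `h`, holomorphic on `Ω`. -/
def IsAsymptoticExpansion (Ω : Set ℂ) (h : ℂ → ℂ) (a : ℕ → ℂ) : Prop :=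
  DifferentiableOn ℂ h Ω ∧ ∀ m : ℕ,
    Filter.Tendsto (fun z => (h z - ∑ v ∈ Finset.range (m + 1), a v * z ^ v) / z ^ (m + 1))
      (nhdsWithin 0 Ω) (nhds (a (m + 1)))

/-- The asymptotic expansion `A` of a function `Z` that is holomorphic for `t_top ∈ Ω` and
arbitrary values of the other variables. Expand `Z` as a convergent power series in the other
variables, with coefficients `c d` depending on `t_top`, and then each coefficient as an
asymptotic series in `t_top` on `Ω`. -/
def IsMixedExpansion {σ : Type*} [Fintype σ] (top : σ) (Ω : Set ℂ) (Z : (σ → ℂ) → ℂ)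
    (A : MvPowerSeries σ ℂ) : Prop :=
  DifferentiableOn ℂ Z {t | t top ∈ Ω} ∧
  ∃ c : {d : σ →₀ ℕ // d top = 0} → ℂ → ℂ,
    (∀ t : σ → ℂ, t top ∈ Ω → HasSum (fun d => c d (t top) * ∏ j, t j ^ d.1 j) (Z t)) ∧
    ∀ d, IsAsymptoticExpansion Ω (c d)
      (fun k => MvPowerSeries.coeff (d.1 + Finsupp.single top k) A)

/-! ### The Hermitian matrix integral -/

/-- The real coordinates `x_ii` and the complex coordinates `x_ij`, `i < j`, of a Hermitian
`n × n` matrix. The volume measure on this space is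
`∏ dx_ii ∏_{i<j} d(Re x_ij) d(Im x_ij)`. -/
abbrev HermitianCoord (n : ℕ) : Type :=
  (Fin n → ℝ) × ({p : Fin n × Fin n // p.1 < p.2} → ℂ)

/-- The Hermitian matrix with given coordinates. -/
def hermitianMatrix {n : ℕ} (x : HermitianCoord n) : Matrix (Fin n) (Fin n) ℂ :=
  Matrix.of fun i j =>
    if h : i < j then x.2 ⟨(i, j), h⟩
    else if h : j < i then starRingEnd ℂ (x.2 ⟨(j, i), h⟩)
    else (x.1 i : ℂ)

theorem isHermitian_hermitianMatrix {n : ℕ} (x : HermitianCoord n) :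
    (hermitianMatrix x).IsHermitian := by
  ext i j
  rcases lt_trichotomy i j with h | h | h
  · simp [hermitianMatrix, h, h.not_gt]
  · subst h; simp [hermitianMatrix]
  · simp [hermitianMatrix, h, h.not_gt]

/-- `exp(-½ tr X²)`. -/
def gaussianWeight {n : ℕ} (x : HermitianCoord n) : ℂ :=
  Complex.exp (-(1 / 2) * (hermitianMatrix x ^ 2).trace)

/-- `exp(-½ tr X²) exp(tr ∑_{j=3}^{2m} (t_j / j) X^j)`. -/
def matrixIntegrand (n m : ℕ) (t : Set.Icc 3 (2 * m) → ℂ) (x : HermitianCoord n) : ℂ :=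
  gaussianWeight x *
    Complex.exp (∑ j : Set.Icc 3 (2 * m), (t j / (j.1 : ℂ)) • hermitianMatrix x ^ j.1).trace

/-- The matrix integral `Z_n(t, m)`, normalized so that `Z_n(0, m) = 1`. -/
def matrixIntegral (n m : ℕ) (t : Set.Icc 3 (2 * m) → ℂ) : ℂ :=
  (∫ x : HermitianCoord n, matrixIntegrand n m t x) / ∫ x : HermitianCoord n, gaussianWeight x

/-- The index `2m` of the last variable `t_{2m}`. -/
def topVar (m : ℕ) (hm : 2 ≤ m) : Set.Icc 3 (2 * m) :=
  ⟨2 * m, by omega, le_refl _⟩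

/-- `A ∈ ℚ[n][[t_3, …, t_{2m}]]` is the asymptotic expansion of `Z_n(t, m)`: for every `n ≥ 1`,
its value at `n` is the asymptotic expansion, whatever the opening of the sector. -/
def IsExpansionOfMatrixIntegral (m : ℕ) (hm : 2 ≤ m)
    (A : MvPowerSeries (Set.Icc 3 (2 * m)) ℚ[X]) : Prop :=
  ∀ n : ℕ, 1 ≤ n → ∀ ε : ℝ, 0 < ε → ε < Real.pi / 2 →
    IsMixedExpansion (topVar m hm) (sector ε) (matrixIntegral n m)
      (MvPowerSeries.map (Polynomial.eval₂RingHom (algebraMap ℚ ℂ) (n : ℂ)) A)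

end

/-!
The coefficients of the matrix integral are Gaussian moments, Gaussian moments count ribbon graphs,
and the logarithm selects the connected ones.

*Combinatorics.* Let `graphSeries S` be the sum of `n ^ b(Γ) ∏ t_j ^ v_j(Γ) / N!` over all the
ribbon graph structures on `N` labelled half-edges, `N ≥ 0`. Splitting off the connected component
of a marked half-edge gives the recursion `RibbonStr.totalWeight_succ`, which says that
`D G = G * D C`, where `G = graphSeries S`, `C = connectedSeries S` is the same sum over connected
structures, and `D` is the derivation multiplying each monomial by its number of half-edges. As
`D (log G) = D G / G`, this proves `log G = C` (`formalLog_graphSeries`). By the orbit-stabilizer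
theorem an isomorphism class contributes `1 / |Aut Γ|` to `C` (`isFormalSum_connectedSeries`).

*Regrouping.* For a connected graph `2 - χ - b` is even and nonnegative
(`RibbonGraph.Connected.exists_genus`): evenness is a computation of the signs of `next`, `opp` and
`next * opp`, and the inequality compares the dimensions of the spaces of functions on the
half-edges invariant under these permutations. When all degrees are at least `3`, the Euler
characteristic bounds the number of half-edges, so there are finitely many graphs of each type.

*Analysis.* Integration by parts against the Gaussian weight gives Wick's theorem
(`integral_prod_apply_mul_gaussianWeight`): the mean of a product of matrix entries is a sum over
pairings of the factors. Applied to products of traces `tr X ^ j`, one for each cycle of a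
permutation `next`, every pairing `opp` contributes `n` to the number of cycles of `next * opp`;
summing over the permutations of a given cycle type identifies the moments of the variables
`tr X ^ j / j` with the coefficients of `graphSeries S` at `n` (`eval_coeff_graphSeries`). That
these moments are the mixed expansion of the integral is a general fact on exponential integrals
(`isMixedExpansion_integral_exp_sum`), whose domination hypothesis holds because
`Re ∑ (t_j / j) λ ^ j` is bounded above on the real line when `Re t_{2m} < 0`. Finally mixed
expansions are unique, and a polynomial is determined by its values at the positive integers
(`isExpansionOfMatrixIntegral_iff`).
-/

noncomputable section

/-! ### Cycles of permutations and equivariant injections -/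

/-- The number of cycles of a permutation, fixed points included. -/
def cycleCount {α : Type*} (σ : Equiv.Perm α) : ℕ :=
  Nat.card (Quotient (Equiv.Perm.SameCycle.setoid σ))

theorem SameCycle.apply_eq {α β : Type*} {σ : Equiv.Perm α} {f : α → β} (hf : ∀ x, f (σ x) = f x)
    {x y : α} (h : σ.SameCycle x y) : f x = f y := by
  obtain ⟨k, rfl⟩ := h
  induction k using Int.induction_on with
  | zero => rfl
  | succ k ih => rw [ih, add_comm, zpow_one_add, Equiv.Perm.mul_apply, hf]
  | pred k ih =>
    rw [ih, ← hf ((σ ^ (-(k : ℤ) - 1)) x), ← Equiv.Perm.mul_apply, ← zpow_one_add]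
    simp

section EquivariantInjection

variable {α β : Type*} {σ : Equiv.Perm α} {τ : Equiv.Perm β} {f : α → β}

theorem equivariant_zpow (hc : ∀ x, f (σ x) = τ (f x)) (k : ℤ) (x : α) :
    f ((σ ^ k) x) = (τ ^ k) (f x) := by
  induction k using Int.induction_on generalizing x with
  | zero => simp
  | succ k ih => rw [zpow_add_one, zpow_add_one, Equiv.Perm.mul_apply, Equiv.Perm.mul_apply, ih, hc]
  | pred k ih =>
    rw [zpow_sub_one, zpow_sub_one, Equiv.Perm.mul_apply, Equiv.Perm.mul_apply, ih]
    congr 1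
    rw [Equiv.Perm.eq_inv_iff_eq, ← hc]
    simp

theorem sameCycle_map_iff (hf : Function.Injective f) (hc : ∀ x, f (σ x) = τ (f x)) (x y : α) :
    τ.SameCycle (f x) (f y) ↔ σ.SameCycle x y := by
  refine exists_congr fun k => ?_
  rw [← equivariant_zpow hc, hf.eq_iff]

theorem SameCycle.mem_range (hc : ∀ x, f (σ x) = τ (f x)) {x : α} {z : β}
    (h : τ.SameCycle (f x) z) : z ∈ Set.range f := by
  obtain ⟨k, rfl⟩ := h
  exact ⟨(σ ^ k) x, equivariant_zpow hc k x⟩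

/-- The map on cycles induced by an equivariant injection. -/
def cycleMap (hf : Function.Injective f) (hc : ∀ x, f (σ x) = τ (f x)) :
    Quotient (Equiv.Perm.SameCycle.setoid σ) → Quotient (Equiv.Perm.SameCycle.setoid τ) :=
  Quotient.map f fun x y h => (sameCycle_map_iff hf hc x y).2 h

theorem cycleMap_injective (hf : Function.Injective f) (hc : ∀ x, f (σ x) = τ (f x)) :
    Function.Injective (cycleMap hf hc) := by
  rintro ⟨x⟩ ⟨y⟩ h
  exact Quotient.sound ((sameCycle_map_iff hf hc x y).1 (Quotient.exact h))

end EquivariantInjection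

theorem Nat.card_eq_add_of_injective {A B D : Type*} [Finite D] {f : A → D} {g : B → D}
    (hf : Function.Injective f) (hg : Function.Injective g) (hd : ∀ a b, f a ≠ g b)
    (hs : ∀ d, d ∈ Set.range f ∨ d ∈ Set.range g) : Nat.card D = Nat.card A + Nat.card B := by
  have := Finite.of_injective f hf
  have := Finite.of_injective g hg
  rw [← Nat.card_sum]
  refine (Nat.card_congr (Equiv.ofBijective (Sum.elim f g) ⟨hf.sumElim hg hd, fun d => ?_⟩)).symm
  rcases hs d with ⟨a, rfl⟩ | ⟨b, rfl⟩
  exacts [⟨Sum.inl a, rfl⟩, ⟨Sum.inr b, rfl⟩]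

theorem cycleCount_eq_add {α β γ : Type*} [Finite γ] {σ : Equiv.Perm α} {ρ : Equiv.Perm β}
    {τ : Equiv.Perm γ} {f : α → γ} {g : β → γ} (hf : Function.Injective f)
    (hg : Function.Injective g) (hcf : ∀ x, f (σ x) = τ (f x)) (hcg : ∀ x, g (ρ x) = τ (g x))
    (hd : ∀ a b, f a ≠ g b) (hs : ∀ d, d ∈ Set.range f ∨ d ∈ Set.range g) :
    cycleCount τ = cycleCount σ + cycleCount ρ := by
  refine Nat.card_eq_add_of_injective (cycleMap_injective hf hcf) (cycleMap_injective hg hcg) ?_ ?_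
  · rintro ⟨a⟩ ⟨b⟩ h
    obtain ⟨x, hx⟩ := SameCycle.mem_range hcf (Quotient.exact h : τ.SameCycle (f a) (g b))
    exact hd x b hx
  · rintro ⟨z⟩
    rcases hs z with ⟨a, rfl⟩ | ⟨b, rfl⟩
    exacts [Or.inl ⟨Quotient.mk _ a, rfl⟩, Or.inr ⟨Quotient.mk _ b, rfl⟩]

namespace RibbonGraph

instance (Γ : RibbonGraph) : Finite Γ.H := Γ.finite_H

instance (Γ : RibbonGraph) : Finite Γ.Vertex := Γ.finite_vertex

theorem card_vertex (Γ : RibbonGraph) : Nat.card Γ.Vertex = cycleCount Γ.next := rfl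

theorem card_edge (Γ : RibbonGraph) : Nat.card Γ.Edge = cycleCount Γ.opp := rfl

theorem boundaryCount_eq (Γ : RibbonGraph) : Γ.boundaryCount = cycleCount (Γ.next * Γ.opp) := rfl

theorem vertexOf_eq_iff (Γ : RibbonGraph) (h k : Γ.H) :
    Γ.vertexOf h = Γ.vertexOf k ↔ Γ.next.SameCycle h k :=
  ⟨fun e => Quotient.exact e, fun e => Quotient.sound e⟩

theorem vertexOf_surjective (Γ : RibbonGraph) : Function.Surjective Γ.vertexOf :=
  Quotient.mk_surjective

theorem vertexOf_next (Γ : RibbonGraph) (h : Γ.H) : Γ.vertexOf (Γ.next h) = Γ.vertexOf h :=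
  (Γ.vertexOf_eq_iff _ _).2 (Equiv.Perm.sameCycle_apply_left.2 (Equiv.Perm.SameCycle.refl _ _))

/-- An equivariant injection of half-edges, that is, the inclusion of a union of connected
components. -/
structure Emb (Γ Δ : RibbonGraph) where
  toFun : Γ.H → Δ.H
  inj : Function.Injective toFun
  map_next : ∀ h, toFun (Γ.next h) = Δ.next (toFun h)
  map_opp : ∀ h, toFun (Γ.opp h) = Δ.opp (toFun h)

namespace Emb

variable {Γ Δ : RibbonGraph} (f : Emb Γ Δ)

/-- The induced map on vertices. -/
def vertexMap : Γ.Vertex → Δ.Vertex := cycleMap f.inj f.map_next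

theorem vertexMap_injective : Function.Injective f.vertexMap := cycleMap_injective _ _

theorem vertexMap_vertexOf (h : Γ.H) : f.vertexMap (Γ.vertexOf h) = Δ.vertexOf (f.toFun h) := rfl

theorem degree_vertexMap (v : Γ.Vertex) : Δ.degree (f.vertexMap v) = Γ.degree v := by
  refine (Nat.card_congr (Equiv.ofBijective
    (fun h : {h : Γ.H // Γ.vertexOf h = v} => (⟨f.toFun h.1, by
      rw [← f.vertexMap_vertexOf, h.2]⟩ : {h : Δ.H // Δ.vertexOf h = f.vertexMap v}))
    ⟨fun a b h => Subtype.ext (f.inj (Subtype.ext_iff.1 h)), ?_⟩)).symm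
  rintro ⟨k, hk⟩
  obtain ⟨h, rfl⟩ := Γ.vertexOf_surjective v
  rw [f.vertexMap_vertexOf] at hk
  obtain ⟨x, rfl⟩ := SameCycle.mem_range f.map_next ((Δ.vertexOf_eq_iff _ _).1 hk.symm)
  refine ⟨⟨x, ?_⟩, rfl⟩
  rw [Δ.vertexOf_eq_iff, sameCycle_map_iff f.inj f.map_next] at hk
  exact (Γ.vertexOf_eq_iff _ _).2 hk

theorem mem_range_vertexMap (k : Δ.H) (hk : k ∈ Set.range f.toFun) :
    Δ.vertexOf k ∈ Set.range f.vertexMap := by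
  obtain ⟨h, rfl⟩ := hk
  exact ⟨Γ.vertexOf h, rfl⟩

/-- The map on the vertices of degree `j`. -/
def vertexMapOfDegree (j : ℕ) (v : {v : Γ.Vertex // Γ.degree v = j}) :
    {v : Δ.Vertex // Δ.degree v = j} := ⟨f.vertexMap v.1, by rw [f.degree_vertexMap, v.2]⟩

theorem vertexMapOfDegree_injective (j : ℕ) : Function.Injective (f.vertexMapOfDegree j) :=
  fun _ _ h => Subtype.ext (f.vertexMap_injective (Subtype.ext_iff.1 h))

theorem map_next_opp (h : Γ.H) :
    f.toFun ((Γ.next * Γ.opp) h) = (Δ.next * Δ.opp) (f.toFun h) := by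
  rw [Equiv.Perm.mul_apply, Equiv.Perm.mul_apply, f.map_next, f.map_opp]

end Emb

section Union

variable {Γ Γ' Δ : RibbonGraph} (f : Emb Γ Δ) (g : Emb Γ' Δ)

theorem vertexMap_disjoint (hd : ∀ a b, f.toFun a ≠ g.toFun b) (v : Γ.Vertex) (w : Γ'.Vertex) :
    f.vertexMap v ≠ g.vertexMap w := by
  obtain ⟨a, rfl⟩ := Γ.vertexOf_surjective v
  obtain ⟨b, rfl⟩ := Γ'.vertexOf_surjective w
  intro h
  rw [f.vertexMap_vertexOf, g.vertexMap_vertexOf, Δ.vertexOf_eq_iff] at h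
  obtain ⟨x, hx⟩ := SameCycle.mem_range f.map_next h
  exact hd x b hx

theorem vertexMap_cover (hs : ∀ d, d ∈ Set.range f.toFun ∨ d ∈ Set.range g.toFun)
    (v : Δ.Vertex) : v ∈ Set.range f.vertexMap ∨ v ∈ Set.range g.vertexMap := by
  obtain ⟨a, rfl⟩ := Δ.vertexOf_surjective v
  exact (hs a).imp (f.mem_range_vertexMap a) (g.mem_range_vertexMap a)

variable (hd : ∀ a b, f.toFun a ≠ g.toFun b)
  (hs : ∀ d, d ∈ Set.range f.toFun ∨ d ∈ Set.range g.toFun)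
include hd hs

theorem vertexCount_union (j : ℕ) : Δ.vertexCount j = Γ.vertexCount j + Γ'.vertexCount j := by
  refine Nat.card_eq_add_of_injective (f.vertexMapOfDegree_injective j)
    (g.vertexMapOfDegree_injective j)
    (fun a b h => vertexMap_disjoint f g hd a.1 b.1 (Subtype.ext_iff.1 h)) ?_
  rintro ⟨v, hv⟩
  rcases vertexMap_cover f g hs v with ⟨w, rfl⟩ | ⟨w, rfl⟩
  · exact Or.inl ⟨⟨w, by rw [← hv, f.degree_vertexMap]⟩, rfl⟩
  · exact Or.inr ⟨⟨w, by rw [← hv, g.degree_vertexMap]⟩, rfl⟩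

theorem boundaryCount_union : Δ.boundaryCount = Γ.boundaryCount + Γ'.boundaryCount :=
  cycleCount_eq_add f.inj g.inj f.map_next_opp g.map_next_opp hd hs

omit hd in
theorem degree_mem_union (S : Set ℕ) :
    (∀ v, Δ.degree v ∈ S) ↔ (∀ v, Γ.degree v ∈ S) ∧ ∀ v, Γ'.degree v ∈ S := by
  refine ⟨fun h => ⟨fun v => f.degree_vertexMap v ▸ h _, fun v => g.degree_vertexMap v ▸ h _⟩,
    fun h v => ?_⟩
  rcases vertexMap_cover f g hs v with ⟨w, rfl⟩ | ⟨w, rfl⟩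
  · rw [f.degree_vertexMap]; exact h.1 w
  · rw [g.degree_vertexMap]; exact h.2 w

theorem exponent_union (S : Set ℕ) : Δ.exponent S = Γ.exponent S + Γ'.exponent S := by
  ext j
  exact vertexCount_union f g hd hs j

end Union

theorem exponent_apply (Γ : RibbonGraph) (S : Set ℕ) (j : S) :
    Γ.exponent S j = Γ.vertexCount j := rfl

/-- The empty ribbon graph. -/
def empty : RibbonGraph := ⟨Empty, inferInstance, 1, 1, fun h => h.elim, fun h => h.elim⟩

instance : IsEmpty empty.H := inferInstanceAs (IsEmpty Empty)

instance : IsEmpty empty.Vertex :=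
  ⟨fun v => by obtain ⟨h, -⟩ := empty.vertexOf_surjective v; exact isEmptyElim h⟩

theorem boundaryCount_of_isEmpty (Γ : RibbonGraph) [IsEmpty Γ.H] : Γ.boundaryCount = 0 := by
  have : IsEmpty Γ.BoundaryCircuit := ⟨by rintro ⟨h⟩; exact isEmptyElim h⟩
  exact Nat.card_of_isEmpty

theorem exponent_of_isEmpty (Γ : RibbonGraph) [IsEmpty Γ.H] (S : Set ℕ) : Γ.exponent S = 0 := by
  ext j
  have : IsEmpty Γ.Vertex :=
    ⟨fun v => by obtain ⟨h, -⟩ := Γ.vertexOf_surjective v; exact isEmptyElim h⟩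
  exact Nat.card_of_isEmpty

/-! ### Invariance under isomorphism -/

section Iso

variable {Γ Δ : RibbonGraph}

theorem Iso.exists_emb (h : Iso Γ Δ) : ∃ f : Emb Γ Δ, Function.Bijective f.toFun := by
  obtain ⟨e, h₁, h₂⟩ := h
  exact ⟨⟨e, e.injective, h₁, h₂⟩, e.bijective⟩

theorem Iso.vertexCount_boundaryCount_degree (h : Iso Γ Δ) :
    (∀ j, Δ.vertexCount j = Γ.vertexCount j) ∧ Δ.boundaryCount = Γ.boundaryCount ∧
      ∀ S : Set ℕ, (∀ v, Δ.degree v ∈ S) ↔ ∀ v, Γ.degree v ∈ S := by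
  obtain ⟨f, hf⟩ := h.exists_emb
  let g : Emb empty Δ := ⟨fun h => isEmptyElim h, fun h => isEmptyElim h,
    fun h => isEmptyElim h, fun h => isEmptyElim h⟩
  have hd : ∀ a b, f.toFun a ≠ g.toFun b := fun _ b => isEmptyElim b
  have hs : ∀ d, d ∈ Set.range f.toFun ∨ d ∈ Set.range g.toFun := fun d => Or.inl (hf.2 d)
  refine ⟨fun j => ?_, ?_, fun S => ?_⟩
  · rw [vertexCount_union f g hd hs, add_eq_left]
    exact Nat.card_of_isEmpty
  · rw [boundaryCount_union f g hd hs, boundaryCount_of_isEmpty empty, add_zero]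
  · rw [degree_mem_union f g hs S]
    exact and_iff_left fun v => isEmptyElim v

theorem Iso.boundaryCount_eq (h : Iso Γ Δ) : Δ.boundaryCount = Γ.boundaryCount :=
  h.vertexCount_boundaryCount_degree.2.1

theorem Iso.exponent_eq (h : Iso Γ Δ) (S : Set ℕ) : Δ.exponent S = Γ.exponent S := by
  ext j
  exact h.vertexCount_boundaryCount_degree.1 j

theorem Iso.degree_mem_iff (h : Iso Γ Δ) (S : Set ℕ) :
    (∀ v, Δ.degree v ∈ S) ↔ ∀ v, Γ.degree v ∈ S := h.vertexCount_boundaryCount_degree.2.2 S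

end Iso

/-! ### Connectedness in terms of half-edges -/

/-- A set of half-edges that is a union of connected components. -/
def IsClosed (Γ : RibbonGraph) (K : Set Γ.H) : Prop :=
  (∀ h, Γ.next h ∈ K ↔ h ∈ K) ∧ ∀ h, Γ.opp h ∈ K ↔ h ∈ K

theorem IsClosed.compl {Γ : RibbonGraph} {K : Set Γ.H} (hK : Γ.IsClosed K) : Γ.IsClosed Kᶜ :=
  ⟨fun h => not_congr (hK.1 h), fun h => not_congr (hK.2 h)⟩

theorem IsClosed.mem_iff_of_sameCycle {Γ : RibbonGraph} {K : Set Γ.H} (hK : Γ.IsClosed K)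
    {h k : Γ.H} (hs : Γ.next.SameCycle h k) : h ∈ K ↔ k ∈ K :=
  iff_of_eq (SameCycle.apply_eq (f := fun x => x ∈ K) (fun x => propext (hK.1 x)) hs)

theorem Emb.isClosed_image {Γ Δ : RibbonGraph} (f : Emb Γ Δ) {K : Set Γ.H} (hK : Γ.IsClosed K) :
    Δ.IsClosed (f.toFun '' K) := by
  refine ⟨fun k => ⟨?_, ?_⟩, fun k => ⟨?_, ?_⟩⟩
  · rintro ⟨y, hy, hyk⟩
    refine ⟨Γ.next.symm y, (hK.1 _).1 (by rwa [Equiv.apply_symm_apply]), Δ.next.injective ?_⟩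
    rw [← f.map_next, Equiv.apply_symm_apply, hyk]
  · rintro ⟨y, hy, rfl⟩
    exact ⟨Γ.next y, (hK.1 y).2 hy, f.map_next y⟩
  · rintro ⟨y, hy, hyk⟩
    refine ⟨Γ.opp.symm y, (hK.2 _).1 (by rwa [Equiv.apply_symm_apply]), Δ.opp.injective ?_⟩
    rw [← f.map_opp, Equiv.apply_symm_apply, hyk]
  · rintro ⟨y, hy, rfl⟩
    exact ⟨Γ.opp y, (hK.2 y).2 hy, f.map_opp y⟩

/-- The half-edges of the connected component of `h`. -/
def component (Γ : RibbonGraph) (h : Γ.H) : Set Γ.H := {k | ∀ K, Γ.IsClosed K → h ∈ K → k ∈ K}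

theorem isClosed_component (Γ : RibbonGraph) (h : Γ.H) : Γ.IsClosed (Γ.component h) :=
  ⟨fun k => forall₂_congr fun K hK => by rw [hK.1],
    fun k => forall₂_congr fun K hK => by rw [hK.2]⟩

theorem mem_component_self (Γ : RibbonGraph) (h : Γ.H) : h ∈ Γ.component h := fun _ _ h => h

/-- Connectedness of the underlying graph is transitivity of the action of the group generated by
`next` and `opp` on the nonempty set of half-edges. -/
theorem connected_iff (Γ : RibbonGraph) :
    Γ.Connected ↔ Nonempty Γ.H ∧ ∀ K, Γ.IsClosed K → K.Nonempty → K = Set.univ := by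
  constructor
  · rintro ⟨⟨v⟩, hc⟩
    refine ⟨⟨(Γ.vertexOf_surjective v).choose⟩,
      fun K hK ⟨k, hk⟩ => Set.eq_univ_of_forall fun h => ?_⟩
    have key : ∀ w, Relation.ReflTransGen Γ.Adj (Γ.vertexOf k) w →
        ∀ h, Γ.vertexOf h = w → h ∈ K := by
      intro w hw
      induction hw with
      | refl =>
        intro h hh
        rwa [hK.mem_iff_of_sameCycle ((Γ.vertexOf_eq_iff _ _).1 hh)]
      | tail _ hbc ih =>
        intro h hh
        obtain ⟨x, hx, rfl⟩ := hbc
        rw [hK.mem_iff_of_sameCycle ((Γ.vertexOf_eq_iff _ _).1 hh), hK.2]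
        exact ih x hx
    exact key _ (hc _ _) h rfl
  · rintro ⟨⟨h⟩, hK⟩
    refine ⟨⟨Γ.vertexOf h⟩, fun v w => ?_⟩
    obtain ⟨a, rfl⟩ := Γ.vertexOf_surjective v
    obtain ⟨b, rfl⟩ := Γ.vertexOf_surjective w
    have hcl : Γ.IsClosed {k | Relation.ReflTransGen Γ.Adj (Γ.vertexOf a) (Γ.vertexOf k)} :=
      ⟨fun k => by simp only [Set.mem_ofPred_eq, vertexOf_next],
        fun k => ⟨fun hk => hk.tail ⟨Γ.opp k, rfl, by rw [Γ.opp_opp]⟩,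
          fun hk => hk.tail ⟨k, rfl, rfl⟩⟩⟩
    have := hK _ hcl ⟨a, Relation.ReflTransGen.refl⟩
    exact (this ▸ Set.mem_univ b : b ∈ {k | _})

theorem connected_iff_component (Γ : RibbonGraph) (h : Γ.H) :
    Γ.Connected ↔ Γ.component h = Set.univ := by
  rw [connected_iff]
  constructor
  · exact fun hc => hc.2 _ (Γ.isClosed_component h) ⟨h, Γ.mem_component_self h⟩
  · refine fun hc => ⟨⟨h⟩, fun K hK ⟨k, hk⟩ => ?_⟩
    have hh : h ∈ K := by
      by_contra hh
      exact (hc ▸ Set.mem_univ k : k ∈ Γ.component h) _ hK.compl hh hk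
    exact Set.eq_univ_of_forall fun x => (hc ▸ Set.mem_univ x : x ∈ Γ.component h) K hK hh

theorem Iso.connected {Γ Δ : RibbonGraph} (h : Iso Γ Δ) (hc : Γ.Connected) : Δ.Connected := by
  obtain ⟨e, h₁, h₂⟩ := h
  rw [connected_iff] at hc ⊢
  obtain ⟨⟨x⟩, hc⟩ := hc
  refine ⟨⟨e x⟩, fun K hK ⟨k, hk⟩ => ?_⟩
  have := hc (e ⁻¹' K) ⟨fun h => by rw [Set.mem_preimage, h₁, hK.1, Set.mem_preimage],
    fun h => by rw [Set.mem_preimage, h₂, hK.2, Set.mem_preimage]⟩ ⟨e.symm k, by simpa⟩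
  exact Set.eq_univ_of_forall fun y => by
    simpa using (this ▸ Set.mem_univ (e.symm y) : e.symm y ∈ e ⁻¹' K)

theorem Iso.connected_iff {Γ Δ : RibbonGraph} (h : Iso Γ Δ) : Δ.Connected ↔ Γ.Connected :=
  ⟨fun hc => Iso.connected (isoSetoid.symm h) hc, fun hc => h.connected hc⟩

/-! ### The number of half-edges -/

theorem card_eq_sum_degree (Γ : RibbonGraph) : Nat.card Γ.H = ∑ᶠ v, Γ.degree v := by
  have := Fintype.ofFinite Γ.Vertex
  rw [finsum_eq_sum_of_fintype, ← Nat.card_congr (Equiv.sigmaFiberEquiv Γ.vertexOf), Nat.card_sigma]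
  rfl

/-- The number of half-edges, `∑ j v_j`, of a graph with exponent vector `d`. -/
def halfEdges {S : Set ℕ} (d : S →₀ ℕ) : ℕ := d.sum fun j k => j.1 * k

theorem halfEdges_add {S : Set ℕ} (d e : S →₀ ℕ) : halfEdges (d + e) = halfEdges d + halfEdges e :=
  Finsupp.sum_add_index' (fun _ => by simp) fun _ _ _ => mul_add _ _ _

theorem card_eq_halfEdges (Γ : RibbonGraph) {S : Set ℕ} (hS : ∀ v, Γ.degree v ∈ S) :
    Nat.card Γ.H = halfEdges (Γ.exponent S) := by
  classical
  have := Fintype.ofFinite Γ.Vertex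
  rw [card_eq_sum_degree, finsum_eq_sum_of_fintype, halfEdges, Finsupp.sum,
    ← Finset.sum_fiberwise_of_maps_to (s := Finset.univ) (t := (Γ.exponent S).support)
      (g := fun v => (⟨Γ.degree v, hS v⟩ : S))]
  · refine Finset.sum_congr rfl fun j _ => ?_
    rw [Finset.sum_congr rfl (g := fun _ => j.1) fun v hv => by
      rw [← (Finset.mem_filter.1 hv).2], Finset.sum_const, smul_eq_mul, mul_comm, exponent_apply,
      vertexCount, Nat.card_eq_fintype_card, Fintype.card_subtype]
    congr 3
    ext v
    exact Subtype.ext_iff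
  · intro v _
    rw [Finsupp.mem_support_iff, exponent_apply, vertexCount]
    have : Nonempty {w : Γ.Vertex // Γ.degree w = Γ.degree v} := ⟨⟨v, rfl⟩⟩
    exact Nat.card_pos.ne'

end RibbonGraph

/-! ### The formal logarithm -/

/-- The derivation of a power series ring multiplying every monomial by its weight. -/
def weightDerivation {σ R : Type*} [CommRing R] (wt : (σ →₀ ℕ) →+ ℕ) :
    Derivation R (MvPowerSeries σ R) (MvPowerSeries σ R) :=
  Derivation.mk'
    { toFun := fun F d => (wt d : R) * MvPowerSeries.coeff d F
      map_add' := fun F G => by funext d; exact mul_add _ _ _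
      map_smul' := fun r F => by
        funext d
        exact mul_left_comm _ _ _ }
    fun F G => by
      classical
      ext d
      change (wt d : R) * MvPowerSeries.coeff d (F * G) = _
      rw [map_add, smul_eq_mul, smul_eq_mul, mul_comm G, MvPowerSeries.coeff_mul,
        MvPowerSeries.coeff_mul, MvPowerSeries.coeff_mul, Finset.mul_sum, ← Finset.sum_add_distrib]
      refine Finset.sum_congr rfl fun p hp => ?_
      rw [← Finset.HasAntidiagonal.mem_antidiagonal.mp hp, map_add, Nat.cast_add]
      change _ = _ * ((wt p.2 : R) * _) + ((wt p.1 : R) * _) * _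
      ring

theorem coeff_weightDerivation {σ R : Type*} [CommRing R] (wt : (σ →₀ ℕ) →+ ℕ)
    (F : MvPowerSeries σ R) (d : σ →₀ ℕ) :
    MvPowerSeries.coeff d (weightDerivation wt F) = wt d * MvPowerSeries.coeff d F := rfl

theorem coeff_pow_eq_zero {σ R : Type*} [CommRing R] {g : MvPowerSeries σ R}
    (hg : MvPowerSeries.constantCoeff g = 0) {d : σ →₀ ℕ} {k : ℕ} (hk : d.degree < k) :
    MvPowerSeries.coeff d (g ^ k) = 0 :=
  MvPowerSeries.coeff_of_lt_order (lt_of_lt_of_le (by exact_mod_cast hk)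
    (MvPowerSeries.le_order_pow_of_constantCoeff_eq_zero k hg))

theorem coeff_mul_congr {σ R : Type*} [CommRing R] {F F' G : MvPowerSeries σ R} {d : σ →₀ ℕ}
    (h : ∀ e ≤ d, MvPowerSeries.coeff e F = MvPowerSeries.coeff e F') :
    MvPowerSeries.coeff d (F * G) = MvPowerSeries.coeff d (F' * G) := by
  classical
  rw [MvPowerSeries.coeff_mul, MvPowerSeries.coeff_mul]
  refine Finset.sum_congr rfl fun p hp => ?_
  rw [h p.1]
  rw [← Finset.HasAntidiagonal.mem_antidiagonal.mp hp]
  exact le_self_add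

section FormalLog

variable {σ R : Type*} [CommRing R] [Algebra ℚ R]

theorem coeff_formalLog {F : MvPowerSeries σ R} (hF : MvPowerSeries.constantCoeff F = 1)
    {d : σ →₀ ℕ} {M : ℕ} (hM : d.degree < M) :
    MvPowerSeries.coeff d (formalLog F) = MvPowerSeries.coeff d
      (∑ k ∈ Finset.range M, PowerSeries.coeff k (PowerSeries.log R) • (F - 1) ^ k) := by
  have h0 : MvPowerSeries.constantCoeff (F - 1) = 0 := by rw [map_sub, hF, map_one, sub_self]
  rw [formalLog, PowerSeries.coeff_subst (PowerSeries.HasSubst.of_constantCoeff_zero h0), map_sum]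
  rw [finsum_eq_sum_of_support_subset (s := Finset.range M)]
  · simp only [MvPowerSeries.coeff_smul, smul_eq_mul]
  · intro k hk
    rw [Finset.coe_range, Set.mem_Iio]
    by_contra hlt
    refine hk ?_
    dsimp only
    rw [coeff_pow_eq_zero h0 (by omega), smul_zero]

theorem constantCoeff_formalLog {F : MvPowerSeries σ R} (hF : MvPowerSeries.constantCoeff F = 1) :
    MvPowerSeries.constantCoeff (formalLog F) = 0 := by
  rw [← MvPowerSeries.coeff_zero_eq_constantCoeff_apply, coeff_formalLog hF (M := 1) (by simp)]
  simp

/-- The logarithmic derivative: `D (log F) · F = D F`. The identity is checked coefficientwise,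
where the logarithm may be replaced by a polynomial in `F - 1` and the product telescopes. -/
theorem weightDerivation_formalLog_mul (wt : (σ →₀ ℕ) →+ ℕ) {F : MvPowerSeries σ R}
    (hF : MvPowerSeries.constantCoeff F = 1) :
    weightDerivation wt (formalLog F) * F = weightDerivation wt F := by
  ext d
  have h0 : MvPowerSeries.constantCoeff (F - 1) = 0 := by rw [map_sub, hF, map_one, sub_self]
  set g := F - 1 with hg
  set D : Derivation R (MvPowerSeries σ R) (MvPowerSeries σ R) := weightDerivation wt
  have hFg : F = 1 + g := by rw [hg]; ring
  have hDF : D F = D g := by rw [hFg, map_add, Derivation.map_one_eq_zero, zero_add]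
  set M := d.degree + 1 with hM
  set P := ∑ k ∈ Finset.range (M + 1), PowerSeries.coeff k (PowerSeries.log R) • g ^ k with hP
  have hDP : D P = (∑ k ∈ Finset.range M, (-g) ^ k) * D g := by
    have h00 : D (PowerSeries.coeff 0 (PowerSeries.log R) • g ^ 0) = 0 := by simp
    rw [hP, map_sum, Finset.sum_range_succ', Finset.sum_mul, h00, add_zero]
    refine Finset.sum_congr rfl fun k _ => ?_
    rw [Derivation.map_smul, PowerSeries.coeff_log, Derivation.leibniz_pow, Nat.add_sub_cancel,
      if_neg (Nat.succ_ne_zero k),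
      ← Nat.cast_smul_eq_nsmul R (k + 1), smul_smul, smul_eq_mul]
    have : (algebraMap ℚ R) ((-1) ^ (k + 1 + 1) / ((k + 1 : ℕ) : ℚ)) * ((k + 1 : ℕ) : R) =
        (-1) ^ k := by
      rw [← map_natCast (algebraMap ℚ R), ← map_mul, div_mul_cancel₀ _ (by positivity), pow_add,
        pow_add, map_mul, map_mul]
      simp
    rw [this, neg_pow g, MvPowerSeries.smul_eq_C_mul, map_pow, map_neg, map_one, mul_assoc]
  have hcongr : MvPowerSeries.coeff d (D (formalLog F) * F) = MvPowerSeries.coeff d (D P * F) := by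
    refine coeff_mul_congr fun e he => ?_
    rw [coeff_weightDerivation, coeff_weightDerivation, coeff_formalLog hF (M := M + 1)]
    exact lt_of_le_of_lt (Finsupp.degree_mono he) (by omega)
  have htel : (∑ k ∈ Finset.range M, (-g) ^ k) * (1 + g) = 1 - (-g) ^ M := by
    rw [← geom_sum_mul_neg, sub_neg_eq_add]
  rw [hcongr, hDP, hDF, mul_right_comm, hFg, htel, sub_mul, one_mul, map_sub, sub_eq_self]
  have hz : MvPowerSeries.coeff d ((-g) ^ M * D g) = MvPowerSeries.coeff d (0 * D g) := by
    refine coeff_mul_congr fun e he => ?_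
    rw [coeff_pow_eq_zero (by rw [map_neg, h0, neg_zero]), map_zero]
    exact lt_of_le_of_lt (Finsupp.degree_mono he) (by omega)
  rw [hz, zero_mul, map_zero]

/-- A series with zero constant term whose derivative is the logarithmic derivative of `F` is
`log F`. -/
theorem formalLog_eq_of_weightDerivation_mul (wt : (σ →₀ ℕ) →+ ℕ) (hwt : ∀ d, wt d = 0 → d = 0)
    {F G : MvPowerSeries σ R} (hF : MvPowerSeries.constantCoeff F = 1)
    (hG : MvPowerSeries.constantCoeff G = 0)
    (h : weightDerivation wt G * F = weightDerivation wt F) : formalLog F = G := by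
  have hu : IsUnit F := by
    rw [MvPowerSeries.isUnit_iff_constantCoeff, hF]
    exact isUnit_one
  have hD : weightDerivation wt (formalLog F) = weightDerivation wt G :=
    hu.mul_right_cancel ((weightDerivation_formalLog_mul wt hF).trans h.symm)
  ext d
  by_cases hd : d = 0
  · rw [hd, MvPowerSeries.coeff_zero_eq_constantCoeff_apply,
      MvPowerSeries.coeff_zero_eq_constantCoeff_apply, hG, constantCoeff_formalLog hF]
  · have := congrArg (MvPowerSeries.coeff d) hD
    rw [coeff_weightDerivation, coeff_weightDerivation] at this
    have hunit : IsUnit ((wt d : R)) := by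
      rw [← map_natCast (algebraMap ℚ R)]
      exact (IsUnit.mk0 _ (Nat.cast_ne_zero.2 fun hw => hd (hwt d hw))).map _
    exact hunit.mul_left_cancel this

end FormalLog

/-! ### Labelled ribbon graphs and the exponential formula -/

/-- The ribbon graph structures on a given set of half-edges. -/
def RibbonStr (H : Type) : Type :=
  {p : Equiv.Perm H × Equiv.Perm H // (∀ h, p.2 (p.2 h) = h) ∧ ∀ h, p.2 h ≠ h}

namespace RibbonStr

open RibbonGraph

variable {H : Type} [Finite H]

instance : Finite (RibbonStr H) := inferInstanceAs (Finite (Subtype _))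

instance : Fintype (RibbonStr H) := Fintype.ofFinite _

/-- The ribbon graph given by a structure on `H`. -/
def graph (r : RibbonStr H) : RibbonGraph := ⟨H, inferInstance, r.1.1, r.1.2, r.2.1, r.2.2⟩

/-- Transport of a structure along a bijection. -/
def map {H H' : Type} (e : H ≃ H') (r : RibbonStr H) : RibbonStr H' :=
  ⟨(e.permCongr r.1.1, e.permCongr r.1.2),
    fun h => by simp [Equiv.permCongr_apply, r.2.1],
    fun h => by
      simp only [Equiv.permCongr_apply]
      rw [ne_eq, ← Equiv.eq_symm_apply]
      exact r.2.2 _⟩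

theorem iso_map {H' : Type} [Finite H'] (e : H ≃ H') (r : RibbonStr H) :
    Iso r.graph (r.map e).graph :=
  ⟨e, fun h => (congrArg (fun x => e (r.1.1 x)) (e.symm_apply_apply h)).symm,
    fun h => (congrArg (fun x => e (r.1.2 x)) (e.symm_apply_apply h)).symm⟩

/-- Transport of structures as a bijection. -/
def congr {H H' : Type} (e : H ≃ H') : RibbonStr H ≃ RibbonStr H' where
  toFun := map e
  invFun := map e.symm
  left_inv r := by
    apply Subtype.ext
    refine Prod.ext ?_ ?_ <;> ext h <;> simp [map, Equiv.permCongr_apply]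
  right_inv r := by
    apply Subtype.ext
    refine Prod.ext ?_ ?_ <;> ext h <;> simp [map, Equiv.permCongr_apply]

open Classical in
/-- The disjoint union of structures on a set of half-edges and on its complement. -/
def glue {p : H → Prop} (r : RibbonStr {x // p x}) (s : RibbonStr {x // ¬ p x}) : RibbonStr H :=
  ⟨(r.1.1.subtypeCongr s.1.1, r.1.2.subtypeCongr s.1.2), fun h => by
      by_cases hp : p h
      · rw [Equiv.Perm.subtypeCongr.left_apply _ _ hp, Equiv.Perm.subtypeCongr.left_apply_subtype,
          r.2.1]
      · rw [Equiv.Perm.subtypeCongr.right_apply _ _ hp,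
          Equiv.Perm.subtypeCongr.right_apply_subtype, s.2.1], fun h => by
      by_cases hp : p h
      · rw [Equiv.Perm.subtypeCongr.left_apply _ _ hp]
        exact fun e => r.2.2 _ (Subtype.ext e)
      · rw [Equiv.Perm.subtypeCongr.right_apply _ _ hp]
        exact fun e => s.2.2 _ (Subtype.ext e)⟩

open Classical in
/-- The inclusion of the first part of a disjoint union. -/
def glueLeft {p : H → Prop} (r : RibbonStr {x // p x}) (s : RibbonStr {x // ¬ p x}) :
    Emb r.graph (glue r s).graph :=
  ⟨Subtype.val, Subtype.val_injective,
    fun h => (Equiv.Perm.subtypeCongr.left_apply_subtype _ _ h).symm,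
    fun h => (Equiv.Perm.subtypeCongr.left_apply_subtype _ _ h).symm⟩

open Classical in
/-- The inclusion of the second part of a disjoint union. -/
def glueRight {p : H → Prop} (r : RibbonStr {x // p x}) (s : RibbonStr {x // ¬ p x}) :
    Emb s.graph (glue r s).graph :=
  ⟨Subtype.val, Subtype.val_injective,
    fun h => (Equiv.Perm.subtypeCongr.right_apply_subtype _ _ h).symm,
    fun h => (Equiv.Perm.subtypeCongr.right_apply_subtype _ _ h).symm⟩

theorem isClosed_glue {p : H → Prop} (r : RibbonStr {x // p x}) (s : RibbonStr {x // ¬ p x}) :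
    (glue r s).graph.IsClosed {x | p x} := by
  classical
  refine ⟨fun (h : H) => ?_, fun (h : H) => ?_⟩
  · change p (r.1.1.subtypeCongr s.1.1 h) ↔ p h
    by_cases hp : p h
    · rw [Equiv.Perm.subtypeCongr.left_apply _ _ hp]
      exact iff_of_true (Subtype.prop _) hp
    · rw [Equiv.Perm.subtypeCongr.right_apply _ _ hp]
      exact iff_of_false (Subtype.prop (p := fun x => ¬ p x) _) hp
  · change p (r.1.2.subtypeCongr s.1.2 h) ↔ p h
    by_cases hp : p h
    · rw [Equiv.Perm.subtypeCongr.left_apply _ _ hp]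
      exact iff_of_true (Subtype.prop _) hp
    · rw [Equiv.Perm.subtypeCongr.right_apply _ _ hp]
      exact iff_of_false (Subtype.prop (p := fun x => ¬ p x) _) hp

omit [Finite H] in
theorem glue_injective {p : H → Prop} {r r' : RibbonStr {x // p x}} {s s' : RibbonStr {x // ¬ p x}}
    (h : glue r s = glue r' s') : r = r' ∧ s = s' := by
  classical
  have h1 : r.1.1.subtypeCongr s.1.1 = r'.1.1.subtypeCongr s'.1.1 :=
    congrArg (fun t : RibbonStr H => t.1.1) h
  have h2 : r.1.2.subtypeCongr s.1.2 = r'.1.2.subtypeCongr s'.1.2 :=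
    congrArg (fun t : RibbonStr H => t.1.2) h
  constructor <;> refine Subtype.ext (Prod.ext (Equiv.ext fun x => ?_) (Equiv.ext fun x => ?_)) <;>
    apply Subtype.ext
  · simpa using DFunLike.congr_fun h1 (x : H)
  · simpa using DFunLike.congr_fun h2 (x : H)
  · simpa using DFunLike.congr_fun h1 (x : H)
  · simpa using DFunLike.congr_fun h2 (x : H)

theorem exists_glue_eq {p : H → Prop} (t : RibbonStr H) (ht : t.graph.IsClosed {x | p x}) :
    ∃ (r : RibbonStr {x // p x}) (s : RibbonStr {x // ¬ p x}), glue r s = t := by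
  classical
  have ht1 : ∀ h : H, p (t.1.1 h) ↔ p h := ht.1
  have ht2 : ∀ h : H, p (t.1.2 h) ↔ p h := ht.2
  refine ⟨⟨(t.1.1.subtypePerm ht1, t.1.2.subtypePerm ht2), fun h => Subtype.ext (t.2.1 h),
      fun h e => t.2.2 h (Subtype.ext_iff.1 e)⟩,
    ⟨(t.1.1.subtypePerm fun h => not_congr (ht1 h), t.1.2.subtypePerm fun h => not_congr (ht2 h)),
      fun h => Subtype.ext (t.2.1 h), fun h e => t.2.2 h (Subtype.ext_iff.1 e)⟩, ?_⟩
  refine Subtype.ext (Prod.ext (Equiv.ext fun x => ?_) (Equiv.ext fun x => ?_)) <;>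
    by_cases hp : p x <;> simp [glue, hp]

/-- The component of a half-edge in a disjoint union is the whole first part exactly when that
part is connected. -/
theorem component_glue_eq_iff {p : H → Prop} (r : RibbonStr {x // p x})
    (s : RibbonStr {x // ¬ p x}) (h : H) (hp : p h) :
    (glue r s).graph.component h = {x | p x} ↔ r.graph.Connected := by
  classical
  rw [connected_iff_component _ (⟨h, hp⟩ : {x // p x})]
  set f := glueLeft r s
  have hcl := isClosed_glue r s
  constructor
  · refine fun hc => Set.eq_univ_of_forall fun (x : {x // p x}) K hK hh => ?_
    have hx : x.1 ∈ (glue r s).graph.component h := hc ▸ x.2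
    obtain ⟨y, hy, hyx⟩ := hx _ (f.isClosed_image hK) ⟨⟨h, hp⟩, hh, rfl⟩
    exact (f.inj hyx : y = x) ▸ hy
  · intro hc
    refine Set.Subset.antisymm (fun x hx => hx _ hcl hp) fun x hx K hK hh => ?_
    have : (⟨x, hx⟩ : {x // p x}) ∈ r.graph.component (⟨h, hp⟩ : {x // p x}) :=
      hc ▸ Set.mem_univ _
    refine this (f.toFun ⁻¹' K) ⟨fun y => ?_, fun y => ?_⟩ hh
    · rw [Set.mem_preimage, f.map_next, hK.1, Set.mem_preimage]
    · rw [Set.mem_preimage, f.map_opp, hK.2, Set.mem_preimage]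

variable {R : Type*} [CommSemiring R]

open Classical in
/-- The restriction of a weight to connected graphs. -/
def connectedPart (w : RibbonGraph → R) (Γ : RibbonGraph) : R := if Γ.Connected then w Γ else 0

theorem connectedPart_iso {w : RibbonGraph → R} (hw : ∀ {Γ Δ}, Iso Γ Δ → w Δ = w Γ)
    {Γ Δ : RibbonGraph} (h : Iso Γ Δ) : connectedPart w Δ = connectedPart w Γ := by
  rw [connectedPart, connectedPart, hw h, h.connected_iff]

/-- The total weight of the structures on a set of half-edges. -/
def totalWeight (w : RibbonGraph → R) (H : Type) [Finite H] : R := ∑ r : RibbonStr H, w r.graph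

theorem totalWeight_congr {w : RibbonGraph → R} (hw : ∀ {Γ Δ}, Iso Γ Δ → w Δ = w Γ)
    {H' : Type} [Finite H'] (e : H ≃ H') : totalWeight w H' = totalWeight w H :=
  (Fintype.sum_equiv (congr e) _ _ fun r => (hw (iso_map e r)).symm).symm

/-- The half-edges of the connected component of `h`. -/
def componentFinset (r : RibbonStr H) (h : H) : Finset H :=
  Set.Finite.toFinset (s := (r.graph.component h : Set H)) (Set.toFinite _)

theorem componentFinset_eq_iff (r : RibbonStr H) (h : H) (K : Finset H) :
    r.componentFinset h = K ↔ r.graph.component h = {x : H | x ∈ K} := by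
  rw [← Finset.coe_inj]
  exact iff_of_eq (congrArg (· = (K : Set H))
    (Set.Finite.coe_toFinset (s := (r.graph.component h : Set H)) _))

/-- Splitting off the component of a fixed half-edge. -/
theorem totalWeight_eq_sum [Fintype H] [DecidableEq H] {w : RibbonGraph → R}
    (hmul : ∀ {Γ Γ' Δ : RibbonGraph} (f : Emb Γ Δ) (g : Emb Γ' Δ),
      (∀ a b, f.toFun a ≠ g.toFun b) →
      (∀ d, d ∈ Set.range f.toFun ∨ d ∈ Set.range g.toFun) → w Δ = w Γ * w Γ') (h : H) :
    totalWeight w H = ∑ K : Finset H with h ∈ K,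
      totalWeight (connectedPart w) {x // x ∈ K} * totalWeight w {x // x ∉ K} := by
  classical
  rw [totalWeight, ← Finset.sum_fiberwise (s := Finset.univ)
    (g := fun r : RibbonStr H => r.componentFinset h), Finset.sum_filter]
  refine Finset.sum_congr rfl fun K _ => ?_
  have hcomp := fun r : RibbonStr H => r.componentFinset_eq_iff h K
  split_ifs with hK
  · rw [totalWeight, totalWeight, Finset.sum_mul_sum, ← Finset.sum_product',
      ← Finset.sum_filter_of_ne (p := fun q : RibbonStr {x // x ∈ K} × RibbonStr {x // x ∉ K} =>
        q.1.graph.Connected)]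
    · symm
      refine Finset.sum_bij (fun q _ => glue q.1 q.2) (fun q hq => ?_) (fun q _ q' _ e => ?_)
        (fun t ht => ?_) fun q hq => ?_
      · rw [Finset.mem_filter, hcomp, component_glue_eq_iff _ _ _ hK]
        exact ⟨Finset.mem_univ _, (Finset.mem_filter.1 hq).2⟩
      · exact Prod.ext (glue_injective e).1 (glue_injective e).2
      · rw [Finset.mem_filter, hcomp] at ht
        obtain ⟨r, s, rfl⟩ := exists_glue_eq (p := fun x => x ∈ K) t
          (ht.2 ▸ t.graph.isClosed_component h)
        exact ⟨(r, s), Finset.mem_filter.2 ⟨Finset.mem_univ _,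
          (component_glue_eq_iff r s h hK).1 ht.2⟩, rfl⟩
      · rw [connectedPart, if_pos (Finset.mem_filter.1 hq).2]
        refine (hmul (glueLeft q.1 q.2) (glueRight q.1 q.2) (fun a b e => ?_) fun d => ?_).symm
        · exact absurd (Subtype.prop (a : {x // x ∈ K}))
            ((show (a : {x // x ∈ K}).1 = (b : {x // x ∉ K}).1 from e) ▸
              Subtype.prop (b : {x // x ∉ K}))
        · by_cases hd : d ∈ K
          exacts [Or.inl ⟨⟨d, hd⟩, rfl⟩, Or.inr ⟨⟨d, hd⟩, rfl⟩]
    · rintro ⟨r, s⟩ - hne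
      by_contra hc
      exact hne (by rw [connectedPart, if_neg hc, zero_mul])
  · refine Finset.sum_eq_zero fun r hr => absurd ?_ hK
    have := (hcomp r).1 (Finset.mem_filter.1 hr).2
    exact (this ▸ r.graph.mem_component_self h : h ∈ {x : H | x ∈ K})

/-- The recursion underlying the exponential formula. -/
theorem totalWeight_succ {w : RibbonGraph → R} (hw : ∀ {Γ Δ}, Iso Γ Δ → w Δ = w Γ)
    (hmul : ∀ {Γ Γ' Δ : RibbonGraph} (f : Emb Γ Δ) (g : Emb Γ' Δ),
      (∀ a b, f.toFun a ≠ g.toFun b) →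
      (∀ d, d ∈ Set.range f.toFun ∨ d ∈ Set.range g.toFun) → w Δ = w Γ * w Γ') (M : ℕ) :
    totalWeight w (Fin (M + 1)) = ∑ k ∈ Finset.range (M + 1), M.choose k •
      (totalWeight (connectedPart w) (Fin (k + 1)) * totalWeight w (Fin (M - k))) := by
  classical
  have key : ∀ K : Finset (Fin (M + 1)), totalWeight (connectedPart w) {x // x ∈ K} *
      totalWeight w {x // x ∉ K} =
      totalWeight (connectedPart w) (Fin K.card) * totalWeight w (Fin (M + 1 - K.card)) := by
    intro K
    rw [totalWeight_congr (connectedPart_iso hw) K.equivFin.symm]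
    congr 1
    refine totalWeight_congr hw (Fintype.equivOfCardEq ?_)
    rw [Fintype.card_fin, Fintype.card_subtype_compl, Fintype.card_coe, Fintype.card_fin]
  have hcard : (Finset.univ.erase (0 : Fin (M + 1))).card = M := by simp
  rw [totalWeight_eq_sum hmul (0 : Fin (M + 1)),
    Finset.sum_congr rfl fun K _ => key K]
  have := Finset.sum_powerset_apply_card (fun k => totalWeight (connectedPart w) (Fin (k + 1)) *
    totalWeight w (Fin (M - k))) (x := Finset.univ.erase (0 : Fin (M + 1)))
  rw [hcard] at this
  rw [← this]
  refine Finset.sum_bij' (fun K _ => K.erase 0) (fun T _ => insert 0 T) (fun K _ => ?_)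
    (fun T _ => ?_) (fun K hK => ?_) (fun T hT => ?_) fun K hK => ?_
  · exact Finset.mem_powerset.2 (Finset.erase_subset_erase _ (Finset.subset_univ _))
  · simp
  · exact Finset.insert_erase (Finset.mem_filter.1 hK).2
  · refine Finset.erase_insert fun h0 => ?_
    exact (Finset.mem_erase.1 (Finset.mem_powerset.1 hT h0)).1 rfl
  · have h0 := (Finset.mem_filter.1 hK).2
    have := Finset.card_erase_add_one h0
    rw [← this]
    congr 3
    omega

end RibbonStr

/-! ### The generating series of ribbon graphs -/

namespace RibbonGraph

open Classical in
/-- The monomial `n^{b(Γ)} ∏ t_j^{v_j(Γ)}` of a graph with vertex degrees in `S`, and zero for all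
other graphs. -/
def weight (S : Set ℕ) (Γ : RibbonGraph) : MvPowerSeries S ℚ[X] :=
  if ∀ v, Γ.degree v ∈ S then MvPowerSeries.monomial (Γ.exponent S) (X ^ Γ.boundaryCount) else 0

theorem weight_iso {S : Set ℕ} {Γ Δ : RibbonGraph} (h : Iso Γ Δ) : weight S Δ = weight S Γ := by
  by_cases hS : ∀ v, Γ.degree v ∈ S
  · rw [weight, weight, if_pos hS, if_pos ((h.degree_mem_iff S).2 hS), h.exponent_eq,
      h.boundaryCount_eq]
  · rw [weight, weight, if_neg hS, if_neg fun hh => hS ((h.degree_mem_iff S).1 hh)]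

theorem weight_union {S : Set ℕ} {Γ Γ' Δ : RibbonGraph} (f : Emb Γ Δ) (g : Emb Γ' Δ)
    (hd : ∀ a b, f.toFun a ≠ g.toFun b)
    (hs : ∀ d, d ∈ Set.range f.toFun ∨ d ∈ Set.range g.toFun) :
    weight S Δ = weight S Γ * weight S Γ' := by
  have hiff := degree_mem_union f g hs S
  by_cases h : ∀ v, Γ.degree v ∈ S
  · by_cases h' : ∀ v, Γ'.degree v ∈ S
    · rw [weight, weight, weight, if_pos h, if_pos h', if_pos (hiff.2 ⟨h, h'⟩),
        MvPowerSeries.monomial_mul_monomial, exponent_union f g hd hs S,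
        boundaryCount_union f g hd hs, pow_add]
    · rw [weight, weight, weight, if_neg h', if_neg fun hh => h' (hiff.1 hh).2, mul_zero]
  · rw [weight, weight, weight, if_neg h, if_neg fun hh => h (hiff.1 hh).1, zero_mul]

theorem coeff_weight_of_card_ne {S : Set ℕ} {Γ : RibbonGraph} {d : S →₀ ℕ}
    (h : Nat.card Γ.H ≠ halfEdges d) : MvPowerSeries.coeff d (weight S Γ) = 0 := by
  classical
  rw [weight]
  split_ifs with hS
  · rw [MvPowerSeries.coeff_monomial, if_neg]
    rintro rfl
    exact h (Γ.card_eq_halfEdges hS)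
  · exact map_zero _

theorem halfEdges_eq_zero {S : Set ℕ} (hS : 0 ∉ S) {d : S →₀ ℕ} (h : halfEdges d = 0) : d = 0 := by
  ext j
  by_contra hj
  have := Finset.sum_eq_zero_iff.1 h j (Finsupp.mem_support_iff.2 hj)
  rcases mul_eq_zero.1 this with h0 | h0
  exacts [hS (h0 ▸ j.2), hj h0]

/-- The number of half-edges as an additive weight on monomials. -/
def halfEdgesHom (S : Set ℕ) : (S →₀ ℕ) →+ ℕ where
  toFun := halfEdges
  map_zero' := Finsupp.sum_zero_index
  map_add' := halfEdges_add

theorem halfEdgesHom_apply {S : Set ℕ} (d : S →₀ ℕ) : halfEdgesHom S d = halfEdges d := rfl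

end RibbonGraph

open RibbonGraph RibbonStr

/-- The exponential generating series `∑_N (1/N!) ∑_r w(r)` of the weights of the ribbon graph
structures `r` on `N` labelled half-edges. Only the structures on `halfEdges d` half-edges
contribute to the coefficient at `d`. -/
def labelledSeries {S : Set ℕ} (w : RibbonGraph → MvPowerSeries S ℚ[X]) : MvPowerSeries S ℚ[X] :=
  fun d => C (1 / ((halfEdges d).factorial : ℚ)) *
    MvPowerSeries.coeff d (totalWeight w (Fin (halfEdges d)))

theorem coeff_labelledSeries {S : Set ℕ} (w : RibbonGraph → MvPowerSeries S ℚ[X]) (d : S →₀ ℕ) :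
    MvPowerSeries.coeff d (labelledSeries w) = C (1 / ((halfEdges d).factorial : ℚ)) *
      MvPowerSeries.coeff d (totalWeight w (Fin (halfEdges d))) := rfl

theorem coeff_connectedPart_of_card_ne {S : Set ℕ} {Γ : RibbonGraph} {d : S →₀ ℕ}
    (h : Nat.card Γ.H ≠ halfEdges d) :
    MvPowerSeries.coeff d (connectedPart (weight S) Γ) = 0 := by
  rw [connectedPart]
  split_ifs
  exacts [coeff_weight_of_card_ne h, map_zero _]

theorem coeff_totalWeight_connectedPart_of_ne {S : Set ℕ} {N : ℕ} {d : S →₀ ℕ}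
    (h : N ≠ halfEdges d) :
    MvPowerSeries.coeff d (totalWeight (connectedPart (weight S)) (Fin N)) = 0 := by
  rw [totalWeight, map_sum]
  exact Finset.sum_eq_zero fun r _ => coeff_connectedPart_of_card_ne (by
    change Nat.card (Fin N) ≠ _; rwa [Nat.card_fin])

/-- The generating series of all ribbon graphs with vertex degrees in `S`. -/
def graphSeries (S : Set ℕ) : MvPowerSeries S ℚ[X] := labelledSeries (weight S)

/-- The generating series of the connected ribbon graphs with vertex degrees in `S`. -/
def connectedSeries (S : Set ℕ) : MvPowerSeries S ℚ[X] := labelledSeries (connectedPart (weight S))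

theorem halfEdges_zero {S : Set ℕ} : halfEdges (0 : S →₀ ℕ) = 0 := Finsupp.sum_zero_index

theorem constantCoeff_graphSeries (S : Set ℕ) :
    MvPowerSeries.constantCoeff (graphSeries S) = 1 := by
  classical
  rw [← MvPowerSeries.coeff_zero_eq_constantCoeff_apply, graphSeries, coeff_labelledSeries,
    halfEdges_zero, totalWeight]
  have : Unique (RibbonStr (Fin 0)) :=
    { default := ⟨(1, 1), fun h => h.elim0, fun h => h.elim0⟩
      uniq := fun r => Subtype.ext (Subsingleton.elim _ _) }
  have : IsEmpty (default : RibbonStr (Fin 0)).graph.H := inferInstanceAs (IsEmpty (Fin 0))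
  rw [Fintype.sum_unique, weight, if_pos, boundaryCount_of_isEmpty, exponent_of_isEmpty]
  · simp
  · intro v
    obtain ⟨h, -⟩ := vertexOf_surjective _ v
    exact isEmptyElim h

theorem constantCoeff_connectedSeries (S : Set ℕ) :
    MvPowerSeries.constantCoeff (connectedSeries S) = 0 := by
  rw [← MvPowerSeries.coeff_zero_eq_constantCoeff_apply, connectedSeries, coeff_labelledSeries,
    halfEdges_zero, totalWeight, Finset.sum_eq_zero, map_zero, mul_zero]
  intro r _
  rw [connectedPart, if_neg]
  rintro ⟨⟨v⟩, -⟩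
  obtain ⟨h, -⟩ := vertexOf_surjective _ v
  exact Fin.elim0 h

/-- The exponential formula: the logarithm of the series of all ribbon graphs is the series of the
connected ones. Differentiating with respect to the number of half-edges amounts to marking a
half-edge, and the component of the marked half-edge is split off. -/
theorem formalLog_graphSeries {S : Set ℕ} (hS : 0 ∉ S) :
    formalLog (graphSeries S) = connectedSeries S := by
  classical
  refine formalLog_eq_of_weightDerivation_mul (halfEdgesHom S) (fun d => halfEdges_eq_zero hS)
    (constantCoeff_graphSeries S) (constantCoeff_connectedSeries S) ?_
  ext1 d
  rw [coeff_weightDerivation, MvPowerSeries.coeff_mul]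
  have hadd : ∀ p ∈ Finset.HasAntidiagonal.antidiagonal d,
      halfEdges p.1 + halfEdges p.2 = halfEdges d := fun p hp => by
    rw [← halfEdges_add, Finset.HasAntidiagonal.mem_antidiagonal.mp hp]
  simp only [coeff_weightDerivation, graphSeries, connectedSeries, coeff_labelledSeries,
    halfEdgesHom_apply]
  rcases hN : halfEdges d with _ | M
  · rw [Nat.cast_zero, zero_mul]
    refine Finset.sum_eq_zero fun p hp => ?_
    have := hadd p hp
    rw [show halfEdges p.1 = 0 by omega, Nat.cast_zero, zero_mul, zero_mul]
  rw [totalWeight_succ weight_iso weight_union, map_sum]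
  simp only [map_nsmul, MvPowerSeries.coeff_mul]
  simp only [Finset.mul_sum, Finset.smul_sum]
  rw [Finset.sum_comm]
  refine Finset.sum_congr rfl fun p hp => ?_
  have hp' := hadd p hp
  rcases hk : halfEdges p.1 with _ | k
  · rw [Nat.cast_zero, zero_mul, zero_mul, eq_comm]
    refine Finset.sum_eq_zero fun k _ => ?_
    rw [coeff_totalWeight_connectedPart_of_ne (by omega), zero_mul, smul_zero, mul_zero,
      mul_zero]
  · rw [Finset.sum_eq_single_of_mem k (Finset.mem_range.2 (by omega)) fun l _ hl => by
      rw [coeff_totalWeight_connectedPart_of_ne (by omega), zero_mul, smul_zero, mul_zero,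
        mul_zero]]
    rw [show M - k = halfEdges p.2 by omega, nsmul_eq_mul]
    have hscal : ((k + 1 : ℕ) : ℚ[X]) * C (1 / ((k + 1).factorial : ℚ)) *
        C (1 / ((halfEdges p.2).factorial : ℚ)) =
        ((M + 1 : ℕ) : ℚ[X]) * C (1 / ((M + 1).factorial : ℚ)) * (M.choose k : ℚ[X]) := by
      simp only [← C_eq_natCast, ← map_mul]
      congr 1
      have h1 : M.choose k * k.factorial * (halfEdges p.2).factorial = M.factorial := by
        rw [show halfEdges p.2 = M - k by omega]
        exact Nat.choose_mul_factorial_mul_factorial (by omega)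
      have h2 : (M.choose k : ℚ) * k.factorial * (halfEdges p.2).factorial = M.factorial := by
        exact_mod_cast h1
      rw [Nat.factorial_succ, Nat.factorial_succ, Nat.cast_mul, Nat.cast_mul, ← h2]
      have h3 : (M.choose k : ℚ) ≠ 0 := by
        exact_mod_cast (Nat.choose_pos (show k ≤ M by omega)).ne'
      have := Nat.factorial_ne_zero k
      have := Nat.factorial_ne_zero (halfEdges p.2)
      field_simp
    linear_combination (MvPowerSeries.coeff p.1
      (totalWeight (connectedPart (weight S)) (Fin (k + 1))) *
      MvPowerSeries.coeff p.2 (totalWeight (weight S) (Fin (halfEdges p.2)))) * hscal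

/-! ### Counting isomorphism classes -/

namespace RibbonGraph

/-- A ribbon graph as a structure on its set of half-edges. -/
def str (Γ : RibbonGraph) : RibbonStr Γ.H := ⟨(Γ.next, Γ.opp), Γ.opp_opp, Γ.opp_ne⟩

theorem str_map_eq_iff (Γ : RibbonGraph) {H : Type} (e f : Γ.H ≃ H) :
    Γ.str.map e = Γ.str.map f ↔ (e.trans f.symm : Equiv.Perm Γ.H) ∈ Γ.Aut := by
  have key : ∀ σ : Equiv.Perm Γ.H, e.permCongr σ = f.permCongr σ ↔
      σ * (e.trans f.symm : Equiv.Perm Γ.H) = (e.trans f.symm : Equiv.Perm Γ.H) * σ := by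
    intro σ
    constructor
    · intro h
      ext x
      have := DFunLike.congr_fun h (e x)
      simp only [Equiv.permCongr_apply, Equiv.symm_apply_apply] at this
      simp [this]
    · intro h
      ext x
      have := DFunLike.congr_fun h (e.symm x)
      simp only [Equiv.Perm.mul_apply, Equiv.trans_apply, Equiv.apply_symm_apply] at this
      simp [Equiv.permCongr_apply, this]
  rw [Aut, Subgroup.mem_centralizer_iff]
  simp only [Set.mem_insert_iff, Set.mem_singleton_iff, forall_eq_or_imp, forall_eq, ← key]
  exact ⟨fun h => ⟨congrArg (fun r : RibbonStr H => r.1.1) h,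
    congrArg (fun r : RibbonStr H => r.1.2) h⟩, fun h => Subtype.ext (Prod.ext h.1 h.2)⟩

theorem iso_graph_iff (Γ : RibbonGraph) {H : Type} [Finite H] (r : RibbonStr H) :
    Iso Γ r.graph ↔ ∃ e : Γ.H ≃ H, Γ.str.map e = r := by
  constructor
  · rintro ⟨e, h₁, h₂⟩
    refine ⟨e, Subtype.ext (Prod.ext (Equiv.ext fun x => ?_) (Equiv.ext fun x => ?_))⟩
    · exact (h₁ (e.symm x)).trans (congrArg r.1.1 (e.apply_symm_apply x))
    · exact (h₂ (e.symm x)).trans (congrArg r.1.2 (e.apply_symm_apply x))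
  · rintro ⟨e, rfl⟩
    exact iso_map e Γ.str

/-- The orbit-stabilizer relation: the graph `Γ` has `N! / |Aut Γ|` labellings of its `N`
half-edges up to isomorphism. -/
theorem card_labellings_mul_card_aut (Γ : RibbonGraph) :
    Nat.card {r : RibbonStr (Fin (Nat.card Γ.H)) // Iso Γ r.graph} * Nat.card Γ.Aut =
      (Nat.card Γ.H).factorial := by
  classical
  have := Fintype.ofFinite Γ.H
  have hex := fun r : {r : RibbonStr (Fin (Nat.card Γ.H)) // Iso Γ r.graph} =>
    (Γ.iso_graph_iff r.1).1 r.2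
  choose f hf using hex
  have E : (Γ.H ≃ Fin (Nat.card Γ.H)) ≃
      {r : RibbonStr (Fin (Nat.card Γ.H)) // Iso Γ r.graph} × Γ.Aut :=
    { toFun := fun e => (⟨Γ.str.map e, iso_map e Γ.str⟩,
        ⟨e.trans (f ⟨Γ.str.map e, iso_map e Γ.str⟩).symm,
          (Γ.str_map_eq_iff _ _).1 (hf ⟨Γ.str.map e, iso_map e Γ.str⟩).symm⟩)
      invFun := fun p => (p.2.1 : Equiv.Perm Γ.H).trans (f p.1)
      left_inv := fun e => by ext x; simp
      right_inv := fun p => by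
        have h : Γ.str.map ((p.2.1 : Equiv.Perm Γ.H).trans (f p.1)) = p.1.1 := by
          rw [← hf p.1, str_map_eq_iff]
          convert p.2.2 using 1
          ext x; simp
        have h' : (⟨Γ.str.map ((p.2.1 : Equiv.Perm Γ.H).trans (f p.1)), iso_map _ Γ.str⟩ :
          {r : RibbonStr (Fin (Nat.card Γ.H)) // Iso Γ r.graph}) = p.1 := Subtype.ext h
        refine Prod.ext h' (Subtype.ext ?_)
        ext x
        simp [h'] }
  rw [← Nat.card_prod, ← Nat.card_congr E, Nat.card_eq_fintype_card,
    Fintype.card_equiv (Finite.equivFin Γ.H), Nat.card_eq_fintype_card]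

end RibbonGraph

theorem RibbonClass.iso_out (Γ : RibbonGraph) :
    Iso (Quotient.out (Quotient.mk isoSetoid Γ)) Γ := Quotient.mk_out Γ

open Classical in
/-- The isomorphism classes of ribbon graphs with `N` half-edges. -/
def ribbonClasses (N : ℕ) : Finset RibbonClass :=
  Finset.univ.image fun r : RibbonStr (Fin N) => Quotient.mk isoSetoid r.graph

theorem mem_ribbonClasses {N : ℕ} {q : RibbonClass} :
    q ∈ ribbonClasses N ↔ Nat.card q.out.H = N := by
  classical
  rw [ribbonClasses, Finset.mem_image]
  constructor
  · rintro ⟨r, -, rfl⟩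
    obtain ⟨e, -⟩ := RibbonClass.iso_out r.graph
    rw [Nat.card_congr e]
    exact Nat.card_fin N
  · rintro rfl
    refine ⟨q.out.str.map (Finite.equivFin _), Finset.mem_univ _, ?_⟩
    conv_rhs => rw [← q.out_eq]
    exact Quotient.sound (isoSetoid.symm (iso_map _ q.out.str))

/-- The weighted count of labelled ribbon graphs is the count of isomorphism classes with weights
`1 / |Aut Γ|`. -/
theorem inv_factorial_mul_sum {F : RibbonGraph → ℚ[X]} (hF : ∀ {Γ Δ}, Iso Γ Δ → F Δ = F Γ)
    (N : ℕ) : C (1 / (N.factorial : ℚ)) * ∑ r : RibbonStr (Fin N), F r.graph =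
      ∑ q ∈ ribbonClasses N, C (1 / (Nat.card q.out.Aut : ℚ)) * F q.out := by
  classical
  rw [← Finset.sum_fiberwise_of_maps_to (s := Finset.univ) (t := ribbonClasses N)
    (g := fun r : RibbonStr (Fin N) => (Quotient.mk isoSetoid r.graph : RibbonClass))
    fun r _ => Finset.mem_image_of_mem _ (Finset.mem_univ r), Finset.mul_sum]
  refine Finset.sum_congr rfl fun q hq => ?_
  have hiff : ∀ r : RibbonStr (Fin N),
      (Quotient.mk isoSetoid r.graph : RibbonClass) = q ↔ Iso q.out r.graph := by
    intro r
    conv_lhs => rw [← q.out_eq]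
    exact ⟨fun h => isoSetoid.symm (Quotient.exact h),
      fun h => Quotient.sound (isoSetoid.symm h)⟩
  rw [Finset.sum_congr rfl (g := fun _ => F q.out) fun r hr =>
    hF ((hiff r).1 (Finset.mem_filter.1 hr).2), Finset.sum_const, nsmul_eq_mul, ← mul_assoc,
    ← C_eq_natCast, ← C_mul]
  congr 2
  obtain rfl := mem_ribbonClasses.1 hq
  have hcard := q.out.card_labellings_mul_card_aut
  rw [Nat.card_eq_fintype_card, Fintype.card_subtype] at hcard
  rw [Finset.filter_congr fun r _ => hiff r, ← hcard, Nat.cast_mul]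
  have h0 := hcard ▸ Nat.factorial_ne_zero (Nat.card q.out.H)
  have h1 : (((Finset.univ.filter fun r : RibbonStr (Fin (Nat.card q.out.H)) =>
    Iso q.out r.graph).card : ℕ) : ℚ) ≠ 0 := Nat.cast_ne_zero.2 (left_ne_zero_of_mul h0)
  have h2 : (Nat.card q.out.Aut : ℚ) ≠ 0 := Nat.cast_ne_zero.2 (right_ne_zero_of_mul h0)
  field_simp

namespace RibbonGraph

theorem coeff_connectedPart_weight {S : Set ℕ} (Γ : RibbonGraph) (d : S →₀ ℕ) :
    C (1 / (Nat.card Γ.Aut : ℚ)) * MvPowerSeries.coeff d (connectedPart (weight S) Γ) =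
      open Classical in if Γ.Connected ∧ ∀ v, Γ.degree v ∈ S then
        MvPowerSeries.coeff d (Γ.term S) else 0 := by
  classical
  rw [connectedPart, weight, term]
  by_cases hc : Γ.Connected
  · by_cases hS : ∀ v, Γ.degree v ∈ S
    · rw [if_pos hc, if_pos hS, if_pos ⟨hc, hS⟩, MvPowerSeries.coeff_monomial,
        MvPowerSeries.coeff_monomial]
      split_ifs <;> simp
    · rw [if_pos hc, if_neg hS, if_neg fun h => hS h.2, map_zero, mul_zero]
  · rw [if_neg hc, if_neg fun h => hc h.1, map_zero, mul_zero]

end RibbonGraph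

theorem coeff_term_ne_zero {S : Set ℕ} {d : S →₀ ℕ} {q : RibbonClass}
    (hq : ∀ v, q.out.degree v ∈ S) (h : MvPowerSeries.coeff d (q.out.term S) ≠ 0) :
    q ∈ ribbonClasses (halfEdges d) := by
  classical
  rw [RibbonGraph.term, MvPowerSeries.coeff_monomial] at h
  rw [mem_ribbonClasses, q.out.card_eq_halfEdges hq]
  split_ifs at h with hd
  · rw [hd]
  · exact absurd rfl h

theorem coeff_connectedSeries (S : Set ℕ) (d : S →₀ ℕ) :
    MvPowerSeries.coeff d (connectedSeries S) = open Classical in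
      ∑ q ∈ (ribbonClasses (halfEdges d)).filter (· ∈ connectedGraphs S),
        MvPowerSeries.coeff d (q.out.term S) := by
  classical
  rw [connectedSeries, coeff_labelledSeries, totalWeight, map_sum,
    inv_factorial_mul_sum (F := fun Γ => MvPowerSeries.coeff d (connectedPart (weight S) Γ))
      (fun h => by rw [connectedPart_iso weight_iso h]), Finset.sum_filter]
  refine Finset.sum_congr rfl fun q _ => (coeff_connectedPart_weight _ _).trans ?_
  exact if_congr Iff.rfl rfl rfl

/-- A structure on `N` labelled half-edges is one of `N! / |Aut Γ|` isomorphic ones, so dividing by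
`N!` leaves the weight `1 / |Aut Γ|` for each isomorphism class. -/
theorem isFormalSum_connectedSeries (S : Set ℕ) :
    IsFormalSum (fun Γ : connectedGraphs S => Γ.1.out.term S) (connectedSeries S) := by
  classical
  intro d
  have hsub : {Γ : connectedGraphs S | MvPowerSeries.coeff d (Γ.1.out.term S) ≠ 0} ⊆
      Subtype.val ⁻¹' (ribbonClasses (halfEdges d) : Set RibbonClass) :=
    fun Γ hΓ => coeff_term_ne_zero Γ.2.2 hΓ
  have hfin : (Subtype.val ⁻¹' (ribbonClasses (halfEdges d) : Set RibbonClass) :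
      Set (connectedGraphs S)).Finite :=
    (Finset.finite_toSet _).preimage Subtype.val_injective.injOn
  refine ⟨hfin.subset hsub, ?_⟩
  rw [coeff_connectedSeries, finsum_eq_sum_of_support_subset _ (s := hfin.toFinset) (by
    rw [Set.Finite.coe_toFinset]; exact hsub)]
  refine (Finset.sum_bij (fun Γ _ => Γ.1) (fun Γ hΓ => ?_) (fun _ _ _ _ h => Subtype.ext h)
    (fun q hq => ?_) fun _ _ => rfl).symm
  · exact Finset.mem_filter.2 ⟨hfin.mem_toFinset.1 hΓ, Γ.2⟩
  · exact ⟨⟨q, (Finset.mem_filter.1 hq).2⟩,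
      hfin.mem_toFinset.2 (Finset.mem_filter.1 hq).1, rfl⟩

/-! ### Cycle types -/

section CycleType

variable {α : Type*} [Fintype α] [DecidableEq α]

theorem cycleCount_eq_card_cycleType_add (σ : Equiv.Perm α) :
    cycleCount σ = Multiset.card σ.cycleType + Fintype.card {x // σ x = x} := by
  classical
  let F : α → {c // c ∈ σ.cycleFactorsFinset} ⊕ {x // σ x = x} := fun x =>
    if h : σ x = x then Sum.inr ⟨x, h⟩ else Sum.inl ⟨σ.cycleOf x,
      Equiv.Perm.cycleOf_mem_cycleFactorsFinset_iff.2 (Equiv.Perm.mem_support.2 h)⟩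
  have hF : ∀ x y, σ.SameCycle x y ↔ F x = F y := by
    intro x y
    by_cases hx : σ x = x
    · by_cases hy : σ y = y
      · simp only [F, dif_pos hx, dif_pos hy, Sum.inr.injEq, Subtype.mk.injEq]
        exact ⟨fun h => h.eq_of_left hx, fun h => h ▸ Equiv.Perm.SameCycle.refl _ _⟩
      · simp only [F, dif_pos hx, dif_neg hy, reduceCtorEq, iff_false]
        exact fun h => hy (h.eq_of_left hx ▸ hx)
    · by_cases hy : σ y = y
      · simp only [F, dif_neg hx, dif_pos hy, reduceCtorEq, iff_false]
        exact fun h => hx (h.eq_of_right hy ▸ hy)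
      · simp only [F, dif_neg hx, dif_neg hy, Sum.inl.injEq, Subtype.mk.injEq]
        exact Equiv.Perm.sameCycle_iff_cycleOf_eq_of_mem_support (Equiv.Perm.mem_support.2 hx)
          (Equiv.Perm.mem_support.2 hy)
  let G : Quotient (Equiv.Perm.SameCycle.setoid σ) →
      {c // c ∈ σ.cycleFactorsFinset} ⊕ {x // σ x = x} :=
    Quotient.lift F fun x y h => (hF x y).1 h
  have hG : Function.Bijective G := by
    constructor
    · rintro ⟨x⟩ ⟨y⟩ h
      exact Quotient.sound ((hF x y).2 h)
    · rintro (⟨c, hc⟩ | ⟨x, hx⟩)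
      · obtain ⟨a, ha⟩ := (Equiv.Perm.mem_cycleFactorsFinset_iff.1 hc).1.nonempty_support
        refine ⟨Quotient.mk _ a, ?_⟩
        have hne : ¬ σ a = a := Equiv.Perm.mem_support.1
          (Equiv.Perm.mem_cycleFactorsFinset_support_le hc ha)
        change F a = _
        simp only [F, dif_neg hne, Sum.inl.injEq, Subtype.mk.injEq]
        exact (Equiv.Perm.cycle_is_cycleOf ha hc).symm
      · refine ⟨Quotient.mk _ x, ?_⟩
        change F x = _
        simp only [F, dif_pos hx]
  rw [cycleCount, Nat.card_congr (Equiv.ofBijective G hG), Nat.card_sum, Nat.card_eq_fintype_card,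
    Nat.card_eq_fintype_card, Fintype.card_coe, Equiv.Perm.cycleType_def, Multiset.card_map]
  rfl

theorem sign_eq_neg_one_pow_card_add_cycleCount (σ : Equiv.Perm α) :
    Equiv.Perm.sign σ = (-1) ^ (Fintype.card α + cycleCount σ) := by
  have h1 : Fintype.card α = σ.cycleType.sum + Fintype.card {x // σ x = x} := by
    rw [Equiv.Perm.sum_cycleType, Equiv.Perm.support, ← Fintype.card_subtype]
    rw [Fintype.card_subtype, Fintype.card_subtype, add_comm,
      Finset.card_filter_add_card_filter_not]
    rfl
  rw [Equiv.Perm.sign_of_cycleType, cycleCount_eq_card_cycleType_add, h1,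
    show ∀ a b c : ℕ, a + c + (b + c) = a + b + 2 * c by intros; ring, pow_add _ _ (2 * _), pow_mul]
  simp

end CycleType

namespace RibbonGraph

theorem degree_vertexOf (Γ : RibbonGraph) [Fintype Γ.H] [DecidableEq Γ.H] {h : Γ.H}
    (hh : Γ.next h ≠ h) : Γ.degree (Γ.vertexOf h) = (Γ.next.cycleOf h).support.card := by
  rw [degree, ← Fintype.card_coe, ← Nat.card_eq_fintype_card]
  refine Nat.card_congr (Equiv.subtypeEquivRight fun k => ?_)
  rw [Γ.vertexOf_eq_iff, Equiv.Perm.mem_support_cycleOf_iff' hh, Equiv.Perm.sameCycle_comm]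

theorem degree_vertexOf_of_fixed (Γ : RibbonGraph) {h : Γ.H} (hh : Γ.next h = h) :
    Γ.degree (Γ.vertexOf h) = 1 := by
  rw [degree, Nat.card_eq_one_iff_unique]
  refine ⟨⟨fun a b => Subtype.ext ?_⟩, ⟨⟨h, rfl⟩⟩⟩
  have key : ∀ k, Γ.vertexOf k = Γ.vertexOf h → k = h := fun k hk =>
    ((Γ.vertexOf_eq_iff _ _).1 hk).eq_of_right hh
  rw [key _ a.2, key _ b.2]

/-- The number of vertices of degree `j ≥ 2` is the multiplicity of `j` in the cycle type. -/
theorem vertexCount_eq_count_cycleType (Γ : RibbonGraph) [Fintype Γ.H] [DecidableEq Γ.H] {j : ℕ}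
    (hj : 2 ≤ j) : Γ.vertexCount j = Γ.next.cycleType.count j := by
  classical
  have hne : ∀ h, Γ.degree (Γ.vertexOf h) = j → Γ.next h ≠ h := by
    intro h hd hf
    rw [degree_vertexOf_of_fixed Γ hf] at hd
    omega
  rw [Equiv.Perm.cycleType_def, Multiset.count_map, ← Finset.filter_val, Finset.card_val,
    ← Fintype.card_coe, ← Nat.card_eq_fintype_card, vertexCount]
  let F : Γ.Vertex → Equiv.Perm Γ.H :=
    Quotient.lift (fun h => Γ.next.cycleOf h) fun x y h => Equiv.Perm.SameCycle.cycleOf_eq h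
  have hF : ∀ h, F (Γ.vertexOf h) = Γ.next.cycleOf h := fun _ => rfl
  refine Nat.card_congr (Equiv.ofBijective (fun v => ⟨F v.1, ?_⟩) ⟨?_, ?_⟩)
  · obtain ⟨v, hv⟩ := v
    obtain ⟨h, rfl⟩ := Γ.vertexOf_surjective v
    rw [Finset.mem_filter, hF, Equiv.Perm.cycleOf_mem_cycleFactorsFinset_iff,
      Equiv.Perm.mem_support]
    exact ⟨hne h hv, by rw [Function.comp, ← degree_vertexOf Γ (hne h hv), hv]⟩
  · rintro ⟨v, hv⟩ ⟨w, hw⟩ hvw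
    obtain ⟨h, rfl⟩ := Γ.vertexOf_surjective v
    obtain ⟨k, rfl⟩ := Γ.vertexOf_surjective w
    refine Subtype.ext ((Γ.vertexOf_eq_iff _ _).2 ?_)
    rw [Equiv.Perm.sameCycle_iff_cycleOf_eq_of_mem_support (Equiv.Perm.mem_support.2 (hne h hv))
          (Equiv.Perm.mem_support.2 (hne k hw))]
    exact Subtype.ext_iff.1 hvw
  · rintro ⟨c, hc⟩
    rw [Finset.mem_filter] at hc
    obtain ⟨a, ha⟩ := (Equiv.Perm.mem_cycleFactorsFinset_iff.1 hc.1).1.nonempty_support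
    have hne : Γ.next a ≠ a := Equiv.Perm.mem_support.1
      (Equiv.Perm.mem_cycleFactorsFinset_support_le hc.1 ha)
    have hca := Equiv.Perm.cycle_is_cycleOf ha hc.1
    refine ⟨⟨Γ.vertexOf a, ?_⟩, Subtype.ext ?_⟩
    · rw [degree_vertexOf Γ hne, ← hca]
      exact hc.2.symm
    · exact hca.symm

/-! ### The Euler characteristic and the genus -/

theorem card_eq_two_mul_edge (Γ : RibbonGraph) : Nat.card Γ.H = 2 * Nat.card Γ.Edge := by
  classical
  let Δ : RibbonGraph := ⟨Γ.H, Γ.finite_H, Γ.opp, Γ.opp, Γ.opp_opp, Γ.opp_ne⟩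
  have hsame : ∀ x y : Γ.H, Γ.opp.SameCycle x y ↔ x = y ∨ x = Γ.opp y := by
    intro x y
    constructor
    · rintro ⟨k, rfl⟩
      have hsq : Γ.opp ^ (2 : ℤ) = 1 := by
        ext z
        rw [zpow_two, Equiv.Perm.mul_apply, Γ.opp_opp, Equiv.Perm.one_apply]
      rcases Int.even_or_odd' k with ⟨l, rfl | rfl⟩
      · left; rw [zpow_mul, hsq, one_zpow, Equiv.Perm.one_apply]
      · right; rw [zpow_add, zpow_mul, hsq, one_zpow, one_mul, zpow_one, Γ.opp_opp]
    · rintro (rfl | rfl)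
      · exact Equiv.Perm.SameCycle.refl _ _
      · exact Equiv.Perm.sameCycle_apply_left.2 (Equiv.Perm.SameCycle.refl _ _)
  have hdeg : ∀ v, Δ.degree v = 2 := by
    intro v
    obtain ⟨h, rfl⟩ := Δ.vertexOf_surjective v
    have : Nat.card {k : Γ.H // k ∈ ({h, Γ.opp h} : Set Γ.H)} = 2 := by
      change Set.ncard ({h, Γ.opp h} : Set Γ.H) = 2
      exact Set.ncard_pair (Γ.opp_ne h).symm
    rw [← this]
    refine Nat.card_congr (Equiv.subtypeEquivRight fun k => ?_)
    exact (Δ.vertexOf_eq_iff k h).trans (hsame k h)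
  have := Fintype.ofFinite Δ.Vertex
  have hcard := Δ.card_eq_sum_degree
  rw [finsum_eq_sum_of_fintype, Finset.sum_congr rfl fun v _ => hdeg v, Finset.sum_const,
    smul_eq_mul, mul_comm, Finset.card_univ, ← Nat.card_eq_fintype_card] at hcard
  exact hcard

/-- The sign of a permutation of `N` half-edges with `c` cycles is `(-1) ^ (N + c)`; compare the
signs of `next`, `opp` and `next * opp`, with `N` even. -/
theorem even_vertex_add_edge_add_boundary (Γ : RibbonGraph) :
    Even (Nat.card Γ.Vertex + Nat.card Γ.Edge + Γ.boundaryCount) := by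
  classical
  have := Fintype.ofFinite Γ.H
  have h := Equiv.Perm.sign_mul Γ.next Γ.opp
  rw [sign_eq_neg_one_pow_card_add_cycleCount, sign_eq_neg_one_pow_card_add_cycleCount,
    sign_eq_neg_one_pow_card_add_cycleCount, ← Nat.card_eq_fintype_card, card_eq_two_mul_edge,
    ← pow_add, ← boundaryCount_eq, ← card_vertex, ← card_edge] at h
  have h2 : ((-1 : ℤˣ)) ^ (Nat.card Γ.Vertex + Nat.card Γ.Edge + Γ.boundaryCount) = 1 := by
    have h3 := congrArg (· * (-1 : ℤˣ) ^ (2 * Nat.card Γ.Edge + Γ.boundaryCount)) h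
    simp only [← pow_add] at h3
    rw [show 2 * Nat.card Γ.Edge + Γ.boundaryCount + (2 * Nat.card Γ.Edge + Γ.boundaryCount) =
      2 * (2 * Nat.card Γ.Edge + Γ.boundaryCount) by ring,
      show 2 * Nat.card Γ.Edge + Nat.card Γ.Vertex + (2 * Nat.card Γ.Edge + Nat.card Γ.Edge) +
        (2 * Nat.card Γ.Edge + Γ.boundaryCount) = 2 * (3 * Nat.card Γ.Edge) +
        (Nat.card Γ.Vertex + Nat.card Γ.Edge + Γ.boundaryCount) by ring,
      pow_add _ (2 * _), pow_mul, pow_mul] at h3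
    simpa using h3.symm
  by_contra hodd
  rw [(Nat.not_even_iff_odd.1 hodd).neg_one_pow] at h2
  exact absurd h2 (by decide)

end RibbonGraph

section LinearAlgebra

open Module

variable {K V W U : Type*} [Field K] [AddCommGroup V] [Module K V] [AddCommGroup W] [Module K W]
  [AddCommGroup U] [Module K U] [FiniteDimensional K V] [FiniteDimensional K W]

theorem finrank_ker_comp_le (g : W →ₗ[K] U) (f : V →ₗ[K] W) :
    finrank K (LinearMap.ker (g ∘ₗ f)) ≤
      finrank K (LinearMap.ker f) + finrank K (LinearMap.ker g) := by
  have hmap : ∀ x ∈ LinearMap.ker (g ∘ₗ f), f x ∈ LinearMap.ker g := fun x hx => hx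
  set φ := f.restrict hmap
  rw [← LinearMap.finrank_range_add_finrank_ker φ, add_comm]
  refine add_le_add ?_ (Submodule.finrank_le _)
  refine LinearMap.finrank_le_finrank_of_injective
    (f := ((Submodule.subtype _).comp (Submodule.subtype (LinearMap.ker φ))).codRestrict
      (LinearMap.ker f) fun x => ?_) ?_
  · have := x.2
    rw [LinearMap.mem_ker] at this
    exact Subtype.ext_iff.1 this
  · intro x y hxy
    have h : x.1.1 = y.1.1 := congrArg (fun z : LinearMap.ker f => (z : V)) hxy
    exact Subtype.ext (Subtype.ext h)

/-- Scott's inequality for two endomorphisms: bound the fixed space of `B A` by the fixed spaces of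
`A` and `B`, their intersection and the sum of the images of `1 - A` and `1 - B`. -/
theorem finrank_ker_one_sub_mul_le (A B : V →ₗ[K] V) :
    finrank K (LinearMap.ker (1 - B * A)) + finrank K (LinearMap.ker (1 - A)) +
      finrank K (LinearMap.ker (1 - B)) +
      finrank K ↥(LinearMap.range (1 - A) ⊔ LinearMap.range (1 - B)) ≤
    2 * finrank K V + finrank K ↥(LinearMap.ker (1 - A) ⊓ LinearMap.ker (1 - B)) := by
  let β : V →ₗ[K] LinearMap.range (1 - A) × LinearMap.range (1 - B) :=
    (1 - A).rangeRestrict.prod (1 - B).rangeRestrict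
  let ψ : LinearMap.range (1 - A) × LinearMap.range (1 - B) →ₗ[K] V :=
    (B ∘ₗ Submodule.subtype _).coprod (Submodule.subtype _)
  have hcomp : ψ ∘ₗ β = 1 - B * A := by
    ext v
    simp [ψ, β]
  have hker : LinearMap.ker β = LinearMap.ker (1 - A) ⊓ LinearMap.ker (1 - B) := by
    simp only [β, LinearMap.ker_prod, LinearMap.ker_rangeRestrict]
  have hrange : LinearMap.range (1 - A) ⊔ LinearMap.range (1 - B) ≤ LinearMap.range ψ := by
    refine sup_le (fun u hu => ⟨(⟨u, hu⟩, ⟨(1 - B) u, u, rfl⟩), ?_⟩) fun w hw => ⟨(0, ⟨w, hw⟩), ?_⟩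
    · simp [ψ]
    · simp [ψ]
  have h1 := finrank_ker_comp_le ψ β
  rw [hcomp, hker] at h1
  have h2 := LinearMap.finrank_range_add_finrank_ker ψ
  rw [finrank_prod] at h2
  have h3 := LinearMap.finrank_range_add_finrank_ker (1 - A)
  have h4 := LinearMap.finrank_range_add_finrank_ker (1 - B)
  have h5 := Submodule.finrank_mono hrange
  omega

end LinearAlgebra

theorem finrank_ker_one_sub_funLeft {α : Type*} [Fintype α] (σ : Equiv.Perm α) :
    Module.finrank ℚ (LinearMap.ker (1 - LinearMap.funLeft ℚ ℚ σ)) = cycleCount σ := by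
  classical
  have hker : LinearMap.ker (1 - LinearMap.funLeft ℚ ℚ σ) = LinearMap.range
      (LinearMap.funLeft ℚ ℚ (Quotient.mk (Equiv.Perm.SameCycle.setoid σ))) := by
    ext f
    rw [LinearMap.mem_ker, LinearMap.sub_apply, sub_eq_zero]
    constructor
    · intro hf
      have h1 : ∀ x, f (σ x) = f x := fun x => (congrFun hf x).symm
      exact ⟨Quotient.lift f fun x y h => SameCycle.apply_eq h1 h, by ext x; rfl⟩
    · rintro ⟨g, rfl⟩
      ext x
      change g _ = g _
      exact congrArg g (Quotient.sound
        (Equiv.Perm.sameCycle_apply_right.2 (Equiv.Perm.SameCycle.refl σ x)))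
  rw [hker, LinearMap.finrank_range_of_inj, cycleCount]
  · have := Fintype.ofFinite (Quotient (Equiv.Perm.SameCycle.setoid σ))
    rw [Module.finrank_fintype_fun_eq_card, Nat.card_eq_fintype_card]
  · exact LinearMap.funLeft_injective_of_surjective _ _ _ Quotient.mk_surjective

namespace RibbonGraph

/-- A connected ribbon graph satisfies `V - E + b ≤ 2`. This is the inequality for the fixed spaces
of the permutations of the half-edges acting on the functions of half-edges. -/
theorem Connected.card_add_le {Γ : RibbonGraph} (hΓ : Γ.Connected) :
    Nat.card Γ.Vertex + Γ.boundaryCount ≤ Nat.card Γ.Edge + 2 := by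
  classical
  have := Fintype.ofFinite Γ.H
  obtain ⟨⟨h₀⟩, hcl⟩ := Γ.connected_iff.1 hΓ
  set A := LinearMap.funLeft ℚ ℚ Γ.next
  set B := LinearMap.funLeft ℚ ℚ Γ.opp
  have hBA : B * A = LinearMap.funLeft ℚ ℚ (Γ.next * Γ.opp) := rfl
  have key := finrank_ker_one_sub_mul_le A B
  rw [hBA, finrank_ker_one_sub_funLeft, finrank_ker_one_sub_funLeft, finrank_ker_one_sub_funLeft,
    Module.finrank_fintype_fun_eq_card, ← Nat.card_eq_fintype_card, card_eq_two_mul_edge,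
    ← boundaryCount_eq, ← card_vertex, ← card_edge] at key
  have hconst : Module.finrank ℚ ↥(LinearMap.ker (1 - A) ⊓ LinearMap.ker (1 - B)) ≤ 1 := by
    refine finrank_le_one ⟨fun _ => 1, ?_⟩ ?_
    · constructor <;>
        (rw [SetLike.mem_coe, LinearMap.mem_ker, LinearMap.sub_apply, sub_eq_zero]; rfl)
    · rintro ⟨f, hfA, hfB⟩
      rw [SetLike.mem_coe, LinearMap.mem_ker, LinearMap.sub_apply, sub_eq_zero] at hfA hfB
      refine ⟨f h₀, Subtype.ext ?_⟩
      have huniv := hcl {h | f h = f h₀}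
        ⟨fun h => by rw [Set.mem_ofPred_eq, ← show f h = f (Γ.next h) from congrFun hfA h]; rfl,
          fun h => by rw [Set.mem_ofPred_eq, ← show f h = f (Γ.opp h) from congrFun hfB h]; rfl⟩
        ⟨h₀, rfl⟩
      ext h
      have : h ∈ {h | f h = f h₀} := huniv ▸ Set.mem_univ h
      simpa using this.symm
  set T := LinearMap.range (1 - A) ⊔ LinearMap.range (1 - B) with hT
  have htop : T ⊔ Submodule.span ℚ {Pi.single h₀ (1 : ℚ)} = ⊤ := by
    set T' := T ⊔ Submodule.span ℚ {Pi.single h₀ (1 : ℚ)}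
    have hmove : ∀ (σ : Equiv.Perm Γ.H), LinearMap.range (1 - LinearMap.funLeft ℚ ℚ σ) ≤ T' →
        ∀ h, Pi.single (σ h) (1 : ℚ) ∈ T' ↔ Pi.single h (1 : ℚ) ∈ T' := by
      intro σ hσ h
      have hmem : Pi.single (σ h) (1 : ℚ) - Pi.single h 1 ∈ T' := by
        refine hσ ⟨Pi.single (σ h) 1, ?_⟩
        ext x
        simp [LinearMap.funLeft_apply, Pi.single_apply, σ.injective.eq_iff]
      exact ⟨fun hh => by simpa using T'.sub_mem hh hmem,
        fun hh => by simpa using T'.add_mem hmem hh⟩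
    set K : Set Γ.H := {h | (Pi.single h 1 : Γ.H → ℚ) ∈ T'}
    have huniv := hcl K
      ⟨hmove Γ.next (le_sup_left.trans le_sup_left), hmove Γ.opp (le_sup_right.trans le_sup_left)⟩
      ⟨h₀, (le_sup_right : _ ≤ T') (Submodule.mem_span_singleton_self _)⟩
    rw [eq_top_iff, ← (Pi.basisFun ℚ Γ.H).span_eq, Submodule.span_le]
    rintro _ ⟨h, rfl⟩
    rw [Pi.basisFun_apply]
    exact (huniv ▸ Set.mem_univ h : h ∈ K)
  have hdim := Submodule.finrank_add_le_finrank_add_finrank T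
    (Submodule.span ℚ {(Pi.single h₀ (1 : ℚ) : Γ.H → ℚ)})
  rw [finrank_span_singleton (Pi.single_ne_zero_iff.2 one_ne_zero), htop, finrank_top,
    Module.finrank_fintype_fun_eq_card, ← Nat.card_eq_fintype_card,
    card_eq_two_mul_edge] at hdim
  omega

theorem Connected.boundaryCount_pos {Γ : RibbonGraph} (hΓ : Γ.Connected) : 0 < Γ.boundaryCount := by
  obtain ⟨⟨h⟩, -⟩ := Γ.connected_iff.1 hΓ
  have : Finite Γ.BoundaryCircuit :=
    inferInstanceAs (Finite (Quotient (Equiv.Perm.SameCycle.setoid (Γ.next * Γ.opp))))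
  have : Nonempty Γ.BoundaryCircuit := ⟨Quotient.mk _ h⟩
  exact Nat.card_pos

/-- A connected ribbon graph is of exactly one type `(g, s)`. -/
theorem Connected.exists_genus {Γ : RibbonGraph} (hΓ : Γ.Connected) :
    ∃ g : ℕ, Γ.eulerChar = 2 - 2 * (g : ℤ) - (Γ.boundaryCount : ℤ) := by
  obtain ⟨k, hk⟩ := Γ.even_vertex_add_edge_add_boundary
  have hle := hΓ.card_add_le
  refine ⟨Nat.card Γ.Edge + 1 - k, ?_⟩
  rw [eulerChar]
  omega

theorem three_mul_vertex_le (Γ : RibbonGraph) (h : ∀ v, 3 ≤ Γ.degree v) :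
    3 * Nat.card Γ.Vertex ≤ 2 * Nat.card Γ.Edge := by
  have := Fintype.ofFinite Γ.Vertex
  rw [← card_eq_two_mul_edge, card_eq_sum_degree, finsum_eq_sum_of_fintype,
    Nat.card_eq_fintype_card, mul_comm, ← smul_eq_mul, ← Finset.card_univ]
  exact Finset.card_nsmul_le_sum _ _ _ fun v _ => h v

theorem Connected.eulerChar_neg {Γ : RibbonGraph} (hΓ : Γ.Connected) (h : ∀ v, 3 ≤ Γ.degree v) :
    Γ.eulerChar < 0 := by
  have h3 := Γ.three_mul_vertex_le h
  have : Nonempty Γ.Vertex := hΓ.1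
  have hpos : 0 < Nat.card Γ.Vertex := Nat.card_pos
  rw [eulerChar]
  omega

theorem card_le_of_eulerChar {Γ : RibbonGraph} (h : ∀ v, 3 ≤ Γ.degree v) :
    (Nat.card Γ.H : ℤ) ≤ -6 * Γ.eulerChar := by
  have h3 := Γ.three_mul_vertex_le h
  rw [eulerChar, card_eq_two_mul_edge]
  push_cast
  omega

end RibbonGraph

open RibbonGraph

/-! ### Regrouping by type and the limit -/

/-- With all degrees at least `3`, the Euler characteristic bounds the number of half-edges. -/
theorem finite_connectedGraphsOfType {S : Set ℕ} (hS : S ⊆ Set.Ici 3) (g s : ℕ) :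
    (connectedGraphsOfType S g s).Finite := by
  refine (Set.Finite.biUnion (Set.finite_Iic (12 * g + 6 * s)) fun N _ =>
    (ribbonClasses N).finite_toSet).subset fun q hq => ?_
  have h := card_le_of_eulerChar fun v => hS (hq.1.2 v)
  rw [hq.2.1] at h
  exact Set.mem_biUnion (x := Nat.card q.out.H) (Set.mem_Iic.2 (by omega))
    (mem_ribbonClasses.2 rfl)

theorem coeff_typeSum {S : Set ℕ} (hS : S ⊆ Set.Ici 3) (g s : ℕ) (d : S →₀ ℕ) :
    MvPowerSeries.coeff d (typeSum S g s) = open Classical in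
      ∑ q ∈ (ribbonClasses (halfEdges d)).filter (· ∈ connectedGraphsOfType S g s),
        MvPowerSeries.coeff d (q.out.term S) := by
  classical
  have hfin := finite_connectedGraphsOfType hS g s
  rw [typeSum, finsum_mem_eq_finite_toFinset_sum _ hfin, map_sum]
  symm
  refine Finset.sum_subset (fun q hq => ?_) fun q hq hq' => ?_
  · exact hfin.mem_toFinset.2 (Finset.mem_filter.1 hq).2
  · by_contra hne
    have hq := hfin.mem_toFinset.1 hq
    exact hq' (Finset.mem_filter.2 ⟨coeff_term_ne_zero hq.1.2 hne, hq⟩)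

theorem exists_type_of_mem_connectedGraphs {S : Set ℕ} (hS : S ⊆ Set.Ici 3) {q : RibbonClass}
    (hq : q ∈ connectedGraphs S) :
    ∃ p : stableTypes, q ∈ connectedGraphsOfType S p.1.1 p.1.2 := by
  obtain ⟨g, hg⟩ := hq.1.exists_genus
  have hneg := hq.1.eulerChar_neg fun v => hS (hq.2 v)
  rw [hg] at hneg
  exact ⟨⟨(g, q.out.boundaryCount), hq.1.boundaryCount_pos, hneg⟩, hq, hg, rfl⟩

theorem type_unique {S : Set ℕ} {q : RibbonClass} {p p' : stableTypes}
    (h : q ∈ connectedGraphsOfType S p.1.1 p.1.2) (h' : q ∈ connectedGraphsOfType S p'.1.1 p'.1.2) :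
    p = p' := by
  have h2 : p.1.2 = p'.1.2 := h.2.2.symm.trans h'.2.2
  have h1 := h.2.1.symm.trans h'.2.1
  refine Subtype.ext (Prod.ext ?_ h2)
  rw [h2] at h1
  omega

theorem isFormalSum_typeSum {S : Set ℕ} (hS : S ⊆ Set.Ici 3) :
    IsFormalSum (fun p : stableTypes => typeSum S p.1.1 p.1.2) (connectedSeries S) := by
  classical
  intro d
  have hex : ∀ q ∈ (ribbonClasses (halfEdges d)).filter (· ∈ connectedGraphs S),
      ∃ p : stableTypes, q ∈ connectedGraphsOfType S p.1.1 p.1.2 :=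
    fun q hq => exists_type_of_mem_connectedGraphs hS (Finset.mem_filter.1 hq).2
  have : Nonempty stableTypes := ⟨⟨(1, 1), by norm_num [stableTypes]⟩⟩
  choose! type htype using hex
  set T := ((ribbonClasses (halfEdges d)).filter (· ∈ connectedGraphs S)).image type with hT
  have hsub : Function.support (fun p : stableTypes =>
      MvPowerSeries.coeff d (typeSum S p.1.1 p.1.2)) ⊆ (T : Set stableTypes) := by
    intro p hp
    rw [Function.mem_support, coeff_typeSum hS] at hp
    obtain ⟨q, hq, -⟩ := Finset.exists_ne_zero_of_sum_ne_zero hp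
    rw [Finset.mem_filter] at hq
    have hq' : q ∈ (ribbonClasses (halfEdges d)).filter (· ∈ connectedGraphs S) :=
      Finset.mem_filter.2 ⟨hq.1, hq.2.1⟩
    rw [type_unique hq.2 (htype q hq')]
    exact Finset.mem_coe.2 (Finset.mem_image_of_mem _ hq')
  refine ⟨T.finite_toSet.subset hsub, ?_⟩
  rw [finsum_eq_sum_of_support_subset _ hsub, coeff_connectedSeries,
    ← Finset.sum_fiberwise_of_maps_to (g := type) (t := T)
      fun q hq => Finset.mem_image_of_mem _ hq]
  refine Finset.sum_congr rfl fun p _ => ?_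
  rw [coeff_typeSum hS, Finset.filter_filter]
  refine Finset.sum_congr (Finset.filter_congr fun q hq => ?_) fun _ _ => rfl
  constructor
  · rintro ⟨hc, rfl⟩
    exact htype q (Finset.mem_filter.2 ⟨hq, hc⟩)
  · intro h
    exact ⟨h.1, type_unique (htype q (Finset.mem_filter.2 ⟨hq, h.1⟩)) h⟩

theorem proj_eq_iff {j : ℕ} {F G : MvPowerSeries (Set.Ici (3 : ℕ)) ℚ[X]} :
    proj j F = proj j G ↔
      ∀ d, tDegree d ≤ j → MvPowerSeries.coeff d F = MvPowerSeries.coeff d G := by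
  rw [proj, Ideal.Quotient.eq]
  refine forall₂_congr fun d _ => ?_
  rw [map_sub, sub_eq_zero]

theorem tDegree_eq_halfEdges (d : Set.Ici (3 : ℕ) →₀ ℕ) : tDegree d = halfEdges d := by
  rw [tDegree, Finsupp.weight_apply, halfEdges]
  exact Finsupp.sum_congr fun j _ => by rw [smul_eq_mul, mul_comm]

/-- Only the variables `t_j` with `j ≤ 2 m` matter in degree at most `2 m`. -/
theorem coeff_includeVars_connectedSeries {m : ℕ} {d : Set.Ici (3 : ℕ) →₀ ℕ}
    (hd : tDegree d ≤ 2 * m) :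
    MvPowerSeries.coeff d (includeVars m (connectedSeries (Set.Icc 3 (2 * m)))) =
      MvPowerSeries.coeff d (connectedSeries (Set.Ici 3)) := by
  classical
  set ι := Set.embeddingOfSubset (Set.Icc 3 (2 * m)) (Set.Ici 3) Set.Icc_subset_Ici_self with hι
  have hsupp : ∀ j ∈ d.support, j.1 ≤ 2 * m := by
    intro j hj
    refine le_trans ?_ hd
    rw [tDegree_eq_halfEdges]
    refine le_trans ?_ (Finset.single_le_sum (fun _ _ => Nat.zero_le _) hj)
    exact Nat.le_mul_of_pos_right _ (Nat.pos_of_ne_zero (Finsupp.mem_support_iff.1 hj))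
  have hrange : (d.support : Set (Set.Ici (3 : ℕ))) ⊆ Set.range ι :=
    fun j hj => ⟨⟨j.1, j.2, hsupp j hj⟩, rfl⟩
  set e : Set.Icc 3 (2 * m) →₀ ℕ := d.comapDomain ι ι.injective.injOn with he
  have hed : e.embDomain ι = d := by
    rw [he, Finsupp.embDomain_comapDomain hrange]
  have heapp : ∀ j, e j = d (ι j) := fun j => rfl
  have hhalf : halfEdges e = halfEdges d := by
    rw [← hed, halfEdges, halfEdges, Finsupp.sum_embDomain]
    rfl
  have hcoeff : MvPowerSeries.coeff d (includeVars m (connectedSeries (Set.Icc 3 (2 * m)))) =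
      MvPowerSeries.coeff e (connectedSeries (Set.Icc 3 (2 * m))) := by
    conv_lhs => rw [← hed]
    exact MvPowerSeries.coeff_embDomain_rename _ _ _
  rw [hcoeff, coeff_connectedSeries, coeff_connectedSeries, hhalf]
  have hterm : ∀ q ∈ ribbonClasses (halfEdges d), q ∈ connectedGraphs (Set.Ici 3) →
      MvPowerSeries.coeff d (q.out.term (Set.Ici 3)) ≠ 0 → ∀ v, q.out.degree v ≤ 2 * m := by
    intro q _ hq hne v
    rw [RibbonGraph.term, MvPowerSeries.coeff_monomial] at hne
    have hexp : d = q.out.exponent (Set.Ici 3) := by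
      by_contra h
      exact hne (if_neg h)
    refine hsupp ⟨q.out.degree v, hq.2 v⟩ ?_
    rw [Finsupp.mem_support_iff, hexp, exponent_apply, vertexCount]
    have : Nonempty {w : q.out.Vertex // q.out.degree w = q.out.degree v} := ⟨⟨v, rfl⟩⟩
    exact Nat.card_pos.ne'
  have heq : ∀ q : RibbonClass, (∀ v, q.out.degree v ∈ Set.Icc 3 (2 * m)) →
      MvPowerSeries.coeff e (q.out.term (Set.Icc 3 (2 * m))) =
        MvPowerSeries.coeff d (q.out.term (Set.Ici 3)) := by
    intro q hq
    have hiff : e = q.out.exponent (Set.Icc 3 (2 * m)) ↔ d = q.out.exponent (Set.Ici 3) := by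
      constructor
      · intro h
        ext j
        by_cases hj : j.1 ≤ 2 * m
        · have := DFunLike.congr_fun h ⟨j.1, j.2, hj⟩
          exact this
        · have h0 : d j = 0 := by
            by_contra hne
            exact hj (hsupp j (Finsupp.mem_support_iff.2 hne))
          have : IsEmpty {w : q.out.Vertex // q.out.degree w = j.1} :=
            ⟨fun w => hj (w.2 ▸ (hq w.1).2)⟩
          rw [h0]
          exact Nat.card_of_isEmpty.symm
      · intro h
        ext j
        exact DFunLike.congr_fun h (ι j)
    rw [RibbonGraph.term, RibbonGraph.term, MvPowerSeries.coeff_monomial,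
      MvPowerSeries.coeff_monomial]
    exact if_congr hiff rfl rfl
  rw [Finset.sum_congr rfl fun q hq => heq q (Finset.mem_filter.1 hq).2.2]
  refine Finset.sum_subset (fun q hq => ?_) fun q hq hq' => ?_
  · rw [Finset.mem_filter] at hq ⊢
    exact ⟨hq.1, hq.2.1, fun v => (hq.2.2 v).1⟩
  · by_contra hne
    rw [Finset.mem_filter] at hq
    exact hq' (Finset.mem_filter.2 ⟨hq.1, hq.2.1, fun v => ⟨hq.2.2 v, hterm q hq.1 hq.2 hne v⟩⟩)

theorem isSeriesLimit_connectedSeries :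
    IsSeriesLimit (fun m => includeVars m (connectedSeries (Set.Icc 3 (2 * m))))
      (connectedSeries (Set.Ici 3)) := fun _ _ =>
  proj_eq_iff.2 fun _ hd => (coeff_includeVars_connectedSeries hd).symm

theorem IsSeriesLimit.unique {F : ℕ → MvPowerSeries (Set.Ici (3 : ℕ)) ℚ[X]}
    {L L' : MvPowerSeries (Set.Ici (3 : ℕ)) ℚ[X]} (h : IsSeriesLimit F L)
    (h' : IsSeriesLimit F L') : L = L' := by
  ext1 d
  exact proj_eq_iff.1 ((h (tDegree d + 2) (by omega)).trans (h' (tDegree d + 2) (by omega)).symm)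
    d (by omega)

/-! ### The Gaussian measure on Hermitian matrices -/

section Gaussian

open MeasureTheory

variable {n : ℕ}

theorem hermitianMatrix_add_smul (x v : HermitianCoord n) (t : ℝ) :
    hermitianMatrix (x + t • v) = hermitianMatrix x + (t : ℂ) • hermitianMatrix v := by
  ext i j
  rcases lt_trichotomy i j with h | h | h
  · simp [hermitianMatrix, h]
  · subst h; simp [hermitianMatrix]
  · simp [hermitianMatrix, h, h.not_gt]

/-- The coordinates of a Hermitian matrix. -/
def hermitianCoord (M : Matrix (Fin n) (Fin n) ℂ) : HermitianCoord n :=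
  (fun i => (M i i).re, fun p => M p.1.1 p.1.2)

theorem hermitianMatrix_hermitianCoord {M : Matrix (Fin n) (Fin n) ℂ} (hM : M.IsHermitian) :
    hermitianMatrix (hermitianCoord M) = M := by
  ext i j
  rcases lt_trichotomy i j with h | h | h
  · simp [hermitianMatrix, hermitianCoord, h]
  · subst h
    have := hM.apply i i
    simpa [hermitianMatrix, hermitianCoord] using Complex.conj_eq_iff_re.1 this
  · simpa [hermitianMatrix, hermitianCoord, h, h.not_gt] using hM.apply i j

/-- Every matrix is a complex combination of two Hermitian matrices. -/
theorem exists_hermitian_decomposition (M : Matrix (Fin n) (Fin n) ℂ) :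
    ∃ v w : HermitianCoord n, M = hermitianMatrix v + Complex.I • hermitianMatrix w := by
  have h1 : ((1 / 2 : ℂ) • (M + M.conjTranspose)).IsHermitian := by
    rw [Matrix.IsHermitian, Matrix.conjTranspose_smul, Matrix.conjTranspose_add,
      Matrix.conjTranspose_conjTranspose, add_comm]
    simp
  have h2 : ((-Complex.I / 2 : ℂ) • (M - M.conjTranspose)).IsHermitian := by
    rw [Matrix.IsHermitian, Matrix.conjTranspose_smul, Matrix.conjTranspose_sub,
      Matrix.conjTranspose_conjTranspose, ← neg_sub M, smul_neg, ← neg_smul]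
    congr 1
    simp [neg_div]
  refine ⟨hermitianCoord ((1 / 2 : ℂ) • (M + M.conjTranspose)),
    hermitianCoord ((-Complex.I / 2 : ℂ) • (M - M.conjTranspose)), ?_⟩
  · rw [hermitianMatrix_hermitianCoord h1, hermitianMatrix_hermitianCoord h2, smul_smul,
      show Complex.I * (-Complex.I / 2) = 1 / 2 by
        rw [mul_div_assoc', mul_neg, Complex.I_mul_I, neg_neg]]
    ext i j
    simp only [Matrix.add_apply, Matrix.smul_apply, Matrix.sub_apply, smul_eq_mul]
    ring

/-- The quadratic form `tr X²` in coordinates. -/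
def traceSq (x : HermitianCoord n) : ℝ := ∑ i, x.1 i ^ 2 + 2 * ∑ p, ‖x.2 p‖ ^ 2

theorem traceSq_nonneg (x : HermitianCoord n) : 0 ≤ traceSq x := by
  unfold traceSq; positivity

theorem trace_sq_eq_sum (x : HermitianCoord n) :
    (hermitianMatrix x ^ 2).trace = ((∑ i, ∑ j, ‖hermitianMatrix x i j‖ ^ 2 : ℝ) : ℂ) := by
  rw [pow_two, Matrix.trace]
  push_cast
  refine Finset.sum_congr rfl fun i _ => ?_
  rw [Matrix.diag_apply, Matrix.mul_apply]
  refine Finset.sum_congr rfl fun j _ => ?_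
  rw [← (isHermitian_hermitianMatrix x).apply j i, ← Complex.ofReal_pow,
    ← Complex.normSq_eq_norm_sq,
    ← Complex.mul_conj]
  rfl

theorem sum_norm_sq_eq_traceSq (x : HermitianCoord n) :
    ∑ i, ∑ j, ‖hermitianMatrix x i j‖ ^ 2 = traceSq x := by
  classical
  set f : Fin n × Fin n → ℝ := fun q => ‖hermitianMatrix x q.1 q.2‖ ^ 2
  have hsymm : ∀ q : Fin n × Fin n, f q.swap = f q := by
    intro q
    change ‖hermitianMatrix x q.2 q.1‖ ^ 2 = ‖hermitianMatrix x q.1 q.2‖ ^ 2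
    rw [← (isHermitian_hermitianMatrix x).apply q.2 q.1, norm_star]
  have hlt : ∑ q : Fin n × Fin n with q.1 < q.2, f q = ∑ p, ‖x.2 p‖ ^ 2 := by
    rw [Finset.sum_subtype (p := fun q : Fin n × Fin n => q.1 < q.2) _ (by simp)]
    refine Finset.sum_congr rfl fun p _ => ?_
    simp only [f, hermitianMatrix, Matrix.of_apply, dif_pos p.2]
  have hgt : ∑ q : Fin n × Fin n with q.2 < q.1, f q = ∑ q : Fin n × Fin n with q.1 < q.2, f q := by
    refine Finset.sum_bij' (fun q _ => q.swap) (fun q _ => q.swap) ?_ ?_ ?_ ?_ ?_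
    · simp
    · simp
    · simp
    · simp
    · exact fun q _ => (hsymm q).symm
  have heq : ∑ q : Fin n × Fin n with q.1 = q.2, f q = ∑ i, x.1 i ^ 2 := by
    refine (Finset.sum_bij (fun i _ => (i, i)) ?_ ?_ ?_ ?_).symm
    · simp
    · intro i _ j _ h; exact congrArg Prod.fst h
    · rintro ⟨i, j⟩ h
      obtain rfl : i = j := by simpa using h
      exact ⟨i, Finset.mem_univ _, rfl⟩
    · intro i _
      simp [f, hermitianMatrix]
  rw [← Fintype.sum_prod_type' (f := fun i j => ‖hermitianMatrix x i j‖ ^ 2), traceSq,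
    ← Finset.sum_filter_add_sum_filter_not _ (fun q : Fin n × Fin n => q.1 = q.2),
    ← Finset.sum_filter_add_sum_filter_not (Finset.univ.filter fun q : Fin n × Fin n => ¬ q.1 = q.2)
      (fun q : Fin n × Fin n => q.1 < q.2), Finset.filter_filter, Finset.filter_filter]
  have e1 : (Finset.univ.filter fun q : Fin n × Fin n => ¬ q.1 = q.2 ∧ q.1 < q.2) =
      Finset.univ.filter fun q => q.1 < q.2 := by
    ext q; simp only [Finset.mem_filter, Finset.mem_univ, true_and]; omega
  have e2 : (Finset.univ.filter fun q : Fin n × Fin n => ¬ q.1 = q.2 ∧ ¬ q.1 < q.2) =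
      Finset.univ.filter fun q => q.2 < q.1 := by
    ext q; simp only [Finset.mem_filter, Finset.mem_univ, true_and]; omega
  rw [e1, e2]
  change ∑ q : Fin n × Fin n with q.1 = q.2, f q + (∑ q : Fin n × Fin n with q.1 < q.2, f q +
    ∑ q : Fin n × Fin n with q.2 < q.1, f q) = _
  rw [hgt, hlt, heq]
  ring

theorem trace_sq (x : HermitianCoord n) : (hermitianMatrix x ^ 2).trace = (traceSq x : ℂ) := by
  rw [trace_sq_eq_sum, sum_norm_sq_eq_traceSq]

theorem norm_apply_sq_le_traceSq (x : HermitianCoord n) (i j : Fin n) :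
    ‖hermitianMatrix x i j‖ ^ 2 ≤ traceSq x := by
  rw [← sum_norm_sq_eq_traceSq]
  refine le_trans ?_ (Finset.single_le_sum
    (f := fun i => ∑ j, ‖hermitianMatrix x i j‖ ^ 2) (fun _ _ => by positivity) (Finset.mem_univ i))
  exact Finset.single_le_sum (f := fun j => ‖hermitianMatrix x i j‖ ^ 2)
    (fun _ _ => by positivity) (Finset.mem_univ j)

theorem continuous_traceSq : Continuous (traceSq (n := n)) := by
  unfold traceSq; fun_prop

theorem continuous_hermitianMatrix_apply (i j : Fin n) :
    Continuous fun x : HermitianCoord n => hermitianMatrix x i j := by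
  rcases lt_trichotomy i j with h | h | h
  · simp only [hermitianMatrix, Matrix.of_apply, dif_pos h]; fun_prop
  · subst h; simp only [hermitianMatrix, Matrix.of_apply, lt_irrefl, dite_false]; fun_prop
  · simp only [hermitianMatrix, Matrix.of_apply, dif_neg h.not_gt, dif_pos h]; fun_prop

theorem gaussianWeight_eq (x : HermitianCoord n) :
    gaussianWeight x = (Real.exp (-(1 / 2) * traceSq x) : ℂ) := by
  rw [gaussianWeight, trace_sq, Complex.ofReal_exp]
  push_cast
  rfl

theorem norm_gaussianWeight (x : HermitianCoord n) :
    ‖gaussianWeight x‖ = Real.exp (-(1 / 2) * traceSq x) := by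
  rw [gaussianWeight_eq, Complex.norm_real, Real.norm_of_nonneg (Real.exp_pos _).le]

theorem continuous_gaussianWeight : Continuous (gaussianWeight (n := n)) := by
  simp only [funext gaussianWeight_eq]
  exact Complex.continuous_ofReal.comp
    (Real.continuous_exp.comp (continuous_const.mul continuous_traceSq))

theorem integrable_exp_neg_mul_norm_sq_complex {c : ℝ} (hc : 0 < c) :
    Integrable fun z : ℂ => Real.exp (-c * ‖z‖ ^ 2) := by
  have h := GaussianFourier.integrable_cexp_neg_mul_sq_norm_add (V := ℂ) (b := (c : ℂ))
    (by simpa using hc) 0 0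
  refine h.norm.congr (Filter.Eventually.of_forall fun z => ?_)
  dsimp only
  rw [Complex.norm_exp]
  congr 1
  simp [← Complex.ofReal_pow, ← Complex.ofReal_neg, ← Complex.ofReal_mul]

theorem integrable_exp_neg_mul_traceSq {c : ℝ} (hc : 0 < c) :
    Integrable fun x : HermitianCoord n => Real.exp (-c * traceSq x) := by
  have h1 : Integrable fun y : Fin n → ℝ => ∏ i, Real.exp (-c * y i ^ 2) :=
    Integrable.fintype_prod fun _ => integrable_exp_neg_mul_sq hc
  have h2 : Integrable fun z : {p : Fin n × Fin n // p.1 < p.2} → ℂ =>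
      ∏ p, Real.exp (-(2 * c) * ‖z p‖ ^ 2) :=
    Integrable.fintype_prod fun _ => integrable_exp_neg_mul_norm_sq_complex (by positivity)
  refine (h1.mul_prod h2).congr (Filter.Eventually.of_forall fun x => ?_)
  dsimp only
  rw [← Real.exp_sum, ← Real.exp_sum, ← Real.exp_add, ← Finset.mul_sum, ← Finset.mul_sum, traceSq]
  congr 1
  ring

/-- Continuous functions of polynomial growth on the space of Hermitian matrices. -/
def PolyGrowth (f : HermitianCoord n → ℂ) : Prop :=
  Continuous f ∧ ∃ (C : ℝ) (k : ℕ), ∀ x, ‖f x‖ ≤ C * (1 + traceSq x) ^ k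

theorem PolyGrowth.const (c : ℂ) : PolyGrowth fun _ : HermitianCoord n => c :=
  ⟨continuous_const, ‖c‖, 0, fun x => by simp⟩

theorem PolyGrowth.mul {f g : HermitianCoord n → ℂ} (hf : PolyGrowth f) (hg : PolyGrowth g) :
    PolyGrowth fun x => f x * g x := by
  obtain ⟨hfc, C, k, hC⟩ := hf
  obtain ⟨hgc, D, l, hD⟩ := hg
  refine ⟨hfc.mul hgc, C * D, k + l, fun x => ?_⟩
  rw [norm_mul, pow_add, mul_mul_mul_comm]
  exact mul_le_mul (hC x) (hD x) (norm_nonneg _) ((norm_nonneg _).trans (hC x))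

theorem PolyGrowth.add {f g : HermitianCoord n → ℂ} (hf : PolyGrowth f) (hg : PolyGrowth g) :
    PolyGrowth fun x => f x + g x := by
  obtain ⟨hfc, C, k, hC⟩ := hf
  obtain ⟨hgc, D, l, hD⟩ := hg
  refine ⟨hfc.add hgc, |C| + |D|, k + l, fun x => ?_⟩
  have h1 : (1 : ℝ) ≤ 1 + traceSq x := by linarith [traceSq_nonneg x]
  have hk : (1 + traceSq x) ^ k ≤ (1 + traceSq x) ^ (k + l) :=
    pow_le_pow_right₀ h1 (Nat.le_add_right _ _)
  have hl : (1 + traceSq x) ^ l ≤ (1 + traceSq x) ^ (k + l) :=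
    pow_le_pow_right₀ h1 (Nat.le_add_left _ _)
  have hk0 : 0 ≤ (1 + traceSq x) ^ k := by positivity
  have hl0 : 0 ≤ (1 + traceSq x) ^ l := by positivity
  rw [add_mul]
  refine (norm_add_le _ _).trans (add_le_add ((hC x).trans ?_) ((hD x).trans ?_))
  · exact mul_le_mul (le_abs_self C) hk hk0 (abs_nonneg C)
  · exact mul_le_mul (le_abs_self D) hl hl0 (abs_nonneg D)

theorem PolyGrowth.sum {ι : Type*} {s : Finset ι} {f : ι → HermitianCoord n → ℂ}
    (hf : ∀ i ∈ s, PolyGrowth (f i)) : PolyGrowth fun x => ∑ i ∈ s, f i x := by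
  classical
  induction s using Finset.induction_on with
  | empty => simpa using PolyGrowth.const 0
  | insert i s hi ih =>
    simp only [Finset.sum_insert hi]
    exact (hf i (Finset.mem_insert_self _ _)).add
      (ih fun j hj => hf j (Finset.mem_insert_of_mem hj))

theorem PolyGrowth.prod {ι : Type*} {s : Finset ι} {f : ι → HermitianCoord n → ℂ}
    (hf : ∀ i ∈ s, PolyGrowth (f i)) : PolyGrowth fun x => ∏ i ∈ s, f i x := by
  classical
  induction s using Finset.induction_on with
  | empty => simpa using PolyGrowth.const 1
  | insert i s hi ih =>
    simp only [Finset.prod_insert hi]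
    exact (hf i (Finset.mem_insert_self _ _)).mul
      (ih fun j hj => hf j (Finset.mem_insert_of_mem hj))

theorem PolyGrowth.pow {f : HermitianCoord n → ℂ} (hf : PolyGrowth f) (k : ℕ) :
    PolyGrowth fun x => f x ^ k := by
  simpa using PolyGrowth.prod (s := Finset.range k) fun _ _ => hf

theorem polyGrowth_apply (i j : Fin n) :
    PolyGrowth fun x : HermitianCoord n => hermitianMatrix x i j := by
  refine ⟨continuous_hermitianMatrix_apply i j, 1, 1, fun x => ?_⟩
  have := norm_apply_sq_le_traceSq x i j
  nlinarith [sq_nonneg (‖hermitianMatrix x i j‖ - 1), norm_nonneg (hermitianMatrix x i j)]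

theorem PolyGrowth.integrable {f : HermitianCoord n → ℂ} (hf : PolyGrowth f) :
    Integrable fun x => f x * gaussianWeight x := by
  obtain ⟨hc, C, k, hC⟩ := hf
  have hint := (integrable_exp_neg_mul_traceSq (n := n) (c := 1 / 4) (by norm_num)).const_mul
    (|C| * (k.factorial * 4 ^ k) * Real.exp (1 / 4))
  refine hint.mono' (hc.mul continuous_gaussianWeight).aestronglyMeasurable
    (Filter.Eventually.of_forall fun x => ?_)
  have h0 := traceSq_nonneg x
  have hpow : (1 + traceSq x) ^ k ≤ k.factorial * 4 ^ k * Real.exp ((1 + traceSq x) / 4) := by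
    have := Real.pow_div_factorial_le_exp ((1 + traceSq x) / 4) (by positivity) k
    rw [div_pow, div_div, div_le_iff₀ (by positivity)] at this
    linarith
  rw [norm_mul, norm_gaussianWeight]
  have hexp : Real.exp ((1 + traceSq x) / 4) * Real.exp (-(1 / 2) * traceSq x) =
      Real.exp (1 / 4) * Real.exp (-(1 / 4) * traceSq x) := by
    rw [← Real.exp_add, ← Real.exp_add]
    congr 1
    ring
  calc ‖f x‖ * Real.exp (-(1 / 2) * traceSq x)
      ≤ |C| * (k.factorial * 4 ^ k * Real.exp ((1 + traceSq x) / 4)) *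
          Real.exp (-(1 / 2) * traceSq x) := by
        refine mul_le_mul_of_nonneg_right ((hC x).trans ?_) (Real.exp_pos _).le
        exact mul_le_mul (le_abs_self C) hpow (by positivity) (abs_nonneg C)
    _ = _ := by
        rw [← mul_assoc, mul_assoc (|C| * _), hexp]
        ring

theorem hasLineDerivAt_gaussianWeight (x v : HermitianCoord n) :
    HasLineDerivAt ℝ gaussianWeight
      (-(hermitianMatrix x * hermitianMatrix v).trace * gaussianWeight x) x v := by
  set X := hermitianMatrix x
  set V := hermitianMatrix v
  have hfun : (fun t : ℝ => gaussianWeight (x + t • v)) = fun t : ℝ => Complex.exp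
      (-(1 / 2) * ((X ^ 2).trace + 2 * (t : ℂ) * (X * V).trace + (t : ℂ) ^ 2 * (V ^ 2).trace)) := by
    ext t
    rw [gaussianWeight, hermitianMatrix_add_smul]
    congr 2
    change ((X + (t : ℂ) • V) ^ 2).trace = _
    rw [pow_two, pow_two X, pow_two V, add_mul, mul_add, mul_add]
    simp only [Matrix.trace_add, smul_mul_assoc, mul_smul_comm, Matrix.trace_smul, smul_eq_mul,
      Matrix.trace_mul_comm V X]
    ring
  rw [HasLineDerivAt, hfun]
  have hofReal : HasDerivAt (fun t : ℝ => (t : ℂ)) 1 0 := Complex.ofRealCLM.hasDerivAt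
  have h := ((((hofReal.const_mul 2).mul_const ((X * V).trace)).const_add ((X ^ 2).trace)).add
    ((hofReal.pow 2).mul_const ((V ^ 2).trace))).const_mul (-(1 / 2) : ℂ) |>.cexp
  refine h.congr_deriv ?_
  simp [gaussianWeight]
  ring

instance : (volume : Measure (HermitianCoord n)).IsAddHaarMeasure :=
  Measure.prod.instIsAddHaarMeasure _ _

/-- Integration by parts: in a Gaussian integral the linear form `tr(XM)` acts as the derivative in
the direction `M`. -/
theorem integral_trace_mul_prod {H : Type*} [DecidableEq H] (T : Finset H) (a b : H → Fin n)
    (M : Matrix (Fin n) (Fin n) ℂ) :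
    ∫ x : HermitianCoord n, (hermitianMatrix x * M).trace *
        (∏ h ∈ T, hermitianMatrix x (a h) (b h)) * gaussianWeight x =
      ∑ h ∈ T, M (a h) (b h) * ∫ x : HermitianCoord n,
        (∏ k ∈ T.erase h, hermitianMatrix x (a k) (b k)) * gaussianWeight x := by
  have hprod : ∀ T : Finset H,
      PolyGrowth fun x : HermitianCoord n => ∏ h ∈ T, hermitianMatrix x (a h) (b h) :=
    fun T => PolyGrowth.prod fun h _ => polyGrowth_apply _ _
  have htr : ∀ M : Matrix (Fin n) (Fin n) ℂ,
      PolyGrowth fun x : HermitianCoord n => (hermitianMatrix x * M).trace := fun M => by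
    simp only [Matrix.trace, Matrix.diag_apply, Matrix.mul_apply]
    exact PolyGrowth.sum fun i _ => PolyGrowth.sum fun j _ =>
      (polyGrowth_apply i j).mul (PolyGrowth.const _)
  -- Hermitian directions
  have hreal : ∀ v : HermitianCoord n,
      ∫ x : HermitianCoord n, (hermitianMatrix x * hermitianMatrix v).trace *
        (∏ h ∈ T, hermitianMatrix x (a h) (b h)) * gaussianWeight x =
      ∑ h ∈ T, hermitianMatrix v (a h) (b h) * ∫ x : HermitianCoord n,
        (∏ k ∈ T.erase h, hermitianMatrix x (a k) (b k)) * gaussianWeight x := by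
    intro v
    set f : HermitianCoord n → ℂ := fun x => ∏ h ∈ T, hermitianMatrix x (a h) (b h)
    set f' : HermitianCoord n → ℂ := fun x => ∑ h ∈ T,
      hermitianMatrix v (a h) (b h) * ∏ k ∈ T.erase h, hermitianMatrix x (a k) (b k) with hf'
    have hf'g : PolyGrowth f' := PolyGrowth.sum fun h _ => (PolyGrowth.const _).mul (hprod _)
    have hder : ∀ x, HasLineDerivAt ℝ f (f' x) x v := by
      intro x
      have hentry : ∀ h ∈ T, HasDerivAt (fun t : ℝ => hermitianMatrix (x + t • v) (a h) (b h))
          (hermitianMatrix v (a h) (b h)) 0 := by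
        intro h _
        have hofReal : HasDerivAt (fun t : ℝ => (t : ℂ)) 1 0 := Complex.ofRealCLM.hasDerivAt
        simp only [hermitianMatrix_add_smul, Matrix.add_apply, Matrix.smul_apply, smul_eq_mul]
        simpa using (hofReal.mul_const (hermitianMatrix v (a h) (b h))).const_add
          (hermitianMatrix x (a h) (b h))
      have := HasDerivAt.fun_finsetProd hentry
      refine this.congr_deriv ?_
      simp [hf', smul_eq_mul, mul_comm]
    have key := integral_bilinear_hasLineDerivAt_right_eq_neg_left_of_integrable
      (μ := (volume : Measure (HermitianCoord n))) (B := ContinuousLinearMap.mul ℝ ℂ) (v := v)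
      (f := f) (f' := f') (g := gaussianWeight)
      (g' := fun x => -(hermitianMatrix x * hermitianMatrix v).trace * gaussianWeight x)
      hf'g.integrable
      ((((hprod T).mul ((PolyGrowth.const (-1)).mul (htr _))).integrable).congr
        (Filter.Eventually.of_forall fun x => by
          simp only [ContinuousLinearMap.mul_apply']
          ring)) (hprod T).integrable (fun x _ => hder x)
      (fun x _ => hasLineDerivAt_gaussianWeight x v)
    simp only [ContinuousLinearMap.mul_apply'] at key
    have hlhs : ∫ x : HermitianCoord n, f x *
        (-(hermitianMatrix x * hermitianMatrix v).trace * gaussianWeight x) =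
        -∫ x : HermitianCoord n, (hermitianMatrix x * hermitianMatrix v).trace * f x *
          gaussianWeight x := by
      rw [← integral_neg]
      congr 1
      ext x
      ring
    rw [hlhs, neg_inj] at key
    rw [key, hf']
    simp only [Finset.sum_mul]
    rw [integral_finsetSum]
    · refine Finset.sum_congr rfl fun h _ => ?_
      simp only [mul_assoc]
      rw [integral_const_mul]
    · exact fun h _ => ((PolyGrowth.const _).mul (hprod _)).integrable
  obtain ⟨v, w, rfl⟩ := exists_hermitian_decomposition M
  have hsplit : ∀ x : HermitianCoord n,
      (hermitianMatrix x * (hermitianMatrix v + Complex.I • hermitianMatrix w)).trace *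
        (∏ h ∈ T, hermitianMatrix x (a h) (b h)) * gaussianWeight x =
      (hermitianMatrix x * hermitianMatrix v).trace *
        (∏ h ∈ T, hermitianMatrix x (a h) (b h)) * gaussianWeight x + Complex.I *
      ((hermitianMatrix x * hermitianMatrix w).trace *
        (∏ h ∈ T, hermitianMatrix x (a h) (b h)) * gaussianWeight x) := by
    intro x
    rw [mul_add, Matrix.trace_add, mul_smul_comm, Matrix.trace_smul, smul_eq_mul]
    ring
  simp only [hsplit]
  rw [integral_add ((htr _).mul (hprod T)).integrable
    (((htr _).mul (hprod T)).integrable.const_mul _), integral_const_mul, hreal, hreal,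
    Finset.mul_sum, ← Finset.sum_add_distrib]
  refine Finset.sum_congr rfl fun h _ => ?_
  rw [Matrix.add_apply, Matrix.smul_apply, smul_eq_mul]
  ring

end Gaussian

/-! ### Pairings and Wick's theorem -/

/-- The pairings of a set: the fixed-point-free involutions. -/
def Pairing (H : Type*) : Type _ := {α : Equiv.Perm H // (∀ h, α (α h) = h) ∧ ∀ h, α h ≠ h}

namespace Pairing

variable {H : Type*}

instance [Finite H] : Finite (Pairing H) := inferInstanceAs (Finite (Subtype _))

instance [Finite H] : Fintype (Pairing H) := Fintype.ofFinite _

section Extend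

variable [DecidableEq H] {a b : H}

/-- The pairing of `H` consisting of the pair `{a, b}` and of a pairing of the other elements. -/
def extend (hab : b ≠ a) (β : Pairing {x // x ≠ a ∧ x ≠ b}) : Pairing H :=
  ⟨Equiv.swap a b * Equiv.Perm.ofSubtype β.1, by
    have ha : Equiv.Perm.ofSubtype β.1 a = a := Equiv.Perm.ofSubtype_apply_of_not_mem _ (by simp)
    have hb : Equiv.Perm.ofSubtype β.1 b = b := Equiv.Perm.ofSubtype_apply_of_not_mem _ (by simp)
    have hx : ∀ x : {x // x ≠ a ∧ x ≠ b},
        (Equiv.swap a b * Equiv.Perm.ofSubtype β.1) x = β.1 x := by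
      intro x
      rw [Equiv.Perm.mul_apply, Equiv.Perm.ofSubtype_apply_coe,
        Equiv.swap_apply_of_ne_of_ne (β.1 x).2.1 (β.1 x).2.2]
    constructor
    · intro h
      by_cases h1 : h = a
      · subst h1; simp [ha, hb]
      · by_cases h2 : h = b
        · subst h2; simp [ha, hb]
        · have := hx ⟨h, h1, h2⟩
          dsimp only at this
          rw [this, hx, β.2.1]
    · intro h
      by_cases h1 : h = a
      · subst h1; simpa [ha] using hab
      · by_cases h2 : h = b
        · subst h2; simpa [hb] using hab.symm
        · have := hx ⟨h, h1, h2⟩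
          dsimp only at this
          rw [this]
          exact fun e => β.2.2 _ (Subtype.ext e)⟩

variable (hab : b ≠ a) (β : Pairing {x // x ≠ a ∧ x ≠ b})

theorem extend_left : (extend hab β).1 a = b := by
  have ha : Equiv.Perm.ofSubtype β.1 a = a := Equiv.Perm.ofSubtype_apply_of_not_mem _ (by simp)
  simp [extend, ha]

theorem extend_right : (extend hab β).1 b = a := by
  have hb : Equiv.Perm.ofSubtype β.1 b = b := Equiv.Perm.ofSubtype_apply_of_not_mem _ (by simp)
  simp [extend, hb]

theorem extend_coe (x : {x // x ≠ a ∧ x ≠ b}) : (extend hab β).1 x = β.1 x := by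
  rw [extend, Equiv.Perm.mul_apply, Equiv.Perm.ofSubtype_apply_coe,
    Equiv.swap_apply_of_ne_of_ne (β.1 x).2.1 (β.1 x).2.2]

theorem exists_extend_eq (α : Pairing H) (hα : α.1 a = b) : ∃ β, extend hab β = α := by
  have hα' : α.1 b = a := by rw [← hα, α.2.1]
  have hp : ∀ x, (α.1 x ≠ a ∧ α.1 x ≠ b) ↔ (x ≠ a ∧ x ≠ b) := by
    intro x
    have h1 : α.1 x = a ↔ x = b := by rw [← hα', α.1.injective.eq_iff]
    have h2 : α.1 x = b ↔ x = a := by rw [← hα, α.1.injective.eq_iff]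
    rw [ne_eq, ne_eq, h1, h2, and_comm]
  let β : Pairing {x // x ≠ a ∧ x ≠ b} := ⟨α.1.subtypePerm hp, fun h => Subtype.ext (α.2.1 h),
    fun h e => α.2.2 h (Subtype.ext_iff.1 e)⟩
  refine ⟨β, Subtype.ext (Equiv.ext fun x => ?_)⟩
  by_cases h1 : x = a
  · rw [h1]
    exact (extend_left hab β).trans hα.symm
  · by_cases h2 : x = b
    · rw [h2]
      exact (extend_right hab β).trans hα'.symm
    · exact extend_coe hab β ⟨x, h1, h2⟩

end Extend

/-- Summing over pairings by the partner of a fixed element. -/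
theorem sum_prod_eq [Fintype H] [DecidableEq H] {R : Type*} [CommSemiring R] (g : H → H → R)
    (a : H) : ∑ α : Pairing H, ∏ h, g h (α.1 h) = ∑ b ∈ Finset.univ.erase a, g a b * g b a *
      ∑ β : Pairing {x // x ≠ a ∧ x ≠ b}, ∏ x : {x // x ≠ a ∧ x ≠ b}, g x (β.1 x) := by
  rw [← Finset.sum_fiberwise_of_maps_to (s := Finset.univ) (t := Finset.univ.erase a)
    (g := fun α : Pairing H => α.1 a)
    fun α _ => Finset.mem_erase.2 ⟨α.2.2 a, Finset.mem_univ _⟩]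
  refine Finset.sum_congr rfl fun b hb => ?_
  have hab : b ≠ a := (Finset.mem_erase.1 hb).1
  rw [Finset.mul_sum]
  symm
  refine Finset.sum_bij (fun β _ => extend hab β) (fun β _ => ?_) (fun β _ β' _ e => ?_)
    (fun α hα => ?_) fun β _ => ?_
  · exact Finset.mem_filter.2 ⟨Finset.mem_univ _, extend_left hab β⟩
  · refine Subtype.ext (Equiv.ext fun x => Subtype.ext ?_)
    rw [← extend_coe hab, e, extend_coe hab]
  · obtain ⟨β, hβ⟩ := exists_extend_eq hab α (Finset.mem_filter.1 hα).2
    exact ⟨β, Finset.mem_univ _, hβ⟩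
  · rw [← Finset.mul_prod_erase Finset.univ _ (Finset.mem_univ a),
      ← Finset.mul_prod_erase (Finset.univ.erase a) _ hb, extend_left, extend_right, ← mul_assoc]
    congr 1
    rw [Finset.prod_subtype (p := fun x => x ≠ a ∧ x ≠ b) _ (by simp [and_comm])]
    exact Finset.prod_congr rfl fun x _ => by rw [extend_coe]

end Pairing

section Wick

open MeasureTheory

variable {n : ℕ}

/-- Wick's theorem: the Gaussian mean of a product of matrix entries is the sum over the pairings
of the factors of the products of the covariances `⟨x_{ab} x_{cd}⟩ = δ_{ad} δ_{bc}`. -/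
theorem integral_prod_apply_mul_gaussianWeight {H : Type*} [Fintype H] [DecidableEq H]
    (a b : H → Fin n) :
    ∫ x : HermitianCoord n, (∏ h, hermitianMatrix x (a h) (b h)) * gaussianWeight x =
      (∑ α : Pairing H, ∏ h, if a h = b (α.1 h) then (1 : ℂ) else 0) *
        ∫ x : HermitianCoord n, gaussianWeight x := by
  induction hN : Fintype.card H using Nat.strong_induction_on generalizing H with
  | _ N ih =>
  rcases isEmpty_or_nonempty H with hH | ⟨⟨h₀⟩⟩
  · have : Unique (Pairing H) :=
      { default := ⟨1, fun h => isEmptyElim h, fun h => isEmptyElim h⟩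
        uniq := fun α => Subtype.ext (Subsingleton.elim _ _) }
    simp
  have htr : ∀ x : HermitianCoord n, hermitianMatrix x (a h₀) (b h₀) =
      (hermitianMatrix x * Matrix.single (b h₀) (a h₀) (1 : ℂ)).trace := by
    intro x
    simp [Matrix.trace, Matrix.mul_apply, Matrix.single_apply, ite_and]
  simp only [← Finset.mul_prod_erase Finset.univ (fun h => hermitianMatrix _ (a h) (b h))
    (Finset.mem_univ h₀), htr]
  rw [integral_trace_mul_prod, Pairing.sum_prod_eq (fun h k => if a h = b k then (1 : ℂ) else 0) h₀,
    Finset.sum_mul]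
  refine Finset.sum_congr rfl fun k hk => ?_
  have hkey := ih (Fintype.card {x : H // x ≠ h₀ ∧ x ≠ k})
    (hN ▸ Fintype.card_subtype_lt (x := h₀) (by simp))
    (fun x : {x : H // x ≠ h₀ ∧ x ≠ k} => a x) (fun x => b x) rfl
  have hprod : ∀ x : HermitianCoord n,
      ∏ h ∈ (Finset.univ.erase h₀).erase k, hermitianMatrix x (a h) (b h) =
      ∏ h : {x : H // x ≠ h₀ ∧ x ≠ k}, hermitianMatrix x (a h) (b h) :=
    fun x => Finset.prod_subtype _ (by simp [and_comm]) _
  simp only [hprod]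
  rw [hkey, ← mul_assoc]
  congr 2
  rw [Matrix.single_apply, ite_and, mul_comm]
  simp only [eq_comm (a := b h₀)]
  split_ifs <;> simp

theorem integrable_gaussianWeight : Integrable (gaussianWeight (n := n)) := by
  simpa using (PolyGrowth.const (n := n) 1).integrable

theorem integral_gaussianWeight_ne_zero : ∫ x : HermitianCoord n, gaussianWeight x ≠ 0 := by
  have : NeZero (volume : Measure (HermitianCoord n)) :=
    ⟨fun h => isOpen_univ.measure_ne_zero volume Set.univ_nonempty
      (by rw [h, Measure.coe_zero, Pi.zero_apply])⟩
  simp only [gaussianWeight_eq]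
  rw [integral_complex_ofReal, Complex.ofReal_ne_zero]
  exact (integral_exp_pos (integrable_exp_neg_mul_traceSq (by norm_num))).ne'

end Wick

/-! ### Traces of powers along the cycles of a permutation -/

theorem pow_succ_apply_eq_sum {ι R : Type*} [Fintype ι] [DecidableEq ι] [CommSemiring R]
    (M : Matrix ι ι R) (k : ℕ) (i j : ι) :
    (M ^ (k + 1)) i j = ∑ p : Fin k → ι,
      ∏ l : Fin (k + 1), M (Fin.cons (α := fun _ => ι) i p l)
        (Fin.snoc (α := fun _ => ι) p j l) := by
  induction k generalizing i with
  | zero => simp [Fin.snoc]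
  | succ k ih =>
    rw [pow_succ', Matrix.mul_apply, ← (Fin.consEquiv fun _ : Fin (k + 1) => ι).sum_comp,
      Fintype.sum_prod_type]
    refine Finset.sum_congr rfl fun q _ => ?_
    rw [ih, Finset.mul_sum]
    refine Finset.sum_congr rfl fun p _ => ?_
    conv_rhs => rw [Fin.prod_univ_succ]
    change _ = M (Fin.cons (α := fun _ => ι) i (Fin.cons (α := fun _ => ι) q p) 0)
        (Fin.snoc (α := fun _ => ι) (Fin.cons (α := fun _ => ι) q p) j 0) *
      ∏ l : Fin (k + 1), M (Fin.cons (α := fun _ => ι) i (Fin.cons (α := fun _ => ι) q p) l.succ)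
        (Fin.snoc (α := fun _ => ι) (Fin.cons (α := fun _ => ι) q p) j l.succ)
    rw [← Fin.cons_snoc_eq_snoc_cons]
    simp only [Fin.cons_zero, Fin.cons_succ]

theorem trace_pow_eq_sum {ι R : Type*} [Fintype ι] [DecidableEq ι] [CommSemiring R]
    (M : Matrix ι ι R) (k : ℕ) :
    (M ^ (k + 1)).trace = ∑ p : Fin (k + 1) → ι, ∏ l, M (p l) (p (finRotate (k + 1) l)) := by
  rw [Matrix.trace, ← (Fin.consEquiv fun _ : Fin (k + 1) => ι).sum_comp, Fintype.sum_prod_type]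
  refine Finset.sum_congr rfl fun i _ => ?_
  rw [Matrix.diag_apply, pow_succ_apply_eq_sum]
  refine Finset.sum_congr rfl fun p _ => Finset.prod_congr rfl fun l _ => ?_
  congr 1
  refine Fin.lastCases ?_ (fun l => ?_) l
  · simp
  · rw [Fin.snoc_castSucc, finRotate_apply, Fin.coeSucc_eq_succ]
    rfl

/-- The sum of the products of the matrix entries along a cyclic permutation is a trace. -/
theorem sum_prod_cycle_eq_trace {F ι R : Type*} [Fintype F] [DecidableEq F] [Fintype ι]
    [DecidableEq ι] [CommSemiring R] (M : Matrix ι ι R) (σ : Equiv.Perm F) [Nonempty F]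
    (hσ : ∀ x y, σ.SameCycle x y) :
    ∑ i : F → ι, ∏ x, M (i x) (i (σ x)) = (M ^ Fintype.card F).trace := by
  obtain ⟨x₀⟩ := ‹Nonempty F›
  obtain ⟨k, hk⟩ := Nat.exists_eq_succ_of_ne_zero (Fintype.card_ne_zero (α := F))
  have hcyc : σ.IsCycleOn ((Finset.univ : Finset F) : Set F) := by
    refine ⟨?_, fun x _ y _ => hσ x y⟩
    rw [Finset.coe_univ]
    exact Set.bijOn_univ.2 σ.bijective
  have hmod : ∀ a b : ℕ, (σ ^ a) x₀ = (σ ^ b) x₀ ↔ a ≡ b [MOD k + 1] := fun a b => by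
    rw [hcyc.pow_apply_eq_pow_apply (Finset.mem_univ x₀), Finset.card_univ, hk]
  let f : Fin (k + 1) → F := fun l => (σ ^ (l : ℕ)) x₀
  have hf : Function.Injective f := fun a b h => by
    have := (hmod a b).1 h
    rw [Nat.ModEq, Nat.mod_eq_of_lt a.2, Nat.mod_eq_of_lt b.2] at this
    exact Fin.ext this
  let e : Fin (k + 1) ≃ F := Equiv.ofBijective f
    ((Fintype.bijective_iff_injective_and_card f).2 ⟨hf, by rw [Fintype.card_fin, hk]⟩)
  have he : ∀ l, e (finRotate (k + 1) l) = σ (e l) := by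
    intro l
    change (σ ^ ((finRotate (k + 1) l : Fin (k + 1)) : ℕ)) x₀ = σ ((σ ^ (l : ℕ)) x₀)
    rw [← Equiv.Perm.mul_apply, ← pow_succ', hmod, finRotate_apply, Fin.val_add]
    refine (Nat.mod_modEq _ _).trans (Nat.ModEq.add_left _ ?_)
    rw [Fin.val_one']
    exact Nat.mod_modEq _ _
  rw [hk, trace_pow_eq_sum]
  refine Fintype.sum_equiv (e.symm.arrowCongr (Equiv.refl ι)) _ _ fun i => ?_
  refine (Fintype.prod_equiv e _ _ fun l => ?_).symm
  change M (i (e.symm.symm l)) (i (e.symm.symm (finRotate (k + 1) l))) = M (i (e l)) (i (σ (e l)))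
  rw [← he]
  rfl

theorem card_invariant_functions {H : Type*} [Fintype H] [DecidableEq H] (τ : Equiv.Perm H)
    (n : ℕ) : Fintype.card {i : H → Fin n // ∀ h, i h = i (τ h)} = n ^ cycleCount τ := by
  have := Fintype.ofFinite (Quotient (Equiv.Perm.SameCycle.setoid τ))
  let e : {i : H → Fin n // ∀ h, i h = i (τ h)} ≃
      (Quotient (Equiv.Perm.SameCycle.setoid τ) → Fin n) :=
    { toFun := fun i => Quotient.lift i.1 fun x y h =>
        SameCycle.apply_eq (fun x => (i.2 x).symm) h
      invFun := fun g => ⟨fun h => g (Quotient.mk _ h), fun h => congrArg g (Quotient.sound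
        (Equiv.Perm.sameCycle_apply_right.2 (Equiv.Perm.SameCycle.refl τ h)))⟩
      left_inv := fun i => rfl
      right_inv := fun g => by
        ext q
        obtain ⟨h, rfl⟩ := Quotient.mk_surjective q
        rfl }
  classical
  rw [Fintype.card_congr e, Fintype.card_fun, Fintype.card_fin, cycleCount,
    Nat.card_eq_fintype_card]

/-- Matrix entries multiplied along all the cycles of a permutation without fixed points give the
product of the traces of powers. -/
theorem sum_prod_perm_eq_prod_trace {H ι R : Type*} [Fintype H] [DecidableEq H] [Fintype ι]
    [DecidableEq ι] [CommSemiring R] (M : Matrix ι ι R) (σ : Equiv.Perm H)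
    (hfix : ∀ h, σ h ≠ h) :
    ∑ i : H → ι, ∏ h, M (i h) (i (σ h)) = (σ.cycleType.map fun j => (M ^ j).trace).prod := by
  let κ : H → {c // c ∈ σ.cycleFactorsFinset} := fun h => ⟨σ.cycleOf h,
    Equiv.Perm.cycleOf_mem_cycleFactorsFinset_iff.2 (Equiv.Perm.mem_support.2 (hfix h))⟩
  have hκ : ∀ x y, κ x = κ y ↔ σ.SameCycle x y := fun x y => by
    rw [Equiv.Perm.sameCycle_iff_cycleOf_eq_of_mem_support (Equiv.Perm.mem_support.2 (hfix x))
      (Equiv.Perm.mem_support.2 (hfix y)), Subtype.mk.injEq]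
  let τ : ∀ c, Equiv.Perm {h // κ h = c} := fun c => σ.subtypePerm fun h => by
    rw [(hκ (σ h) h).2 (Equiv.Perm.sameCycle_apply_left.2 (Equiv.Perm.SameCycle.refl _ _))]
  have hc : ∀ c, ∑ i : {h // κ h = c} → ι, ∏ x, M (i x) (i (τ c x)) =
      (M ^ c.1.support.card).trace := by
    intro c
    obtain ⟨a, ha⟩ := (Equiv.Perm.mem_cycleFactorsFinset_iff.1 c.2).1.nonempty_support
    have hac : κ a = c := Subtype.ext (Equiv.Perm.cycle_is_cycleOf ha c.2).symm
    have : Nonempty {h // κ h = c} := ⟨⟨a, hac⟩⟩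
    rw [sum_prod_cycle_eq_trace M (τ c), Fintype.card_subtype]
    · congr 3
      ext h
      rw [Finset.mem_filter_univ, ← hac, hκ, Equiv.Perm.mem_support_cycleOf_iff' (hfix a),
        Equiv.Perm.sameCycle_comm]
    · rintro ⟨x, hx⟩ ⟨y, hy⟩
      exact (Equiv.Perm.sameCycle_subtypePerm (h := _)).2 ((hκ x y).1 (hx.trans hy.symm))
  rw [Equiv.Perm.cycleType_def, Multiset.map_map]
  change _ = ∏ c ∈ σ.cycleFactorsFinset, (M ^ c.support.card).trace
  rw [← Finset.prod_coe_sort]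
  simp only [← hc]
  rw [Finset.prod_univ_sum, Fintype.piFinset_univ]
  let e : (H → ι) ≃ (∀ c, {h // κ h = c} → ι) :=
    ((Equiv.sigmaFiberEquiv κ).symm.arrowCongr (Equiv.refl ι)).trans (Equiv.piCurry fun _ _ => ι)
  refine Fintype.sum_equiv e _ _ fun i => ?_
  rw [← Fintype.prod_equiv (Equiv.sigmaFiberEquiv κ) (fun x => M (i x.2) (i (σ x.2)))
    _ fun x => rfl, Fintype.prod_sigma]
  rfl

open MeasureTheory in
/-- The Gaussian mean of a product of traces counts the pairings of the half-edges, a pairing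
being weighted by `n` to the number of boundary components of the graph that it closes. -/
theorem integral_prod_trace_mul_gaussianWeight {n : ℕ} {H : Type*} [Fintype H] [DecidableEq H]
    (σ : Equiv.Perm H) (hfix : ∀ h, σ h ≠ h) :
    ∫ x : HermitianCoord n, (σ.cycleType.map fun j => (hermitianMatrix x ^ j).trace).prod *
        gaussianWeight x =
      (∑ α : Pairing H, (n : ℂ) ^ cycleCount (σ * α.1)) *
        ∫ x : HermitianCoord n, gaussianWeight x := by
  simp only [← sum_prod_perm_eq_prod_trace _ σ hfix, Finset.sum_mul]
  rw [integral_finsetSum _ fun i _ =>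
    (PolyGrowth.prod fun h _ => polyGrowth_apply (i h) (i (σ h))).integrable]
  simp only [integral_prod_apply_mul_gaussianWeight]
  rw [← Finset.sum_mul, ← Finset.sum_mul, Finset.sum_comm]
  congr 1
  refine Finset.sum_congr rfl fun α _ => ?_
  rw [← Nat.cast_pow, ← card_invariant_functions, Fintype.card_subtype, Finset.card_filter,
    Nat.cast_sum]
  refine Finset.sum_congr rfl fun i _ => ?_
  rw [Finset.prod_ite_zero]
  by_cases H : ∀ h, i h = i ((σ * α.1) h)
  · rw [if_pos H, Nat.cast_one]
    exact (if_pos fun h _ => H h).trans Finset.prod_const_one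
  · rw [if_neg fun h => H fun x => h x (Finset.mem_univ x), if_neg H, Nat.cast_zero]

/-! ### The coefficients as Gaussian moments -/

/-- The cycle type prescribed by an exponent vector: `d_j` cycles of length `j`. -/
def exponentCycleType {S : Set ℕ} (d : S →₀ ℕ) : Multiset ℕ :=
  (Finsupp.toMultiset d).map Subtype.val

section ExponentCycleType

variable {S : Set ℕ} (d : S →₀ ℕ)

theorem count_exponentCycleType (j : S) : (exponentCycleType d).count j.1 = d j := by
  classical
  rw [exponentCycleType, Multiset.count_map_eq_count' _ _ Subtype.val_injective,
    Finsupp.count_toMultiset]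

theorem mem_of_mem_exponentCycleType {j : ℕ} (hj : j ∈ exponentCycleType d) : j ∈ S := by
  obtain ⟨i, -, rfl⟩ := Multiset.mem_map.1 hj
  exact i.2

theorem sum_exponentCycleType : (exponentCycleType d).sum = halfEdges d := by
  classical
  rw [exponentCycleType, Finset.sum_multiset_map_count, Finsupp.toFinset_toMultiset]
  exact Finset.sum_congr rfl fun j _ => by
    rw [Finsupp.count_toMultiset, smul_eq_mul, mul_comm]

theorem prod_map_exponentCycleType {R : Type*} [CommMonoid R] (f : ℕ → R) :
    ((exponentCycleType d).map f).prod = d.prod fun j k => f j.1 ^ k := by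
  classical
  rw [exponentCycleType, Multiset.map_map, Finset.prod_multiset_map_count,
    Finsupp.toFinset_toMultiset]
  exact Finset.prod_congr rfl fun j _ => by rw [Finsupp.count_toMultiset]; rfl

theorem prod_exponentCycleType :
    (exponentCycleType d).prod * ∏ j ∈ (exponentCycleType d).toFinset,
      ((exponentCycleType d).count j).factorial = d.prod fun j k => j.1 ^ k * k.factorial := by
  classical
  have hfin : (exponentCycleType d).toFinset = d.support.image Subtype.val := by
    rw [exponentCycleType, Multiset.toFinset_map, Finsupp.toFinset_toMultiset]
  have hprod : (exponentCycleType d).prod = ∏ j ∈ d.support, j.1 ^ d j := by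
    rw [Finset.prod_multiset_count, hfin, Finset.prod_image fun _ _ _ _ h => Subtype.ext h]
    exact Finset.prod_congr rfl fun j _ => by rw [count_exponentCycleType]
  rw [hprod, hfin, Finset.prod_image fun _ _ _ _ h => Subtype.ext h, Finsupp.prod,
    ← Finset.prod_mul_distrib]
  exact Finset.prod_congr rfl fun j _ => by rw [count_exponentCycleType]

end ExponentCycleType

/-- On `halfEdges d` half-edges, a graph has exponent vector `d` exactly when the permutation
`next` has the corresponding cycle type. -/
theorem exponent_eq_iff_cycleType {S : Set ℕ} (hS : S ⊆ Set.Ici 2) {d : S →₀ ℕ} (Γ : RibbonGraph)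
    [Fintype Γ.H] [DecidableEq Γ.H] (hcard : Fintype.card Γ.H = halfEdges d) :
    ((∀ v, Γ.degree v ∈ S) ∧ Γ.exponent S = d) ↔ Γ.next.cycleType = exponentCycleType d := by
  constructor
  · rintro ⟨hdeg, rfl⟩
    ext j
    by_cases hj : j ∈ S
    · rw [← vertexCount_eq_count_cycleType Γ (hS hj), count_exponentCycleType _ ⟨j, hj⟩,
        exponent_apply]
    · rw [Multiset.count_eq_zero_of_notMem fun h => hj (mem_of_mem_exponentCycleType _ h)]
      by_cases h2 : 2 ≤ j
      · rw [← vertexCount_eq_count_cycleType Γ h2]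
        have : IsEmpty {v : Γ.Vertex // Γ.degree v = j} := ⟨fun v => hj (v.2 ▸ hdeg v.1)⟩
        exact Nat.card_of_isEmpty
      · exact Multiset.count_eq_zero_of_notMem fun h =>
          h2 (Equiv.Perm.two_le_of_mem_cycleType h)
  · intro h
    have hsupp : Γ.next.support = Finset.univ := by
      rw [← Finset.card_eq_iff_eq_univ, ← Equiv.Perm.sum_cycleType, h, sum_exponentCycleType, hcard]
    refine ⟨fun v => ?_, ?_⟩
    · obtain ⟨x, rfl⟩ := Γ.vertexOf_surjective v
      have hx : x ∈ Γ.next.support := hsupp ▸ Finset.mem_univ x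
      rw [degree_vertexOf Γ (Equiv.Perm.mem_support.1 hx)]
      refine mem_of_mem_exponentCycleType d (h ▸ ?_)
      rw [Equiv.Perm.cycleType_def]
      exact Multiset.mem_map_of_mem _
        (Finset.mem_def.1 (Equiv.Perm.cycleOf_mem_cycleFactorsFinset_iff.2 hx))
    · ext j
      rw [exponent_apply, vertexCount_eq_count_cycleType Γ (hS j.2), h, count_exponentCycleType]

/-- A ribbon graph structure is a permutation together with a pairing. -/
def ribbonStrEquiv (H : Type) : RibbonStr H ≃ Equiv.Perm H × Pairing H where
  toFun r := (r.1.1, ⟨r.1.2, r.2⟩)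
  invFun p := ⟨(p.1, p.2.1), p.2.2⟩
  left_inv _ := rfl
  right_inv _ := rfl

/-- The product `∏_j (tr X^j / j)^{d_j} / d_j!`. -/
def traceMonomial {S : Set ℕ} (d : S →₀ ℕ) {n : ℕ} (x : HermitianCoord n) : ℂ :=
  d.prod fun j k => ((hermitianMatrix x ^ j.1).trace / (j.1 : ℂ)) ^ k / (k.factorial : ℂ)

open MeasureTheory in
/-- The coefficients of the generating series of ribbon graphs are Gaussian moments. -/
theorem eval_coeff_graphSeries {S : Set ℕ} (hS : S ⊆ Set.Ici 2) (d : S →₀ ℕ) (n : ℕ) :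
    eval₂RingHom (algebraMap ℚ ℂ) (n : ℂ) (MvPowerSeries.coeff d (graphSeries S)) *
      ∫ x : HermitianCoord n, gaussianWeight x =
    ∫ x : HermitianCoord n, traceMonomial d x * gaussianWeight x := by
  classical
  set φ := eval₂RingHom (algebraMap ℚ ℂ) (n : ℂ)
  set N := halfEdges d with hN
  set m := exponentCycleType d with hm
  set I := ∫ x : HermitianCoord n, gaussianWeight x
  set P : HermitianCoord n → ℂ := fun x => d.prod fun j k => (hermitianMatrix x ^ j.1).trace ^ k
  have hφX : φ X = (n : ℂ) := eval₂_X _ _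
  have hφC : ∀ q : ℚ, φ (C q) = (q : ℂ) := fun q => by
    change eval₂ _ _ (C q) = _
    rw [eval₂_C, eq_ratCast]
  have hcard : ∀ r : RibbonStr (Fin N), Fintype.card (Fin N) = halfEdges d := fun _ => by
    rw [Fintype.card_fin]
  -- the weight of a labelled graph
  have hw : ∀ r : RibbonStr (Fin N), φ (MvPowerSeries.coeff d (weight S r.graph)) =
      if r.1.1.cycleType = m then (n : ℂ) ^ cycleCount (r.1.1 * r.1.2) else 0 := by
    intro r
    have hiff := @exponent_eq_iff_cycleType S hS d r.graph (inferInstanceAs (Fintype (Fin N)))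
      (inferInstanceAs (DecidableEq (Fin N))) (hcard r)
    change _ ↔ r.1.1.cycleType = m at hiff
    by_cases hdeg : ∀ v, r.graph.degree v ∈ S
    · rw [weight, if_pos hdeg, MvPowerSeries.coeff_monomial]
      by_cases he : r.graph.exponent S = d
      · rw [if_pos he.symm, if_pos (hiff.1 ⟨hdeg, he⟩), map_pow, hφX]
        rfl
      · rw [if_neg fun h => he h.symm, if_neg fun h => he (hiff.2 h).2, map_zero]
    · rw [weight, if_neg hdeg, if_neg fun h => hdeg (hiff.2 h).1, map_zero, map_zero]
  -- Wick's theorem for a fixed permutation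
  have hσ : ∀ σ : Equiv.Perm (Fin N), σ.cycleType = m →
      (∑ α : Pairing (Fin N), (n : ℂ) ^ cycleCount (σ * α.1)) * I =
        ∫ x : HermitianCoord n, P x * gaussianWeight x := by
    intro σ hσ
    have hsupp : σ.support = Finset.univ := by
      rw [← Finset.card_eq_iff_eq_univ, ← Equiv.Perm.sum_cycleType, hσ, hm,
        sum_exponentCycleType, Fintype.card_fin]
    rw [← integral_prod_trace_mul_gaussianWeight σ fun h =>
      Equiv.Perm.mem_support.1 (hsupp ▸ Finset.mem_univ h), hσ]
    simp only [hm, prod_map_exponentCycleType, P]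
  have hD : ((d.prod fun j k => j.1 ^ k * k.factorial : ℕ) : ℂ) ≠ 0 := by
    rw [Nat.cast_ne_zero]
    refine Finset.prod_ne_zero_iff.2 fun j _ => mul_ne_zero (pow_ne_zero _ ?_)
      (Nat.factorial_ne_zero _)
    have := hS j.2
    rw [Set.mem_Ici] at this
    omega
  have hcount : ((Finset.univ.filter fun σ : Equiv.Perm (Fin N) => σ.cycleType = m).card : ℂ) *
      (d.prod fun j k => j.1 ^ k * k.factorial : ℕ) = N.factorial := by
    have h := Equiv.Perm.card_of_cycleType_mul_eq (Fin N) m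
    rw [if_pos, hm, sum_exponentCycleType, Fintype.card_fin, Nat.sub_self, Nat.factorial_zero,
      one_mul, prod_exponentCycleType] at h
    · rw [← h]
      push_cast
      rfl
    · exact ⟨by rw [hm, sum_exponentCycleType, Fintype.card_fin],
        fun a ha => hS (mem_of_mem_exponentCycleType d ha)⟩
  have hmono : ∀ x : HermitianCoord n, traceMonomial d x * gaussianWeight x =
      ((d.prod fun j k => j.1 ^ k * k.factorial : ℕ) : ℂ)⁻¹ * (P x * gaussianWeight x) := by
    intro x
    rw [← mul_assoc]
    congr 1
    simp only [traceMonomial, P, Finsupp.prod, Nat.cast_prod]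
    rw [← Finset.prod_inv_distrib, ← Finset.prod_mul_distrib]
    refine Finset.prod_congr rfl fun j _ => ?_
    rw [div_pow, div_div, div_eq_inv_mul]
    push_cast
    rfl
  rw [graphSeries, coeff_labelledSeries, map_mul, hφC, RibbonStr.totalWeight, map_sum, map_sum,
    ← hN]
  simp only [hw, hmono]
  rw [integral_const_mul, ← (ribbonStrEquiv (Fin N)).symm.sum_comp, Fintype.sum_prod_type]
  change _ * (∑ σ : Equiv.Perm (Fin N), ∑ α : Pairing (Fin N),
    if σ.cycleType = m then (n : ℂ) ^ cycleCount (σ * α.1) else 0) * I = _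
  have hsum : (∑ σ : Equiv.Perm (Fin N), ∑ α : Pairing (Fin N),
      if σ.cycleType = m then (n : ℂ) ^ cycleCount (σ * α.1) else 0) * I =
      (Finset.univ.filter fun σ : Equiv.Perm (Fin N) => σ.cycleType = m).card *
        ∫ x : HermitianCoord n, P x * gaussianWeight x := by
    rw [Finset.sum_mul, ← nsmul_eq_mul, ← Finset.sum_const, Finset.sum_filter]
    refine Finset.sum_congr rfl fun σ _ => ?_
    split_ifs with h
    · exact hσ σ h
    · rw [Finset.sum_const_zero, zero_mul]
  have hN0 : (N.factorial : ℂ) ≠ 0 := Nat.cast_ne_zero.2 (Nat.factorial_ne_zero _)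
  rw [mul_assoc, hsum, ← mul_assoc]
  congr 1
  rw [Rat.cast_div, Rat.cast_one, Rat.cast_natCast, ← hcount]
  rw [← hcount] at hN0
  have hc0 := left_ne_zero_of_mul hN0
  field_simp

/-! ### Exponential series in several variables -/

theorem hasSum_mul_of_summable_norm {ι κ : Type*} (f : ι → ℂ) (g : κ → ℂ)
    (hf : Summable fun k => ‖f k‖) (hg : Summable fun k => ‖g k‖) {b : ℂ} (hb : HasSum g b) :
    (Summable fun p : ι × κ => ‖f p.1 * g p.2‖) ∧
      HasSum (fun p : ι × κ => f p.1 * g p.2) ((∑' i, f i) * b) :=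
  ⟨hf.mul_norm hg, hf.of_norm.hasSum.mul hb (summable_mul_of_summable_norm hf hg)⟩

theorem hasSum_prod_fin_of_summable_norm {n : ℕ} (f : Fin n → ℕ → ℂ)
    (hf : ∀ i, Summable fun k => ‖f i k‖) : (Summable fun d : Fin n → ℕ => ‖∏ i, f i (d i)‖) ∧
      HasSum (fun d : Fin n → ℕ => ∏ i, f i (d i)) (∏ i, ∑' k, f i k) := by
  induction n with
  | zero =>
    simp only [Finset.univ_eq_empty, Finset.prod_empty]
    exact ⟨(hasSum_fintype _).summable, by simp⟩
  | succ n ih =>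
    obtain ⟨h1, h2⟩ := ih (fun i => f i.succ) fun i => hf _
    let E : ℕ × (Fin n → ℕ) ≃ (Fin (n + 1) → ℕ) := Fin.consEquiv fun _ => ℕ
    have hE : ∀ p, ∏ i, f i (E p i) = f 0 p.1 * ∏ i : Fin n, f i.succ (p.2 i) := fun p => by
      rw [Fin.prod_univ_succ]
      rfl
    rw [← E.summable_iff, ← E.hasSum_iff, Fin.prod_univ_succ]
    simp only [Function.comp_def, hE]
    exact hasSum_mul_of_summable_norm (f 0) (fun d : Fin n → ℕ => ∏ i : Fin n, f i.succ (d i))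
      (hf 0) h1 h2

/-- A finite product of absolutely convergent series. -/
theorem hasSum_prod_of_summable_norm {ι : Type*} [Fintype ι] (f : ι → ℕ → ℂ)
    (hf : ∀ i, Summable fun k => ‖f i k‖) :
    HasSum (fun d : ι → ℕ => ∏ i, f i (d i)) (∏ i, ∑' k, f i k) := by
  let e := Fintype.equivFin ι
  have h := (hasSum_prod_fin_of_summable_norm (fun a => f (e.symm a)) fun a => hf _).2
  let E : (ι → ℕ) ≃ (Fin (Fintype.card ι) → ℕ) := e.arrowCongr (Equiv.refl ℕ)
  have hE : ∀ d : ι → ℕ, ∏ a, f (e.symm a) (E d a) = ∏ i, f i (d i) := fun d =>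
    Fintype.prod_equiv e.symm _ _ fun a => rfl
  rw [← E.hasSum_iff, Fintype.prod_equiv e.symm _ (fun i => ∑' k, f i k) fun a => rfl] at h
  simpa only [Function.comp_def, hE] using h

theorem hasSum_prod_pow_div_factorial {σ : Type*} [Fintype σ] (u : σ → ℂ) :
    HasSum (fun d : σ →₀ ℕ => ∏ j, u j ^ d j / (d j).factorial) (Complex.exp (∑ j, u j)) := by
  have h := (hasSum_prod_of_summable_norm (fun j k => u j ^ k / (k.factorial : ℂ))
    fun j => by simpa using Real.summable_pow_div_factorial ‖u j‖)
  have he : ∀ z : ℂ, ∑' k : ℕ, z ^ k / (k.factorial : ℂ) = Complex.exp z := fun z => by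
    rw [Complex.exp_eq_exp_ℂ, NormedSpace.exp_eq_tsum_div]
  simp only [he, ← Complex.exp_sum] at h
  exact (Finsupp.equivFunOnFinite.hasSum_iff (α := ℂ)
    (f := fun d : σ → ℕ => ∏ j, u j ^ d j / ((d j).factorial : ℂ))).2 h

/-- The exponential series in all the variables except one. -/
theorem hasSum_prod_pow_div_factorial_of_ne {σ : Type*} [Fintype σ] [DecidableEq σ] (top : σ)
    (u : σ → ℂ) :
    HasSum (fun d : {d : σ →₀ ℕ // d top = 0} => ∏ j, u j ^ d.1 j / (d.1 j).factorial)
      (Complex.exp (∑ j ∈ Finset.univ.erase top, u j)) := by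
  have h := hasSum_prod_pow_div_factorial (Function.update u top 0)
  have hs : ∑ j, Function.update u top 0 j = ∑ j ∈ Finset.univ.erase top, u j := by
    rw [← Finset.add_sum_erase _ _ (Finset.mem_univ top), Function.update_self, zero_add]
    exact Finset.sum_congr rfl fun j hj => Function.update_of_ne (Finset.ne_of_mem_erase hj) _ _
  rw [hs, ← hasSum_subtype_iff_of_support_subset (s := {d : σ →₀ ℕ | d top = 0})] at h
  · have h' : HasSum (fun d : {d : σ →₀ ℕ // d top = 0} => ∏ j, Function.update u top 0 j ^ d.1 j /
        ((d.1 j).factorial : ℂ)) (Complex.exp (∑ j ∈ Finset.univ.erase top, u j)) := h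
    convert h' using 2 with d
    refine Finset.prod_congr rfl fun j _ => ?_
    by_cases hj : j = top
    · subst hj
      rw [show (d : σ →₀ ℕ) j = 0 from d.2, pow_zero, pow_zero]
    · rw [Function.update_of_ne hj]
  · intro d hd
    by_contra hne
    refine hd (Finset.prod_eq_zero (Finset.mem_univ top) ?_)
    rw [Function.update_self, zero_pow hne, zero_div]

theorem hasSum_prod_pow_div_factorial_of_ne_real {σ : Type*} [Fintype σ] [DecidableEq σ] (top : σ)
    (u : σ → ℝ) :
    HasSum (fun d : {d : σ →₀ ℕ // d top = 0} => ∏ j, u j ^ d.1 j / (d.1 j).factorial)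
      (Real.exp (∑ j ∈ Finset.univ.erase top, u j)) := by
  have h := hasSum_prod_pow_div_factorial_of_ne top fun j => (u j : ℂ)
  rw [← Complex.hasSum_ofReal]
  push_cast
  exact h

/-! ### The remainder of the exponential series in a half plane -/

theorem norm_exp_sub_sum_le {w : ℂ} (hw : w.re ≤ 0) (k : ℕ) :
    ‖Complex.exp w - ∑ v ∈ Finset.range k, w ^ v / v.factorial‖ ≤ (k + 3) * ‖w‖ ^ k := by
  rcases le_total ‖w‖ 1 with h | h
  · refine (Complex.norm_exp_sub_sum_le_norm_mul_exp w k).trans ?_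
    rw [mul_comm]
    gcongr
    have h1 : Real.exp ‖w‖ ≤ Real.exp 1 := Real.exp_le_exp.2 h
    have := Real.exp_one_lt_d9
    have hk : (0 : ℝ) ≤ k := k.cast_nonneg
    linarith
  · have h1 : ‖Complex.exp w‖ ≤ ‖w‖ ^ k := by
      rw [Complex.norm_exp]
      exact (Real.exp_le_one_iff.2 hw).trans (one_le_pow₀ h)
    have h2 : ‖∑ v ∈ Finset.range k, w ^ v / v.factorial‖ ≤ k * ‖w‖ ^ k := by
      refine (norm_sum_le_of_le (Finset.range k) (f := fun v => w ^ v / (v.factorial : ℂ))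
        (n := fun _ => ‖w‖ ^ k) fun v hv => ?_).trans (by simp)
      rw [norm_div, norm_pow, Complex.norm_natCast]
      refine (div_le_self (by positivity) (Nat.one_le_cast.2 v.factorial_pos)).trans ?_
      exact pow_le_pow_right₀ h (Finset.mem_range.1 hv).le
    refine (norm_sub_le _ _).trans ?_
    nlinarith [pow_nonneg (norm_nonneg w) k]

/-! ### Exponential integrals and their asymptotic expansions -/

section ExponentialIntegral

open MeasureTheory Filter Topology

variable {X : Type*} [MeasurableSpace X] {μ : Measure X}

theorem norm_exp_mul_ofReal_le_one {z : ℂ} (hz : z.re ≤ 0) {q : ℝ} (hq : 0 ≤ q) :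
    ‖Complex.exp (z * q)‖ ≤ 1 := by
  rw [Complex.norm_exp, Complex.re_mul_ofReal, Real.exp_le_one_iff]
  exact mul_nonpos_of_nonpos_of_nonneg hz hq

theorem integrable_mul_exp {g : X → ℂ} {q : X → ℝ} (hg : Integrable g μ) (hqm : AEMeasurable q μ)
    (hq : ∀ x, 0 ≤ q x) {z : ℂ} (hz : z.re ≤ 0) :
    Integrable (fun x => g x * Complex.exp (z * q x)) μ :=
  hg.mul_bdd (c := 1) (Complex.measurable_exp.comp_aemeasurable
    ((Complex.measurable_ofReal.comp_aemeasurable hqm).const_mul z)).aestronglyMeasurable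
    (Eventually.of_forall fun x => norm_exp_mul_ofReal_le_one hz (hq x))

/-- A Laplace transform is holomorphic in the half plane `Re z < 0`. -/
theorem differentiableAt_integral_mul_exp {g : X → ℂ} {q : X → ℝ} (hg : Integrable g μ)
    (hqm : AEMeasurable q μ) (hq : ∀ x, 0 ≤ q x) {z : ℂ} (hz : z.re < 0) :
    DifferentiableAt ℂ (fun z => ∫ x, g x * Complex.exp (z * q x) ∂μ) z := by
  have hexp : ∀ z : ℂ, AEStronglyMeasurable (fun x => Complex.exp (z * q x)) μ := fun z =>
    (Complex.measurable_exp.comp_aemeasurable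
      ((Complex.measurable_ofReal.comp_aemeasurable hqm).const_mul z)).aestronglyMeasurable
  have hqc : AEStronglyMeasurable (fun x => (q x : ℂ)) μ :=
    (Complex.measurable_ofReal.comp_aemeasurable hqm).aestronglyMeasurable
  have hs : {ζ : ℂ | ζ.re < z.re / 2} ∈ 𝓝 z :=
    (isOpen_lt Complex.continuous_re continuous_const).mem_nhds
      (show z.re < z.re / 2 by linarith)
  refine (hasDerivAt_integral_of_dominated_loc_of_deriv_le (𝕜 := ℂ)
    (F' := fun z x => g x * (Complex.exp (z * q x) * q x))
    (bound := fun x => ‖g x‖ * (-z.re / 2)⁻¹) hs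
    (Eventually.of_forall fun ζ => hg.aestronglyMeasurable.mul (hexp ζ))
    (integrable_mul_exp hg hqm hq hz.le) (hg.aestronglyMeasurable.mul ((hexp z).mul hqc)) ?_
    (hg.norm.mul_const _) ?_).2.differentiableAt
  · refine Eventually.of_forall fun x ζ hζ => ?_
    rw [norm_mul, norm_mul]
    gcongr
    rw [Complex.norm_exp, Complex.re_mul_ofReal, Complex.norm_real, Real.norm_of_nonneg (hq x)]
    have hδ : 0 < -z.re / 2 := by linarith
    have h1 : Real.exp (ζ.re * q x) ≤ Real.exp (-(-z.re / 2 * q x)) := by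
      refine Real.exp_le_exp.2 ?_
      have := mul_le_mul_of_nonneg_right (le_of_lt hζ) (hq x)
      linarith
    have h2 : -z.re / 2 * q x ≤ Real.exp (-z.re / 2 * q x) := by
      linarith [Real.add_one_le_exp (-z.re / 2 * q x)]
    rw [Real.exp_neg] at h1
    refine (mul_le_mul_of_nonneg_right h1 (hq x)).trans ?_
    rw [inv_mul_le_iff₀ (Real.exp_pos _), ← div_eq_mul_inv, le_div_iff₀ hδ, mul_comm]
    exact h2
  · refine Eventually.of_forall fun x ζ _ => ?_
    have h : HasDerivAt (fun ζ : ℂ => ζ * (q x : ℂ)) (q x : ℂ) ζ := hasDerivAt_mul_const _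
    exact h.cexp.const_mul (g x)

/-- The moments give the asymptotic expansion of a Laplace transform at the origin. -/
theorem isAsymptoticExpansion_integral_mul_exp {Ω : Set ℂ} (hΩ : Ω ⊆ {z | z.re < 0}) {g : X → ℂ}
    {q : X → ℝ} (hg : ∀ k : ℕ, Integrable (fun x => g x * (q x : ℂ) ^ k) μ)
    (hqm : AEMeasurable q μ) (hq : ∀ x, 0 ≤ q x) :
    IsAsymptoticExpansion Ω (fun z => ∫ x, g x * Complex.exp (z * q x) ∂μ)
      fun k => ∫ x, g x * ((q x : ℂ) ^ k / k.factorial) ∂μ := by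
  have hg0 : Integrable g μ := by simpa using hg 0
  refine ⟨fun z hz =>
    (differentiableAt_integral_mul_exp hg0 hqm hq (hΩ hz)).differentiableWithinAt, fun m => ?_⟩
  set a : ℕ → ℂ := fun k => ∫ x, g x * ((q x : ℂ) ^ k / k.factorial) ∂μ with ha
  set K : ℝ := ((m + 2 : ℕ) + 3) * ∫ x, ‖g x * (q x : ℂ) ^ (m + 2)‖ ∂μ with hK
  have hint : ∀ k : ℕ, Integrable (fun x => g x * ((q x : ℂ) ^ k / k.factorial)) μ := fun k => by
    simpa only [mul_div_assoc] using (hg k).div_const (k.factorial : ℂ)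
  have key : ∀ z ∈ Ω, ‖(∫ x, g x * Complex.exp (z * q x) ∂μ) -
      ∑ v ∈ Finset.range (m + 2), a v * z ^ v‖ ≤ K * ‖z‖ ^ (m + 2) := by
    intro z hz
    have hsum : (∫ x, g x * Complex.exp (z * q x) ∂μ) - ∑ v ∈ Finset.range (m + 2), a v * z ^ v =
        ∫ x, g x * (Complex.exp (z * q x) -
          ∑ v ∈ Finset.range (m + 2), (z * q x) ^ v / v.factorial) ∂μ := by
      simp only [ha, ← integral_mul_const]
      rw [← integral_finsetSum _ fun v _ => (hint v).mul_const _,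
        ← integral_sub (integrable_mul_exp hg0 hqm hq (le_of_lt (hΩ hz)))
          (integrable_finsetSum _ fun v _ => (hint v).mul_const _)]
      refine integral_congr_ae (Eventually.of_forall fun x => ?_)
      dsimp only
      rw [mul_sub, Finset.mul_sum]
      congr 1
      refine Finset.sum_congr rfl fun v _ => ?_
      rw [mul_pow]
      ring
    rw [hsum, hK, ← integral_const_mul, ← integral_mul_const]
    refine norm_integral_le_of_norm_le (((hg (m + 2)).norm.const_mul _).mul_const _)
      (Eventually.of_forall fun x => ?_)
    have hre : (z * q x).re ≤ 0 := by
      rw [Complex.re_mul_ofReal]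
      exact mul_nonpos_of_nonpos_of_nonneg (le_of_lt (hΩ hz)) (hq x)
    rw [norm_mul]
    refine (mul_le_mul_of_nonneg_left (norm_exp_sub_sum_le hre (m + 2)) (norm_nonneg _)).trans
      (le_of_eq ?_)
    rw [norm_mul, norm_mul, norm_pow, mul_pow]
    ring
  have hlim : Tendsto (fun z : ℂ => K * ‖z‖) (𝓝[Ω] 0) (𝓝 0) := by
    have : Tendsto (fun z : ℂ => K * ‖z‖) (𝓝 0) (𝓝 (K * ‖(0 : ℂ)‖)) :=
      (continuous_const.mul continuous_norm).tendsto _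
    rw [norm_zero, mul_zero] at this
    exact this.mono_left nhdsWithin_le_nhds
  rw [tendsto_iff_norm_sub_tendsto_zero]
  refine squeeze_zero' (Eventually.of_forall fun _ => norm_nonneg _) ?_ hlim
  filter_upwards [self_mem_nhdsWithin] with z hz
  have hz0 : z ≠ 0 := fun h => by
    have := hΩ hz
    simp [h] at this
  have h := key z hz
  rw [Finset.sum_range_succ, ← sub_sub] at h
  have hzp : 0 < ‖z ^ (m + 1)‖ := norm_pos_iff.2 (pow_ne_zero _ hz0)
  rw [← mul_div_cancel_right₀ (a (m + 1)) (pow_ne_zero (m + 1) hz0), ← sub_div, norm_div,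
    div_le_iff₀ hzp, norm_pow]
  refine h.trans (le_of_eq ?_)
  ring

variable {σ : Type*} [Fintype σ] [DecidableEq σ] {top : σ} {w : X → ℂ} {y : σ → X → ℂ} {q : X → ℝ}

omit [MeasurableSpace X] in
theorem norm_exp_sum_le (hq : ∀ x, 0 ≤ q x) (hy : ∀ x, y top x = q x) {t : σ → ℂ} {R δ : ℝ}
    (hR : ∀ j, ‖t j‖ ≤ R) (hδ : (t top).re ≤ -δ) (x : X) :
    ‖Complex.exp (∑ j, t j * y j x)‖ ≤
      Real.exp (R * ∑ j ∈ Finset.univ.erase top, ‖y j x‖ - δ * q x) := by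
  rw [Complex.norm_exp, Real.exp_le_exp, ← Finset.add_sum_erase _ _ (Finset.mem_univ top),
    Complex.add_re, hy, Complex.re_mul_ofReal, Finset.mul_sum]
  have h1 : (∑ j ∈ Finset.univ.erase top, t j * y j x).re ≤
      ∑ j ∈ Finset.univ.erase top, R * ‖y j x‖ := by
    rw [Complex.re_sum]
    refine Finset.sum_le_sum fun j _ => (Complex.re_le_norm _).trans ?_
    rw [norm_mul]
    exact mul_le_mul_of_nonneg_right (hR j) (norm_nonneg _)
  have h2 := mul_le_mul_of_nonneg_right hδ (hq x)
  linarith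

omit [DecidableEq σ] in
theorem aestronglyMeasurable_exp_sum (hym : ∀ j, AEStronglyMeasurable (y j) μ) (t : σ → ℂ) :
    AEStronglyMeasurable (fun x => Complex.exp (∑ j, t j * y j x)) μ :=
  Complex.continuous_exp.comp_aestronglyMeasurable
    (Finset.aestronglyMeasurable_fun_sum _ fun j _ => (hym j).const_mul (t j))

/-- The linear form `t ↦ ∑_j t_j a_j`. -/
def dotForm (a : σ → ℂ) : (σ → ℂ) →L[ℂ] ℂ := ∑ j, a j • ContinuousLinearMap.proj j

omit [DecidableEq σ] in
theorem dotForm_apply (a t : σ → ℂ) : dotForm a t = ∑ j, t j * a j := by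
  simp only [dotForm, FunLike.coe_sum, Finset.sum_apply, FunLike.coe_smul, Pi.smul_apply,
    ContinuousLinearMap.proj_apply, smul_eq_mul]
  exact Finset.sum_congr rfl fun j _ => mul_comm _ _

omit [DecidableEq σ] in
theorem norm_dotForm_le (a : σ → ℂ) : ‖dotForm a‖ ≤ ∑ j, ‖a j‖ := by
  refine norm_sum_le_of_le _ fun j _ => ?_
  rw [norm_smul]
  refine mul_le_of_le_one_right (norm_nonneg _) ?_
  refine ContinuousLinearMap.opNorm_le_bound _ zero_le_one fun t => ?_
  rw [one_mul]
  exact norm_le_pi_norm t j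

omit [DecidableEq σ] in
theorem hasFDerivAt_mul_exp_sum (c : ℂ) (a s : σ → ℂ) :
    HasFDerivAt (fun s : σ → ℂ => c * Complex.exp (∑ j, s j * a j))
      ((c * Complex.exp (∑ j, s j * a j)) • dotForm a) s := by
  simp only [← dotForm_apply, mul_smul]
  exact ((dotForm a).hasFDerivAt (x := s)).cexp.const_mul c

omit [MeasurableSpace X] in
/-- Domination of the derivative in `t` of the exponential: the linear factor is absorbed by
`u ≤ δ⁻¹ * exp (δ * u)`, which costs half of the decay in `q`. -/
theorem norm_exp_sum_mul_dotForm_le (hq : ∀ x, 0 ≤ q x) (hy : ∀ x, y top x = q x) {t : σ → ℂ}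
    {R δ : ℝ} (hδ0 : 0 < δ) (hR : ∀ j, ‖t j‖ ≤ R) (hδ : (t top).re ≤ -(2 * δ)) (x : X) :
    ‖Complex.exp (∑ j, t j * y j x)‖ * ‖dotForm fun j => y j x‖ ≤
      δ⁻¹ * Real.exp ((R + δ) * ∑ j ∈ Finset.univ.erase top, ‖y j x‖ - δ * q x) := by
  have h1 := norm_exp_sum_le (y := y) hq hy hR hδ x
  set Y := ∑ j ∈ Finset.univ.erase top, ‖y j x‖
  have h2 : ‖dotForm fun j => y j x‖ ≤ Y + q x := by
    refine (norm_dotForm_le _).trans (le_of_eq ?_)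
    rw [← Finset.add_sum_erase _ _ (Finset.mem_univ top), hy, Complex.norm_real,
      Real.norm_of_nonneg (hq x), add_comm]
  have h3 : Y + q x ≤ δ⁻¹ * Real.exp (δ * Y + δ * q x) := by
    rw [← div_eq_inv_mul, le_div_iff₀ hδ0]
    have := Real.add_one_le_exp (δ * Y + δ * q x)
    linarith
  calc _ ≤ Real.exp (R * Y - 2 * δ * q x) * (δ⁻¹ * Real.exp (δ * Y + δ * q x)) :=
        mul_le_mul h1 (h2.trans h3) (norm_nonneg _) (Real.exp_pos _).le
    _ = δ⁻¹ * Real.exp ((R + δ) * Y - δ * q x) := by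
        rw [mul_left_comm, ← Real.exp_add]
        congr 2
        ring

theorem integrable_mul_exp_sum (hq : ∀ x, 0 ≤ q x) (hy : ∀ x, y top x = q x)
    (hw : AEStronglyMeasurable w μ) (hym : ∀ j, AEStronglyMeasurable (y j) μ)
    (hexp : ∀ R δ : ℝ, 0 < δ → Integrable (fun x =>
      ‖w x‖ * Real.exp (R * ∑ j ∈ Finset.univ.erase top, ‖y j x‖ - δ * q x)) μ)
    {t : σ → ℂ} (ht : (t top).re < 0) :
    Integrable (fun x => w x * Complex.exp (∑ j, t j * y j x)) μ := by
  refine (hexp ‖t‖ (-(t top).re) (by linarith)).mono'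
    (hw.mul (aestronglyMeasurable_exp_sum hym t)) (Eventually.of_forall fun x => ?_)
  rw [norm_mul]
  exact mul_le_mul_of_nonneg_left
    (norm_exp_sum_le hq hy (norm_le_pi_norm t) (by linarith) x) (norm_nonneg _)

/-- An exponential integral is holomorphic in its parameters. -/
theorem differentiableAt_integral_exp_sum (hq : ∀ x, 0 ≤ q x) (hy : ∀ x, y top x = q x)
    (hw : AEStronglyMeasurable w μ) (hym : ∀ j, AEStronglyMeasurable (y j) μ)
    (hexp : ∀ R δ : ℝ, 0 < δ → Integrable (fun x =>
      ‖w x‖ * Real.exp (R * ∑ j ∈ Finset.univ.erase top, ‖y j x‖ - δ * q x)) μ)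
    {t : σ → ℂ} (ht : (t top).re < 0) :
    DifferentiableAt ℂ (fun t : σ → ℂ => ∫ x, w x * Complex.exp (∑ j, t j * y j x) ∂μ) t := by
  obtain ⟨δ, hδ0, hδ⟩ : ∃ δ : ℝ, 0 < δ ∧ (t top).re < -(2 * δ) :=
    ⟨-(t top).re / 4, by linarith, by linarith⟩
  have hLm : AEStronglyMeasurable (fun x => dotForm fun j => y j x) μ :=
    Finset.aestronglyMeasurable_fun_sum _ fun j _ => (hym j).smul_const _
  have hs : {s : σ → ℂ | ‖s‖ < ‖t‖ + 1 ∧ (s top).re < -(2 * δ)} ∈ 𝓝 t := by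
    refine IsOpen.mem_nhds ?_ ⟨lt_add_one _, hδ⟩
    exact (isOpen_lt (continuous_norm (E := σ → ℂ)) continuous_const).inter
      (isOpen_lt (Complex.continuous_re.comp (continuous_apply top)) continuous_const)
  have hFm : ∀ s : σ → ℂ, AEStronglyMeasurable (fun x => w x * Complex.exp (∑ j, s j * y j x)) μ :=
    fun s => hw.mul (aestronglyMeasurable_exp_sum hym s)
  have hbound : ∀ᵐ x ∂μ, ∀ s ∈ {s : σ → ℂ | ‖s‖ < ‖t‖ + 1 ∧ (s top).re < -(2 * δ)},
      ‖(w x * Complex.exp (∑ j, s j * y j x)) • dotForm fun j => y j x‖ ≤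
        δ⁻¹ * (‖w x‖ * Real.exp
          ((‖t‖ + 1 + δ) * ∑ j ∈ Finset.univ.erase top, ‖y j x‖ - δ * q x)) := by
    refine Eventually.of_forall fun x s ⟨hs1, hs2⟩ => ?_
    rw [norm_smul, norm_mul, mul_assoc, mul_left_comm δ⁻¹]
    exact mul_le_mul_of_nonneg_left (norm_exp_sum_mul_dotForm_le hq hy hδ0
      (fun j => (norm_le_pi_norm s j).trans hs1.le) hs2.le x) (norm_nonneg (w x))
  have hdiff : ∀ᵐ x ∂μ, ∀ s ∈ {s : σ → ℂ | ‖s‖ < ‖t‖ + 1 ∧ (s top).re < -(2 * δ)},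
      HasFDerivAt (fun s : σ → ℂ => w x * Complex.exp (∑ j, s j * y j x))
        ((w x * Complex.exp (∑ j, s j * y j x)) • dotForm fun j => y j x) s :=
    Eventually.of_forall fun x s _ => hasFDerivAt_mul_exp_sum (w x) (fun j => y j x) s
  exact (hasFDerivAt_integral_of_dominated_of_fderiv_le hs
    (Eventually.of_forall hFm) (integrable_mul_exp_sum hq hy hw hym hexp ht) ((hFm t).smul hLm)
    hbound ((hexp _ δ hδ0).const_mul _) hdiff).differentiableAt

/-- An exponential integral is a convergent power series in the parameters other than
`t_top`. -/
theorem hasSum_integral_exp_sum (hy : ∀ x, y top x = q x)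
    (hw : AEStronglyMeasurable w μ) (hym : ∀ j, AEStronglyMeasurable (y j) μ)
    (hexp : ∀ R δ : ℝ, 0 < δ → Integrable (fun x =>
      ‖w x‖ * Real.exp (R * ∑ j ∈ Finset.univ.erase top, ‖y j x‖ - δ * q x)) μ)
    {t : σ → ℂ} (ht : (t top).re < 0) :
    HasSum (fun d : {d : σ →₀ ℕ // d top = 0} =>
        (∫ x, (w x * ∏ j, y j x ^ d.1 j / (d.1 j).factorial) * Complex.exp (t top * q x) ∂μ) *
          ∏ j, t j ^ d.1 j)
      (∫ x, w x * Complex.exp (∑ j, t j * y j x) ∂μ) := by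
  have hqm : AEStronglyMeasurable (fun x => (q x : ℂ)) μ :=
    (hym top).congr (Eventually.of_forall hy)
  have hyexp : AEStronglyMeasurable (fun x => Complex.exp (t top * q x)) μ :=
    Complex.continuous_exp.comp_aestronglyMeasurable (hqm.const_mul _)
  have hterm : ∀ (d : {d : σ →₀ ℕ // d top = 0}) (x : X),
      (w x * ∏ j, y j x ^ d.1 j / (d.1 j).factorial) * Complex.exp (t top * q x) *
          ∏ j, t j ^ d.1 j =
        w x * Complex.exp (t top * q x) * ∏ j, (t j * y j x) ^ d.1 j / (d.1 j).factorial := by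
    intro d x
    have : ∏ j, (t j * y j x) ^ d.1 j / ((d.1 j).factorial : ℂ) =
        (∏ j, y j x ^ d.1 j / ((d.1 j).factorial : ℂ)) * ∏ j, t j ^ d.1 j := by
      rw [← Finset.prod_mul_distrib]
      exact Finset.prod_congr rfl fun j _ => by rw [mul_pow]; ring
    rw [this]
    ring
  simp only [← integral_mul_const, hterm]
  have hb : ∀ x, HasSum (fun d : {d : σ →₀ ℕ // d top = 0} =>
      ‖w x‖ * Real.exp ((t top).re * q x) *
        ∏ j, (‖t j‖ * ‖y j x‖) ^ d.1 j / ((d.1 j).factorial : ℝ))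
      (‖w x‖ * Real.exp ((t top).re * q x) *
        Real.exp (∑ j ∈ Finset.univ.erase top, ‖t j‖ * ‖y j x‖)) := fun x =>
    (hasSum_prod_pow_div_factorial_of_ne_real top fun j => ‖t j‖ * ‖y j x‖).mul_left _
  refine hasSum_integral_of_dominated_convergence
    (fun (d : {d : σ →₀ ℕ // d top = 0}) x => ‖w x‖ * Real.exp ((t top).re * q x) *
      ∏ j, (‖t j‖ * ‖y j x‖) ^ d.1 j / ((d.1 j).factorial : ℝ)) (fun d => ?_) (fun d => ?_)
    (Eventually.of_forall fun x => (hb x).summable) ?_ (Eventually.of_forall fun x => ?_)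
  · exact (hw.mul hyexp).mul (Finset.aestronglyMeasurable_fun_prod _ fun j _ =>
      ((continuous_pow (d.1 j)).div_const _).comp_aestronglyMeasurable ((hym j).const_mul (t j)))
  · refine Eventually.of_forall fun x => le_of_eq ?_
    rw [norm_mul, norm_mul, norm_prod, Complex.norm_exp, Complex.re_mul_ofReal]
    simp only [norm_div, norm_pow, norm_mul, Complex.norm_natCast]
  · simp only [fun x => (hb x).tsum_eq]
    refine (hexp ‖t‖ (-(t top).re) (by linarith)).mono' ?_ (Eventually.of_forall fun x => ?_)
    · have hre : AEStronglyMeasurable (fun x => (t top).re * q x) μ := by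
        simpa using (Complex.continuous_re.comp_aestronglyMeasurable hqm).const_mul (t top).re
      exact (hw.norm.mul (Real.continuous_exp.comp_aestronglyMeasurable hre)).mul
        (Real.continuous_exp.comp_aestronglyMeasurable
          (Finset.aestronglyMeasurable_fun_sum _ fun j _ => (hym j).norm.const_mul _))
    · rw [Real.norm_of_nonneg (by positivity), mul_assoc, ← Real.exp_add]
      gcongr
      rw [Finset.mul_sum, sub_eq_add_neg, neg_mul, neg_neg, add_comm]
      gcongr with j
      exact norm_le_pi_norm t j
  · have h := (hasSum_prod_pow_div_factorial_of_ne top fun j => t j * y j x).mul_left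
      (w x * Complex.exp (t top * q x))
    have hs : ∑ j, t j * y j x = t top * q x + ∑ j ∈ Finset.univ.erase top, t j * y j x := by
      rw [← Finset.add_sum_erase _ _ (Finset.mem_univ top), hy]
    rwa [mul_assoc, ← Complex.exp_add, ← hs] at h

/-- The mixed expansion of an exponential integral has the moments as coefficients. -/
theorem isMixedExpansion_integral_exp_sum {Ω : Set ℂ} (hΩ : Ω ⊆ {z | z.re < 0})
    (hq : ∀ x, 0 ≤ q x) (hy : ∀ x, y top x = q x)
    (hw : AEStronglyMeasurable w μ) (hym : ∀ j, AEStronglyMeasurable (y j) μ)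
    (hexp : ∀ R δ : ℝ, 0 < δ → Integrable (fun x =>
      ‖w x‖ * Real.exp (R * ∑ j ∈ Finset.univ.erase top, ‖y j x‖ - δ * q x)) μ)
    (hmom : ∀ d : σ →₀ ℕ, Integrable (fun x => w x * ∏ j, y j x ^ d j / (d j).factorial) μ)
    {A : MvPowerSeries σ ℂ}
    (hA : ∀ d, MvPowerSeries.coeff d A = ∫ x, w x * ∏ j, y j x ^ d j / (d j).factorial ∂μ) :
    IsMixedExpansion top Ω (fun t => ∫ x, w x * Complex.exp (∑ j, t j * y j x) ∂μ) A := by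
  have hqm : AEMeasurable q μ := by
    have := Complex.measurable_re.comp_aemeasurable (hym top).aemeasurable
    simpa only [Function.comp_def, hy, Complex.ofReal_re] using this
  refine ⟨fun t ht => (differentiableAt_integral_exp_sum hq hy hw hym hexp
    (hΩ ht)).differentiableWithinAt, fun d z => ∫ x, (w x * ∏ j, y j x ^ d.1 j /
      ((d.1 j).factorial : ℂ)) * Complex.exp (z * q x) ∂μ,
    fun t ht => hasSum_integral_exp_sum hy hw hym hexp (hΩ ht),
    fun d => ?_⟩
  have hprod : ∀ (k : ℕ) (x : X), (w x * ∏ j, y j x ^ d.1 j / (d.1 j).factorial) *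
      ((q x : ℂ) ^ k / k.factorial) = w x * ∏ j, y j x ^ (d.1 + Finsupp.single top k) j /
        (((d.1 + Finsupp.single top k) j).factorial : ℂ) := by
    intro k x
    rw [mul_assoc, ← Finset.mul_prod_erase _ _ (Finset.mem_univ top),
      ← Finset.mul_prod_erase _ (fun j => y j x ^ (d.1 + Finsupp.single top k) j /
        (((d.1 + Finsupp.single top k) j).factorial : ℂ)) (Finset.mem_univ top),
      Finsupp.add_apply, d.2, Finsupp.single_eq_same, zero_add, hy, pow_zero, Nat.factorial_zero,
      Nat.cast_one, div_one, one_mul, mul_comm ((q x : ℂ) ^ k / _)]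
    congr 2
    refine Finset.prod_congr rfl fun j hj => ?_
    rw [Finsupp.add_apply, Finsupp.single_eq_of_ne (Finset.ne_of_mem_erase hj), add_zero]
  have h := isAsymptoticExpansion_integral_mul_exp (μ := μ) hΩ
    (g := fun x => w x * ∏ j, y j x ^ d.1 j / ((d.1 j).factorial : ℂ)) (q := q) (fun k => ?_) hqm hq
  · simp only [hprod, ← hA] at h
    exact h
  · have := (hmom (d.1 + Finsupp.single top k)).mul_const (k.factorial : ℂ)
    simp only [← hprod] at this
    refine this.congr (Eventually.of_forall fun x => ?_)
    have hk : (k.factorial : ℂ) ≠ 0 := Nat.cast_ne_zero.2 k.factorial_ne_zero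
    dsimp only
    rw [mul_assoc, div_mul_cancel₀ _ hk]

end ExponentialIntegral

/-! ### The expansion of the matrix integral -/

section MatrixIntegral

open MeasureTheory Filter

/-- The power sums of the eigenvalues. -/
theorem trace_pow_eq_sum_eigenvalues {ι : Type*} [Fintype ι] [DecidableEq ι] {M : Matrix ι ι ℂ}
    (hM : M.IsHermitian) (k : ℕ) : (M ^ k).trace = ∑ i, ((hM.eigenvalues i : ℝ) : ℂ) ^ k := by
  conv_lhs => rw [hM.spectral_theorem]
  rw [← map_pow, Matrix.diagonal_pow, Unitary.conjStarAlgAut_apply, Matrix.trace_mul_cycle,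
    Unitary.coe_star_mul_self, one_mul, Matrix.trace_diagonal]
  rfl

/-- A polynomial with negative leading term is bounded above on the half line. -/
theorem exists_sum_pow_sub_le {ι : Type*} (s : Finset ι) (e : ι → ℕ) {N : ℕ}
    (he : ∀ j ∈ s, e j < N) {R δ : ℝ} (hR : 0 ≤ R) (hδ : 0 < δ) :
    ∃ K : ℝ, ∀ a : ℝ, 0 ≤ a → R * ∑ j ∈ s, a ^ e j - δ * a ^ N ≤ K := by
  -- Beyond `B` the term `δ * a ^ N` dominates, and below `B` every power is at most `B ^ N`.
  set B : ℝ := max 1 (R * s.card / δ) with hB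
  have hB1 : 1 ≤ B := le_max_left _ _
  have hBδ : R * s.card ≤ δ * B := by
    rw [mul_comm δ, ← div_le_iff₀ hδ]
    exact le_max_right _ _
  refine ⟨R * (s.card * B ^ N), fun a ha => ?_⟩
  have hK : 0 ≤ R * (s.card * B ^ N) := by positivity
  rcases le_or_gt a B with hab | hab
  · have h1 : ∑ j ∈ s, a ^ e j ≤ s.card * B ^ N := by
      rw [← nsmul_eq_mul]
      refine Finset.sum_le_card_nsmul _ _ _ fun j hj => ?_
      exact (pow_le_pow_left₀ ha hab _).trans (pow_le_pow_right₀ hB1 (he j hj).le)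
    have h2 := mul_le_mul_of_nonneg_left h1 hR
    have h3 : 0 ≤ δ * a ^ N := by positivity
    linarith
  · have ha0 : 0 < a := by linarith
    have h1 : (∑ j ∈ s, a ^ e j) * a ≤ s.card * a ^ N := by
      rw [Finset.sum_mul, ← nsmul_eq_mul]
      refine Finset.sum_le_card_nsmul _ _ _ fun j hj => ?_
      rw [← pow_succ]
      exact pow_le_pow_right₀ (by linarith) (he j hj)
    have h2 : R * ∑ j ∈ s, a ^ e j ≤ δ * a ^ N := by
      refine le_of_mul_le_mul_right ?_ ha0
      have h3 : 0 ≤ a ^ N := by positivity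
      calc R * (∑ j ∈ s, a ^ e j) * a = R * ((∑ j ∈ s, a ^ e j) * a) := by ring
        _ ≤ R * (s.card * a ^ N) := mul_le_mul_of_nonneg_left h1 hR
        _ = R * s.card * a ^ N := by ring
        _ ≤ δ * B * a ^ N := mul_le_mul_of_nonneg_right hBδ h3
        _ ≤ δ * a * a ^ N := by gcongr
        _ = δ * a ^ N * a := by ring
    linarith

variable {n m : ℕ}

/-- The function `tr X^j / j`, whose coefficient in the potential is `t_j`. -/
def traceVar (j : ℕ) (x : HermitianCoord n) : ℂ := (hermitianMatrix x ^ j).trace / (j : ℂ)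

theorem polyGrowth_traceVar (j : ℕ) : PolyGrowth (traceVar (n := n) j) := by
  have h : ∀ i l : Fin n, PolyGrowth fun x : HermitianCoord n => (hermitianMatrix x ^ j) i l := by
    induction j with
    | zero =>
      intro i l
      simp only [pow_zero]
      exact PolyGrowth.const _
    | succ k ih =>
      intro i l
      simp only [pow_succ, Matrix.mul_apply]
      exact PolyGrowth.sum fun p _ => (ih i p).mul (polyGrowth_apply p l)
  change PolyGrowth fun x : HermitianCoord n => (hermitianMatrix x ^ j).trace / (j : ℂ)
  simp only [div_eq_mul_inv]
  exact (PolyGrowth.sum fun i _ => h i i).mul (PolyGrowth.const _)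

theorem traceVar_eq_sum (j : ℕ) (x : HermitianCoord n) : traceVar j x =
    ((∑ i, (isHermitian_hermitianMatrix x).eigenvalues i ^ j / j : ℝ) : ℂ) := by
  rw [traceVar, trace_pow_eq_sum_eigenvalues (isHermitian_hermitianMatrix x), Finset.sum_div]
  push_cast
  rfl

theorem traceVar_two_mul_eq (x : HermitianCoord n) :
    traceVar (2 * m) x = ((traceVar (2 * m) x).re : ℂ) := by
  rw [traceVar_eq_sum, Complex.ofReal_re]

theorem traceVar_two_mul_nonneg (x : HermitianCoord n) : 0 ≤ (traceVar (2 * m) x).re := by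
  rw [traceVar_eq_sum, Complex.ofReal_re]
  exact Finset.sum_nonneg fun i _ => div_nonneg (Even.pow_nonneg (even_two_mul m) _)
    (Nat.cast_nonneg _)

/-- The terms of lower degree of the potential are dominated by the top one. -/
theorem exists_sum_norm_traceVar_sub_le (n : ℕ) (hm : 2 ≤ m) (R : ℝ) {δ : ℝ} (hδ : 0 < δ) :
    ∃ K : ℝ, ∀ x : HermitianCoord n,
      R * ∑ j ∈ Finset.univ.erase (topVar m hm), ‖traceVar j.1 x‖ -
        δ * (traceVar (2 * m) x).re ≤ K := by
  have hm0 : (0 : ℝ) < (2 * m : ℕ) := by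
    rw [Nat.cast_pos]
    omega
  obtain ⟨K, hK⟩ := exists_sum_pow_sub_le (Finset.univ.erase (topVar m hm))
    (fun j : Set.Icc 3 (2 * m) => j.1) (N := 2 * m)
    (fun j hj => lt_of_le_of_ne j.2.2 fun h => Finset.ne_of_mem_erase hj (Subtype.ext h))
    (abs_nonneg R) (div_pos hδ hm0)
  refine ⟨n * K, fun x => ?_⟩
  set ev := (isHermitian_hermitianMatrix x).eigenvalues
  have h1 : ∀ j ∈ Finset.univ.erase (topVar m hm), ‖traceVar j.1 x‖ ≤ ∑ i, |ev i| ^ j.1 := by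
    intro j _
    rw [traceVar_eq_sum, Complex.norm_real]
    refine norm_sum_le_of_le _ fun i _ => ?_
    rw [norm_div, norm_pow, Real.norm_eq_abs, Real.norm_natCast]
    refine div_le_self (by positivity) ?_
    have := j.2.1
    exact_mod_cast (by omega : 1 ≤ j.1)
  have h2 : (traceVar (2 * m) x).re = ∑ i, |ev i| ^ (2 * m) / (2 * m : ℕ) := by
    rw [traceVar_eq_sum, Complex.ofReal_re]
    exact Finset.sum_congr rfl fun i _ => by rw [(even_two_mul m).pow_abs]
  calc _ ≤ |R| * ∑ j ∈ Finset.univ.erase (topVar m hm), ∑ i, |ev i| ^ j.1 -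
        δ * (traceVar (2 * m) x).re := by
        refine sub_le_sub_right ?_ _
        exact mul_le_mul (le_abs_self R) (Finset.sum_le_sum h1)
          (Finset.sum_nonneg fun _ _ => norm_nonneg _) (abs_nonneg R)
    _ = ∑ i, (|R| * ∑ j ∈ Finset.univ.erase (topVar m hm), |ev i| ^ j.1 -
          δ / (2 * m : ℕ) * |ev i| ^ (2 * m)) := by
        rw [h2, Finset.sum_comm, Finset.mul_sum, Finset.mul_sum, ← Finset.sum_sub_distrib]
        exact Finset.sum_congr rfl fun i _ => by ring
    _ ≤ ∑ _i : Fin n, K := Finset.sum_le_sum fun i _ => hK _ (abs_nonneg _)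
    _ = n * K := by simp

theorem matrixIntegrand_eq (t : Set.Icc 3 (2 * m) → ℂ) (x : HermitianCoord n) :
    matrixIntegrand n m t x = gaussianWeight x * Complex.exp (∑ j, t j * traceVar j.1 x) := by
  rw [matrixIntegrand, Matrix.trace_sum]
  congr 3
  funext j
  rw [Matrix.trace_smul, traceVar, smul_eq_mul]
  ring

theorem integrable_norm_gaussianWeight_mul_exp (n : ℕ) (hm : 2 ≤ m) (c : ℂ) (R δ : ℝ)
    (hδ : 0 < δ) : Integrable fun x : HermitianCoord n => ‖gaussianWeight x * c‖ *
      Real.exp (R * ∑ j ∈ Finset.univ.erase (topVar m hm), ‖traceVar j.1 x‖ -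
        δ * (traceVar (2 * m) x).re) := by
  obtain ⟨K, hK⟩ := exists_sum_norm_traceVar_sub_le n hm R hδ
  have hc : ∀ j, Continuous (traceVar (n := n) j) := fun j => (polyGrowth_traceVar j).1
  refine ((integrable_gaussianWeight (n := n)).mul_const c).norm.mul_bdd (c := Real.exp K) ?_
    (Eventually.of_forall fun x => ?_)
  · exact (Real.continuous_exp.comp ((continuous_const.mul (continuous_finsetSum _ fun j _ =>
      (hc j.1).norm)).sub (continuous_const.mul (Complex.continuous_re.comp
        (hc _))))).aestronglyMeasurable
  · rw [Real.norm_of_nonneg (Real.exp_pos _).le]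
    exact Real.exp_le_exp.2 (hK x)

theorem integrable_matrixIntegrand (n : ℕ) (hm : 2 ≤ m) {t : Set.Icc 3 (2 * m) → ℂ}
    (ht : (t (topVar m hm)).re < 0) : Integrable (matrixIntegrand n m t) := by
  have h := integrable_mul_exp_sum (μ := volume) (top := topVar m hm) (w := gaussianWeight (n := n))
    (y := fun j => traceVar j.1) (q := fun x => (traceVar (2 * m) x).re)
    traceVar_two_mul_nonneg traceVar_two_mul_eq continuous_gaussianWeight.aestronglyMeasurable
    (fun j => (polyGrowth_traceVar j.1).1.aestronglyMeasurable)
    (fun R δ hδ => by simpa using integrable_norm_gaussianWeight_mul_exp n hm 1 R δ hδ) ht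
  exact h.congr (Eventually.of_forall fun x => (matrixIntegrand_eq t x).symm)

theorem traceMonomial_eq {S : Set ℕ} [Fintype S] (d : S →₀ ℕ) (x : HermitianCoord n) :
    traceMonomial d x = ∏ j, traceVar j.1 x ^ d j / ((d j).factorial : ℂ) :=
  Finsupp.prod_fintype _ _ fun j => by simp

/-- The mixed expansion of the matrix integral is given by the sum over all ribbon graphs. -/
theorem isMixedExpansion_matrixIntegral (n : ℕ) (hm : 2 ≤ m) {Ω : Set ℂ}
    (hΩ : Ω ⊆ {z | z.re < 0}) :
    IsMixedExpansion (topVar m hm) Ω (matrixIntegral n m)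
      (MvPowerSeries.map (Polynomial.eval₂RingHom (algebraMap ℚ ℂ) (n : ℂ))
        (graphSeries (Set.Icc 3 (2 * m)))) := by
  set I := ∫ x : HermitianCoord n, gaussianWeight x with hI
  have hI0 : I ≠ 0 := integral_gaussianWeight_ne_zero
  have hZ : matrixIntegral n m = fun t => ∫ x : HermitianCoord n,
      gaussianWeight x * I⁻¹ * Complex.exp (∑ j, t j * traceVar j.1 x) := by
    funext t
    rw [matrixIntegral, ← hI, div_eq_mul_inv, ← integral_mul_const]
    simp only [matrixIntegrand_eq]
    exact integral_congr_ae (Eventually.of_forall fun x => mul_right_comm _ _ _)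
  rw [hZ]
  have hmom : ∀ (d : Set.Icc 3 (2 * m) →₀ ℕ) (x : HermitianCoord n),
      gaussianWeight x * I⁻¹ * ∏ j, traceVar j.1 x ^ d j / ((d j).factorial : ℂ) =
        traceMonomial d x * gaussianWeight x * I⁻¹ := fun d x => by
    rw [traceMonomial_eq]
    ring
  refine isMixedExpansion_integral_exp_sum (top := topVar m hm)
    (w := fun x : HermitianCoord n => gaussianWeight x * I⁻¹) (y := fun j => traceVar j.1)
    (q := fun x => (traceVar (2 * m) x).re) hΩ
    traceVar_two_mul_nonneg traceVar_two_mul_eq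
    (continuous_gaussianWeight.mul continuous_const).aestronglyMeasurable
    (fun j => (polyGrowth_traceVar j.1).1.aestronglyMeasurable)
    (integrable_norm_gaussianWeight_mul_exp n hm I⁻¹) (fun d => ?_) fun d => ?_
  · simp only [hmom, traceMonomial_eq]
    refine (PolyGrowth.integrable (PolyGrowth.prod fun j _ => ?_)).mul_const _
    simp only [div_eq_mul_inv]
    exact ((polyGrowth_traceVar j.1).pow _).mul (PolyGrowth.const _)
  · simp only [hmom]
    have hS : Set.Icc 3 (2 * m) ⊆ Set.Ici 2 := fun j hj => le_trans (by norm_num) hj.1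
    rw [integral_mul_const, ← eval_coeff_graphSeries hS d n,
      mul_assoc, mul_inv_cancel₀ hI0, mul_one, MvPowerSeries.coeff_map]

end MatrixIntegral

/-! ### Uniqueness of expansions -/

section Uniqueness

open Filter Topology

/-- An everywhere convergent power series in one variable with sum zero vanishes. -/
theorem eq_zero_of_hasSum_mul_pow {p : ℕ → ℂ} (h : ∀ s : ℂ, HasSum (fun k => s ^ k * p k) 0)
    (k : ℕ) : p k = 0 := by
  have hp : HasFPowerSeriesAt (fun _ : ℂ => (0 : ℂ)) (FormalMultilinearSeries.ofScalars ℂ p) 0 := by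
    rw [hasFPowerSeriesAt_iff]
    refine Eventually.of_forall fun s => ?_
    simpa only [FormalMultilinearSeries.coeff_ofScalars, smul_eq_mul] using h s
  have := hp.eq_zero
  rw [← FormalMultilinearSeries.coeff_ofScalars (𝕜 := ℂ) (p := p), this]
  rfl

/-- An everywhere convergent power series in several variables with sum zero vanishes: it is
expanded along each line through the origin, and its homogeneous parts vanish as functions. -/
theorem eq_zero_of_hasSum_mul_prod_pow {σ : Type*} [Fintype σ] {E : (σ →₀ ℕ) → ℂ}
    (h : ∀ t : σ → ℂ, HasSum (fun d => E d * ∏ j, t j ^ d j) 0) (d : σ →₀ ℕ) : E d = 0 := by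
  classical
  let P : ℕ → MvPolynomial σ ℂ := fun k =>
    ∑ d ∈ Finset.univ.finsuppAntidiag k, MvPolynomial.monomial d (E d)
  have hP : ∀ k t, MvPolynomial.eval t (P k) =
      ∑ d ∈ Finset.univ.finsuppAntidiag k, E d * ∏ j, t j ^ d j := fun k t => by
    simp only [P, map_sum, MvPolynomial.eval_monomial]
    exact Finset.sum_congr rfl fun d _ => by rw [Finsupp.prod_fintype _ _ fun j => pow_zero _]
  have hzero : ∀ k, P k = 0 := by
    intro k
    refine MvPolynomial.funext fun t => ?_
    rw [map_zero]
    refine eq_zero_of_hasSum_mul_pow (p := fun k => MvPolynomial.eval t (P k)) (fun s => ?_) k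
    have h1 := (h fun j => s * t j).tsum_fiberwise fun d : σ →₀ ℕ => ∑ j, d j
    have hterm : ∀ k, ∑' b : ↑((fun d : σ →₀ ℕ => ∑ j, d j) ⁻¹' {k}),
        E b.1 * ∏ j, (s * t j) ^ b.1 j = s ^ k * MvPolynomial.eval t (P k) := by
      intro k
      have hset : (fun d : σ →₀ ℕ => ∑ j, d j) ⁻¹' {k} =
          ((Finset.univ.finsuppAntidiag k : Finset (σ →₀ ℕ)) : Set (σ →₀ ℕ)) := by
        ext d
        simp
      rw [hset, Finset.tsum_subtype' (Finset.univ.finsuppAntidiag k)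
        fun d : σ →₀ ℕ => E d * ∏ j, (s * t j) ^ d j, hP, Finset.mul_sum]
      refine Finset.sum_congr rfl fun d hd => ?_
      rw [Finset.mem_finsuppAntidiag] at hd
      simp only [mul_pow]
      rw [Finset.prod_mul_distrib, Finset.prod_pow_eq_pow_sum, hd.1]
      ring
    simp only [hterm] at h1
    exact h1
  have hc := congrArg (MvPolynomial.coeff d) (hzero (∑ j, d j))
  rw [MvPolynomial.coeff_zero, MvPolynomial.coeff_sum, Finset.sum_eq_single d] at hc
  · rwa [MvPolynomial.coeff_monomial, if_pos rfl] at hc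
  · intro e _ he
    rw [MvPolynomial.coeff_monomial, if_neg he]
  · intro hd
    exact absurd (Finset.mem_finsuppAntidiag.2 ⟨rfl, Finset.subset_univ _⟩) hd

/-- Asymptotic expansions are unique. -/
theorem IsAsymptoticExpansion.unique {Ω : Set ℂ} [(𝓝[Ω] (0 : ℂ)).NeBot] (h0 : (0 : ℂ) ∉ Ω)
    {f g : ℂ → ℂ} {a b : ℕ → ℂ} (hf : IsAsymptoticExpansion Ω f a)
    (hg : IsAsymptoticExpansion Ω g b) (hfg : Set.EqOn f g Ω) (k : ℕ) : a k = b k := by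
  have key : ∀ {f : ℂ → ℂ} {a : ℕ → ℂ}, IsAsymptoticExpansion Ω f a →
      Tendsto f (𝓝[Ω] 0) (𝓝 (a 0)) := by
    intro f a hf
    have h1 := (hf.2 0).mul (tendsto_id.mono_left (nhdsWithin_le_nhds (s := Ω)))
    have h2 := h1.add_const (a 0)
    rw [show a (0 + 1) * 0 + a 0 = a 0 by ring] at h2
    refine h2.congr' ?_
    filter_upwards [self_mem_nhdsWithin] with z hz
    have hz0 : z ≠ 0 := fun h => h0 (h ▸ hz)
    simp [hz0]
  induction k using Nat.strong_induction_on with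
  | _ k ih =>
    cases k with
    | zero =>
      exact tendsto_nhds_unique_of_eventuallyEq (key hf) (key hg)
        (by filter_upwards [self_mem_nhdsWithin] with z hz using hfg hz)
    | succ m =>
      refine tendsto_nhds_unique_of_eventuallyEq (hf.2 m) (hg.2 m) ?_
      filter_upwards [self_mem_nhdsWithin] with z hz
      rw [hfg hz, Finset.sum_congr rfl fun v hv => by rw [ih v (Finset.mem_range.1 hv)]]

/-- Mixed expansions are unique. -/
theorem IsMixedExpansion.unique {σ : Type*} [Fintype σ] {top : σ} {Ω : Set ℂ}
    [(𝓝[Ω] (0 : ℂ)).NeBot] (h0 : (0 : ℂ) ∉ Ω) {Z : (σ → ℂ) → ℂ} {A B : MvPowerSeries σ ℂ}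
    (hA : IsMixedExpansion top Ω Z A) (hB : IsMixedExpansion top Ω Z B) : A = B := by
  classical
  obtain ⟨-, c, hc, hcA⟩ := hA
  obtain ⟨-, c', hc', hcB⟩ := hB
  have heq : ∀ d, Set.EqOn (c d) (c' d) Ω := by
    intro d z hz
    let E : (σ →₀ ℕ) → ℂ := fun d => if h : d top = 0 then c ⟨d, h⟩ z - c' ⟨d, h⟩ z else 0
    have hE : ∀ t : σ → ℂ, HasSum (fun d => E d * ∏ j, t j ^ d j) 0 := by
      intro t
      rw [← hasSum_subtype_iff_of_support_subset (s := {d : σ →₀ ℕ | d top = 0})]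
      · have ht : Function.update t top z top = z := Function.update_self _ _ _
        have h := (hc (Function.update t top z) (ht.symm ▸ hz)).sub
          (hc' (Function.update t top z) (ht.symm ▸ hz))
        rw [sub_self, ht] at h
        have hterm : ∀ d : {d : σ →₀ ℕ // d top = 0},
            c d z * ∏ j, Function.update t top z j ^ d.1 j -
              c' d z * ∏ j, Function.update t top z j ^ d.1 j = E d.1 * ∏ j, t j ^ d.1 j := by
          intro d
          rw [← sub_mul]
          simp only [E, dif_pos d.2]
          congr 1
          refine Finset.prod_congr rfl fun j _ => ?_
          by_cases hj : j = top
          · rw [hj, d.2, pow_zero, pow_zero]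
          · rw [Function.update_of_ne hj]
        simp only [hterm] at h
        exact h
      · intro d hd
        by_contra hne
        have hne' : ¬ d top = 0 := hne
        exact hd (by simp only [E, dif_neg hne', zero_mul])
    have := eq_zero_of_hasSum_mul_prod_pow hE d.1
    simp only [E, dif_pos d.2] at this
    exact sub_eq_zero.1 this
  ext d
  have h := (hcA ⟨d.erase top, Finsupp.erase_same⟩).unique h0
    (hcB ⟨d.erase top, Finsupp.erase_same⟩)
    (heq _) (d top)
  simpa only [Finsupp.erase_add_single] using h

end Uniqueness

theorem re_neg_of_mem_sector {ε : ℝ} (hε : 0 < ε) {z : ℂ} (hz : z ∈ sector ε) : z.re < 0 := by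
  obtain ⟨r, θ, hr, h1, h2, rfl⟩ := hz
  rw [Complex.re_ofReal_mul, Complex.exp_ofReal_mul_I_re]
  exact mul_neg_of_pos_of_neg hr
    (Real.cos_neg_of_pi_div_two_lt_of_lt (by linarith) (by linarith))

theorem neBot_nhdsWithin_sector {ε : ℝ} (hε : ε < Real.pi / 2) :
    (nhdsWithin (0 : ℂ) (sector ε)).NeBot := by
  rw [← mem_closure_iff_nhdsWithin_neBot, Metric.mem_closure_iff]
  intro δ hδ
  refine ⟨((δ / 2 : ℝ) : ℂ) * Complex.exp ((Real.pi : ℝ) * Complex.I),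
    ⟨δ / 2, Real.pi, half_pos hδ, by linarith, by linarith, rfl⟩, ?_⟩
  rw [dist_zero_left, norm_mul, Complex.norm_exp_ofReal_mul_I, mul_one, Complex.norm_real,
    Real.norm_of_nonneg (half_pos hδ).le]
  exact half_lt_self hδ

/-- Series over `ℚ[n]` that agree at all positive integers are equal. -/
theorem eq_of_map_eval₂_eq {σ : Type*} {A B : MvPowerSeries σ ℚ[X]}
    (h : ∀ n : ℕ, 1 ≤ n → MvPowerSeries.map (eval₂RingHom (algebraMap ℚ ℂ) (n : ℂ)) A =
      MvPowerSeries.map (eval₂RingHom (algebraMap ℚ ℂ) (n : ℂ)) B) : A = B := by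
  ext1 d
  refine Polynomial.eq_of_infinite_eval_eq _ _ (Set.infinite_of_injective_forall_mem
    (f := fun n : ℕ => ((n + 1 : ℕ) : ℚ)) (fun a b hab => ?_) fun n => ?_)
  · have := Nat.cast_injective hab
    omega
  · have h1 := congrArg (MvPowerSeries.coeff d) (h (n + 1) (Nat.le_add_left _ _))
    rw [MvPowerSeries.coeff_map, MvPowerSeries.coeff_map, coe_eval₂RingHom] at h1
    have hn : ((n + 1 : ℕ) : ℂ) = algebraMap ℚ ℂ ((n + 1 : ℕ) : ℚ) := (map_natCast _ _).symm
    rw [hn, eval₂_at_apply, eval₂_at_apply] at h1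
    exact (algebraMap ℚ ℂ).injective h1

/-- The generating series of ribbon graphs is the unique expansion of the matrix integral. -/
theorem isExpansionOfMatrixIntegral_iff {m : ℕ} (hm : 2 ≤ m)
    {A : MvPowerSeries (Set.Icc 3 (2 * m)) ℚ[X]} :
    IsExpansionOfMatrixIntegral m hm A ↔ A = graphSeries (Set.Icc 3 (2 * m)) := by
  have hex : IsExpansionOfMatrixIntegral m hm (graphSeries (Set.Icc 3 (2 * m))) :=
    fun n _ ε hε _ => isMixedExpansion_matrixIntegral n hm fun z hz => re_neg_of_mem_sector hε hz
  refine ⟨fun hA => eq_of_map_eval₂_eq fun n hn => ?_, fun h => h ▸ hex⟩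
  have hπ := Real.pi_pos
  have := neBot_nhdsWithin_sector (ε := Real.pi / 4) (by linarith)
  refine IsMixedExpansion.unique (fun h => ?_) (hA n hn (Real.pi / 4) (by linarith) (by linarith))
    (hex n hn (Real.pi / 4) (by linarith) (by linarith))
  exact lt_irrefl _ (re_neg_of_mem_sector (by linarith) h)

theorem theorem2p5 :
    -- the matrix integral converges and is normalized, and its asymptotic expansion exists
    (∀ n m : ℕ, ∀ hm : 2 ≤ m, ∀ ε : ℝ, 0 < ε → ∀ t : Set.Icc 3 (2 * m) → ℂ,
      t (topVar m hm) ∈ sector ε →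
        MeasureTheory.Integrable (matrixIntegrand n m t) MeasureTheory.volume) ∧
    (∀ n : ℕ, MeasureTheory.Integrable (gaussianWeight (n := n)) MeasureTheory.volume ∧
      (∫ x : HermitianCoord n, gaussianWeight x) ≠ 0) ∧
    (∀ m : ℕ, ∀ hm : 2 ≤ m, ∃! A, IsExpansionOfMatrixIntegral m hm A) ∧
    ∀ A : (m : ℕ) → MvPowerSeries (Set.Icc 3 (2 * m)) (Polynomial ℚ),
      (∀ m : ℕ, ∀ hm : 2 ≤ m, IsExpansionOfMatrixIntegral m hm (A m)) →
      -- the logarithm is the sum over connected ribbon graphs, and its regrouping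
      (∀ m : ℕ, 2 ≤ m →
        MvPowerSeries.constantCoeff (A m) = 1 ∧
        IsFormalSum
          (fun Γ : connectedGraphs (Set.Icc 3 (2 * m)) => Γ.1.out.term (Set.Icc 3 (2 * m)))
          (formalLog (A m)) ∧
        (∀ g s : ℕ, (connectedGraphsOfType (Set.Icc 3 (2 * m)) g s).Finite) ∧
        IsFormalSum
          (fun p : stableTypes => typeSum (Set.Icc 3 (2 * m)) p.1.1 p.1.2)
          (formalLog (A m))) ∧
      -- stability of the projections, and the limit
      (∀ j m m' : ℕ, 2 ≤ m → 2 ≤ m' → j ≤ 2 * m → j ≤ 2 * m' →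
        proj j (includeVars m (formalLog (A m))) = proj j (includeVars m' (formalLog (A m')))) ∧
      (∃! L, IsSeriesLimit (fun m => includeVars m (formalLog (A m))) L) ∧
      (∀ g s : ℕ, (connectedGraphsOfType (Set.Ici 3) g s).Finite) ∧
      ∀ L, IsSeriesLimit (fun m => includeVars m (formalLog (A m))) L →
        IsFormalSum (fun p : stableTypes => typeSum (Set.Ici 3) p.1.1 p.1.2) L := by
  refine ⟨fun n m hm ε hε t ht => integrable_matrixIntegrand n hm (re_neg_of_mem_sector hε ht),
    fun n => ⟨integrable_gaussianWeight, integral_gaussianWeight_ne_zero⟩,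
    fun m hm => ⟨_, (isExpansionOfMatrixIntegral_iff hm).2 rfl,
      fun A hA => (isExpansionOfMatrixIntegral_iff hm).1 hA⟩, fun A hA => ?_⟩
  have hlog : ∀ m, 2 ≤ m → formalLog (A m) = connectedSeries (Set.Icc 3 (2 * m)) := fun m hm => by
    rw [(isExpansionOfMatrixIntegral_iff hm).1 (hA m hm), formalLog_graphSeries (by simp)]
  have hsub : ∀ m, Set.Icc 3 (2 * m) ⊆ Set.Ici 3 := fun m => Set.Icc_subset_Ici_self
  have hL : IsSeriesLimit (fun m => includeVars m (formalLog (A m)))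
      (connectedSeries (Set.Ici 3)) := fun m hm => by
    dsimp only
    rw [hlog m hm]
    exact isSeriesLimit_connectedSeries m hm
  refine ⟨fun m hm => ⟨?_, ?_, finite_connectedGraphsOfType (hsub m), ?_⟩,
    fun j m m' hm hm' hj hj' => proj_eq_iff.2 fun d hd => ?_,
    ⟨_, hL, fun L h => h.unique hL⟩, finite_connectedGraphsOfType subset_rfl,
    fun L h => h.unique hL ▸ isFormalSum_typeSum subset_rfl⟩
  · rw [(isExpansionOfMatrixIntegral_iff hm).1 (hA m hm), constantCoeff_graphSeries]
  · rw [hlog m hm]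
    exact isFormalSum_connectedSeries _
  · rw [hlog m hm]
    exact isFormalSum_typeSum (hsub m)
  · rw [hlog m hm, hlog m' hm', coeff_includeVars_connectedSeries (hd.trans hj),
      coeff_includeVars_connectedSeries (hd.trans hj')]

end
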